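/- For $\tau\in\mathbb{C}$ with $\operatorname{Im}(\tau)>0$ and $u\in\mathbb{C}$ write $q^u=\exp(2\pi i\tau u)$, $\widetilde q^{\,u}=\exp(-2\pi i u/\tau)$, $q=q^1$, $\widetilde q=\widetilde q^{\,1}$. For $|p|<1$ let $(b;p)_\infty=\prod_{j=0}^{\infty}(1-bp^j)$, and define the $\tau$-shifted factorial, a meromorphic function of $z\in\mathbb{C}$, by $$[z;\tau]_\infty=\frac{(\exp(-2\pi i z);\widetilde q\,)_\infty}{(q^z;q)_\infty}.$$ Write $[b\pm z;\tau]_\infty=[b+z;\tau]_\infty\,[b-z;\tau]_\infty$ and $[b\pm z,c\pm w;\tau]_\infty=[b\pm z;\tau]_\infty\,[c\pm w;\tau]_\infty$. Let $\sqrt{\cdot}$ be the principal branch of the square root. Let $\operatorname{Im}(\tau)>0$, let $\tau_0,\tau_1,\tau_2,\tau_3,\tau_4\in\mathbb{C}$ satisfy $\operatorname{Im}(\tau_j)<0$ for $j=0,\ldots,4$, put $a=\tau_0+\tau_1+\tau_2+\tau_3+\tau_4$, and assume $\operatorname{Im}(a)>\operatorname{Im}(\tau^{-1})$. Then the following integral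 converges absolutely and $$\int_{-\infty}^{\infty}\frac{[1\pm 2x,\,a-4\pm x;\tau]_\infty}{\prod_{j=0}^4[\tau_j\pm x;\tau]_\infty}\,dx=\frac{2\,q^{-\frac1{24}}\,\widetilde q^{\,\frac1{24}}}{\sqrt{-i\tau}}\;\frac{\prod_{j=0}^4[a-\tau_j-3;\tau]_\infty}{\prod_{0\le k<m\le 4}[\tau_k+\tau_m-1;\tau]_\infty}.$$ -/

import Mathlib

namespace HyperbolicBeta

/-- The power `q ^ u`, where `q = exp (2 π i τ)`, with the convention `q ^ u = exp (2 π i τ u)`. -/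
noncomputable def qPow (τ u : ℂ) : ℂ :=
  Complex.exp (2 * Real.pi * Complex.I * τ * u)

/-- The power `q̃ ^ u`, where `q̃ = exp (- 2 π i / τ)`, with the convention
`q̃ ^ u = exp (- 2 π i u / τ)`. -/
noncomputable def qTildePow (τ u : ℂ) : ℂ :=
  Complex.exp (-(2 * Real.pi * Complex.I * u) / τ)

/-- The `q`-Pochhammer symbol `(a; q)_∞ = ∏_{j ≥ 0} (1 - a q ^ j)`, meant for `‖q‖ < 1`. -/
noncomputable def qPochhammer (a q : ℂ) : ℂ :=
  ∏' j : ℕ, (1 - a * q ^ j)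

/-- For `‖q‖ < 1` the infinite product defining the `q`-Pochhammer symbol converges, so that
`qPochhammer` is never the default value of `∏'` there. -/
theorem multipliable_qPochhammer (a : ℂ) {q : ℂ} (hq : ‖q‖ < 1) :
    Multipliable fun j : ℕ => 1 - a * q ^ j := by
  have h : Summable fun j : ℕ => ‖-(a * q ^ j)‖ := by
    simp only [norm_neg, norm_mul, norm_pow]
    exact (summable_geometric_of_lt_one (norm_nonneg q) hq).mul_left ‖a‖
  simpa [sub_eq_add_neg] using multipliable_one_add_of_summable h

/-- The `τ`-shifted factorial
`[z; τ]_∞ = (exp (- 2 π i z); q̃)_∞ / (q ^ z; q)_∞`, for `τ` in the upper half plane.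
It agrees with the meromorphic function of `z` so defined wherever the denominator does not
vanish. -/
noncomputable def tauFactorial (z τ : ℂ) : ℂ :=
  qPochhammer (Complex.exp (-(2 * Real.pi * Complex.I * z))) (qTildePow τ 1) /
    qPochhammer (qPow τ z) (qPow τ 1)

/-- The shorthand `[u ± z; τ]_∞ = [u + z; τ]_∞ [u - z; τ]_∞`. -/
noncomputable def tauFactorialPM (u z τ : ℂ) : ℂ :=
  tauFactorial (u + z) τ * tauFactorial (u - z) τ

/-- The integrand `[1 ± 2z, a - 4 ± z; τ]_∞ / ∏_{j=0}^4 [τ_j ± z; τ]_∞`, where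
`a = τ_0 + τ_1 + τ_2 + τ_3 + τ_4` and `t j` stands for `τ_j`. -/
noncomputable def nassrallahRahmanIntegrand (τ : ℂ) (t : Fin 5 → ℂ) (z : ℂ) : ℂ :=
  tauFactorialPM 1 (2 * z) τ * tauFactorialPM ((∑ j, t j) - 4) z τ /
    ∏ j, tauFactorialPM (t j) z τ

end HyperbolicBeta

section

set_option autoImplicit false

open Complex Filter Topology
open scoped Real

namespace HyperbolicBeta

/-! The integrand splits as a product of a base-$\tilde q$ part and a base-$q$ part
(`nassrallahRahmanIntegrand_eq`). The first, `trigWeight`, is the integrand of the trigonometric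
Nassrallah–Rahman integral in $z=e^{2\pi i x}$ with parameters $s_j=e^{-2\pi i\tau_j}$; it is
1-periodic in $x$ and unchanged by $\tau_j\mapsto\tau_j+1$. Only the second, `hypWeight`, feels such
shifts.

A single rational identity (`nassrallah_rahman_rational_identity`) shows that a combination of the
integrands at $\tau_i$ and $\tau_i+1$ equals $g(x)-g(x+1)$. Here $g$ does not decay: at $+\infty$ it
approaches a 1-periodic function. That function is holomorphic in $y=e^{-2\pi i x}$ on the closed
unit disc and vanishes at $y=0$, so its mean is zero. The condition on $\operatorname{Im}(a)$ enters
here, since it keeps the poles of that function outside the disc. Hence the integral of the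
combination vanishes (`integral_eq_zero_of_telescope`, `hypIntegral_update`), and the integral
divided by the base-$q$ part of its expected value, `hypNormalized`, is invariant under
$\tau_j\mapsto\tau_j+N$.

As $N\to\infty$, dominated convergence leaves `trigWeight` times
$1/\big((q^{1+2x};q)_\infty(q^{1-2x};q)_\infty\big)$. The sum of the last factor over integer
translates of $x$ is the constant $(q;q)_\infty$, by Jacobi's triple product
(`hasSum_hypLimitWeight`). So `hypNormalized` equals $(q;q)_\infty$ times the trigonometric integral
of base $\tilde q$ (`hypNormalized_eq`).

The trigonometric integral is evaluated by the same scheme (`trigIntegral_eq`): the same rational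
identity gives invariance under $s_i\mapsto p s_i$, and letting all $s_j\to0$ leaves a constant
term, which is $2/(p;p)_\infty$. The remaining constant $(q;q)_\infty/(\tilde q;\tilde q)_\infty$
comes from the modular transformation of the eta function (`qPochhammer_modular`). -/

/-! ### Basic analysis of $(a;q)_\infty$: zeros, holomorphy, limits. -/

theorem qPochhammer_eq_mul (a : ℂ) {q : ℂ} (hq : ‖q‖ < 1) :
    qPochhammer a q = (1 - a) * qPochhammer (a * q) q := by
  have h : Multipliable fun j : ℕ => 1 - a * q ^ (j + 1) := by
    simpa [pow_succ', mul_assoc] using multipliable_qPochhammer (a * q) hq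
  calc qPochhammer a q = (1 - a * q ^ 0) * ∏' j : ℕ, (1 - a * q ^ (j + 1)) :=
        tprod_eq_zero_mul' h
    _ = (1 - a) * qPochhammer (a * q) q := by
      rw [pow_zero, mul_one, qPochhammer]
      simp_rw [pow_succ', mul_assoc]

theorem qPochhammer_zero (q : ℂ) : qPochhammer 0 q = 1 := by
  simp [qPochhammer]

theorem qPochhammer_one {q : ℂ} (hq : ‖q‖ < 1) : qPochhammer 1 q = 0 := by
  rw [qPochhammer_eq_mul 1 hq]; simp

theorem qPochhammer_ne_zero {a q : ℂ} (hq : ‖q‖ < 1) (h : ∀ j : ℕ, a * q ^ j ≠ 1) :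
    qPochhammer a q ≠ 0 := by
  have h' : ∀ j : ℕ, 1 + -(a * q ^ j) ≠ 0 := fun j hj => h j (by linear_combination -hj)
  have := tprod_one_add_ne_zero_of_summable h' (by
    simp only [norm_neg, norm_mul, norm_pow]
    exact (summable_geometric_of_lt_one (norm_nonneg q) hq).mul_left ‖a‖)
  simpa [qPochhammer, sub_eq_add_neg] using this

theorem qPochhammer_ne_zero_of_norm_lt_one {a q : ℂ} (hq : ‖q‖ < 1) (ha : ‖a‖ < 1) :
    qPochhammer a q ≠ 0 := by
  refine qPochhammer_ne_zero hq fun j hj => ?_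
  have : ‖a * q ^ j‖ < 1 := by
    rw [norm_mul, norm_pow]
    exact (mul_le_of_le_one_right (norm_nonneg a) (pow_le_one₀ (norm_nonneg q) hq.le)).trans_lt ha
  rw [hj] at this
  simp at this

theorem differentiable_qPochhammer {q : ℂ} (hq : ‖q‖ < 1) :
    Differentiable ℂ fun a => qPochhammer a q := by
  have key : HasProdLocallyUniformlyOn (fun (n : ℕ) (a : ℂ) => 1 + -(a * q ^ n))
      (fun a => ∏' n : ℕ, (1 + -(a * q ^ n))) Set.univ := by
    apply hasProdLocallyUniformlyOn_of_forall_compact isOpen_univ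
    intro K _ hK
    obtain ⟨R, hR⟩ := hK.isBounded.exists_norm_le
    refine ((summable_geometric_of_lt_one (norm_nonneg q) hq).mul_left
      R).hasProdUniformlyOn_nat_one_add hK (.of_forall fun n x hx => ?_) (fun _ => by fun_prop)
    rw [norm_neg, norm_mul, norm_pow]
    exact mul_le_mul_of_nonneg_right (hR x hx) (by positivity)
  have := key.differentiableOn (.of_forall fun s => by
    simpa [Finset.prod_fn] using DifferentiableOn.finsetProd (fun _ _ => by fun_prop)) isOpen_univ
  simpa [qPochhammer, sub_eq_add_neg, differentiableOn_univ] using this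

theorem continuous_qPochhammer {q : ℂ} (hq : ‖q‖ < 1) : Continuous fun a => qPochhammer a q :=
  (differentiable_qPochhammer hq).continuous

theorem tendsto_qPochhammer_one {ι : Type*} {l : Filter ι} {q : ℂ} (hq : ‖q‖ < 1) {f : ι → ℂ}
    (hf : Tendsto f l (𝓝 0)) : Tendsto (fun i => qPochhammer (f i) q) l (𝓝 1) := by
  have := ((continuous_qPochhammer hq).tendsto 0).comp hf
  rwa [qPochhammer_zero] at this

theorem tendsto_prod_qPochhammer (a : ℂ) {q : ℂ} (hq : ‖q‖ < 1) :
    Tendsto (fun N : ℕ => ∏ k ∈ Finset.range N, (1 - a * q ^ k)) atTop (𝓝 (qPochhammer a q)) :=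
  (multipliable_qPochhammer a hq).hasProd.tendsto_prod_nat

theorem exists_norm_qPochhammer_pow_le {q : ℂ} (hq : ‖q‖ < 1) :
    ∃ C, ∀ n : ℕ, ‖qPochhammer (q ^ (n + 1)) q‖ ≤ C := by
  have h : Tendsto (fun n : ℕ => q ^ (n + 1)) atTop (𝓝 0) :=
    (tendsto_pow_atTop_nhds_zero_of_norm_lt_one hq).comp (tendsto_add_atTop_nat 1)
  obtain ⟨C, hC⟩ := (tendsto_qPochhammer_one hq h).norm.bddAbove_range
  exact ⟨C, fun n => hC ⟨n, rfl⟩⟩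

/-! ### Euler's expansions and Jacobi's triple product. -/

/-- Abel continuity at the origin along the geometric sequence `y q ^ N`. -/
theorem tendsto_tsum_mul_pow_geometric {c : ℕ → ℂ} {y q : ℂ} (hq : ‖q‖ < 1)
    (hs : Summable fun n => ‖c n * y ^ n‖) :
    Tendsto (fun N : ℕ => ∑' n, c n * (y * q ^ N) ^ n) atTop (𝓝 (c 0)) := by
  have h0 : ∑' n, c n * (0 : ℂ) ^ n = c 0 := by
    rw [tsum_eq_single 0]
    · simp
    · intro n hn; simp [hn]
  rw [← h0]
  refine tendsto_tsum_of_dominated_convergence hs (fun n => ?_) (.of_forall fun N n => ?_)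
  · have : Tendsto (fun N : ℕ => y * q ^ N) atTop (𝓝 0) := by
      simpa using (tendsto_pow_atTop_nhds_zero_of_norm_lt_one hq).const_mul y
    exact (this.pow n).const_mul (c n)
  · rw [mul_pow, ← mul_assoc, norm_mul]
    refine mul_le_of_le_one_right (norm_nonneg _) ?_
    rw [norm_pow, norm_pow]
    exact pow_le_one₀ (by positivity) (pow_le_one₀ (norm_nonneg q) hq.le)

theorem qPochhammer_pow_eq {q : ℂ} (hq : ‖q‖ < 1) (n : ℕ) :
    (1 - q ^ n) * qPochhammer (q ^ (n + 1)) q = qPochhammer (q ^ n) q := by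
  rw [qPochhammer_eq_mul (q ^ n) hq, pow_succ]

/-- Euler's expansion of `1 / (x; q)_∞`. -/
theorem hasSum_inv_qPochhammer {q x : ℂ} (hq : ‖q‖ < 1) (hx : ‖x‖ < 1) :
    (Summable fun n : ℕ => ‖qPochhammer (q ^ (n + 1)) q * x ^ n‖) ∧
    (∑' n : ℕ, qPochhammer (q ^ (n + 1)) q * x ^ n) * qPochhammer x q = qPochhammer q q := by
  obtain ⟨C, hC⟩ := exists_norm_qPochhammer_pow_le hq
  have hsum : ∀ x : ℂ, ‖x‖ < 1 → Summable fun n : ℕ => ‖qPochhammer (q ^ (n + 1)) q * x ^ n‖ := by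
    intro x hx
    refine Summable.of_nonneg_of_le (fun _ => norm_nonneg _) (fun n => ?_)
      ((summable_geometric_of_lt_one (norm_nonneg x) hx).mul_left C)
    rw [norm_mul, norm_pow]
    exact mul_le_mul_of_nonneg_right (hC n) (by positivity)
  refine ⟨hsum x hx, ?_⟩
  set F : ℂ → ℂ := fun x => ∑' n : ℕ, qPochhammer (q ^ (n + 1)) q * x ^ n with hF
  -- The coefficient $(q^{n+1};q)_\infty$ is $(q;q)_\infty/(q;q)_n$, written without division. Its
  -- recursion in $n$ gives this functional equation; iterating it along $xq^N\to0$ determines $F$.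
  have hrec : ∀ x : ℂ, ‖x‖ < 1 → F (x * q) = (1 - x) * F x := by
    intro x hx
    have hxq : ‖x * q‖ < 1 := by
      rw [norm_mul]; nlinarith [norm_nonneg x, norm_nonneg q]
    have h1 : F x - F (x * q) = x * F x := by
      simp only [hF]
      rw [← (hsum x hx).of_norm.tsum_sub (hsum _ hxq).of_norm, ← tsum_mul_left]
      have hs : Summable fun n : ℕ => (qPochhammer (q ^ (n + 1)) q * x ^ n -
          qPochhammer (q ^ (n + 1)) q * (x * q) ^ n) :=
        (hsum x hx).of_norm.sub (hsum _ hxq).of_norm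
      rw [hs.tsum_eq_zero_add]
      simp only [pow_zero, sub_self, zero_add]
      refine tsum_congr fun n => ?_
      rw [← qPochhammer_pow_eq hq (n + 1), mul_pow]
      ring
    linear_combination -h1
  have hiter : ∀ N : ℕ, F (x * q ^ N) = (∏ k ∈ Finset.range N, (1 - x * q ^ k)) * F x := by
    intro N
    induction N with
    | zero => simp
    | succ N ih =>
      have hxN : ‖x * q ^ N‖ < 1 := by
        rw [norm_mul, norm_pow]
        exact (mul_le_of_le_one_right (norm_nonneg x)
          (pow_le_one₀ (norm_nonneg q) hq.le)).trans_lt hx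
      rw [pow_succ, ← mul_assoc, hrec _ hxN, ih, Finset.prod_range_succ]
      ring
  have hlim := tendsto_tsum_mul_pow_geometric hq (hsum x hx)
  have hlim2 := (tendsto_prod_qPochhammer x hq).mul_const (F x)
  rw [← funext hiter] at hlim2
  have := tendsto_nhds_unique hlim hlim2
  rw [zero_add, pow_one] at this
  rw [this, mul_comm]

theorem norm_exp_two_pi_I_mul (w : ℂ) : ‖cexp (2 * π * I * w)‖ = Real.exp (-2 * π * w.im) := by
  rw [Complex.norm_exp]; simp

theorem norm_exp_two_pi_I_mul_lt_one {τ : ℂ} (hτ : 0 < τ.im) : ‖cexp (2 * π * I * τ)‖ < 1 := by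
  rw [norm_exp_two_pi_I_mul, Real.exp_lt_one_iff]
  nlinarith [Real.pi_pos]

/-- The term `(-1) ^ n q ^ (n (n - 1) / 2) y ^ n` of Jacobi's triple product, with
`q = exp (2 π i τ)` and `y = exp (2 π i w)`. -/
noncomputable def tripleTerm (τ w : ℂ) (n : ℤ) : ℂ :=
  jacobiTheta₂_term n (w + 1 / 2 - τ / 2) τ

theorem tripleTerm_succ (τ w : ℂ) (n : ℤ) :
    tripleTerm τ w (n + 1) = -cexp (2 * π * I * w) * tripleTerm τ (w + τ) n := by
  have : -cexp (2 * π * I * w) = cexp (2 * π * I * w + π * I) := by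
    rw [Complex.exp_add, Complex.exp_pi_mul_I]; ring
  rw [this, tripleTerm, tripleTerm, jacobiTheta₂_term, jacobiTheta₂_term, ← Complex.exp_add]
  congr 1
  push_cast
  ring

theorem tripleTerm_add (τ w v : ℂ) (n : ℤ) :
    tripleTerm τ (w + v) n = cexp (2 * π * I * v) ^ n * tripleTerm τ w n := by
  rw [← Complex.exp_int_mul, tripleTerm, tripleTerm, jacobiTheta₂_term, jacobiTheta₂_term,
    ← Complex.exp_add]
  congr 1
  ring

theorem summable_norm_tripleTerm {τ : ℂ} (hτ : 0 < τ.im) (w : ℂ) :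
    Summable fun n : ℤ => ‖tripleTerm τ w n‖ :=
  ((summable_jacobiTheta₂_term_iff (w + 1 / 2 - τ / 2) τ).mpr hτ).norm

/-- Euler's expansion of `(y; q)_∞`. -/
theorem hasSum_qPochhammer {τ : ℂ} (hτ : 0 < τ.im) (w : ℂ) :
    HasSum (fun n : ℕ => tripleTerm τ w n * qPochhammer (cexp (2 * π * I * τ) ^ (n + 1))
        (cexp (2 * π * I * τ)))
      (qPochhammer (cexp (2 * π * I * τ)) (cexp (2 * π * I * τ)) *
        qPochhammer (cexp (2 * π * I * w)) (cexp (2 * π * I * τ))) := by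
  set q := cexp (2 * π * I * τ) with hqdef
  have hq : ‖q‖ < 1 := norm_exp_two_pi_I_mul_lt_one hτ
  obtain ⟨C, hC⟩ := exists_norm_qPochhammer_pow_le hq
  have hsum : ∀ w, Summable fun n : ℕ => ‖tripleTerm τ w n * qPochhammer (q ^ (n + 1)) q‖ := by
    intro w
    refine Summable.of_nonneg_of_le (fun _ => norm_nonneg _) (fun n => ?_)
      (((summable_norm_tripleTerm hτ w).comp_injective
        (Nat.cast_injective (R := ℤ))).mul_right C)
    rw [norm_mul]
    exact mul_le_mul_of_nonneg_left (hC n) (norm_nonneg _)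
  set F : ℂ → ℂ := fun w => ∑' n : ℕ, tripleTerm τ w n * qPochhammer (q ^ (n + 1)) q with hF
  -- Same scheme as for the reciprocal: replacing $w$ by $w+\tau$ is $y\mapsto yq$, and $F$ tends to
  -- its constant term along $yq^N\to0$.
  have hrec : ∀ w, F w = (1 - cexp (2 * π * I * w)) * F (w + τ) := by
    intro w
    have h1 : F w - F (w + τ) = -cexp (2 * π * I * w) * F (w + τ) := by
      simp only [hF]
      rw [← (hsum w).of_norm.tsum_sub (hsum _).of_norm, ← tsum_mul_left]
      have hs := (hsum w).of_norm.sub (hsum (w + τ)).of_norm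
      rw [Summable.tsum_eq_zero_add (G := ℂ) hs]
      have h0 : tripleTerm τ (w + τ) 0 = tripleTerm τ w 0 := by
        rw [tripleTerm_add]; simp
      simp only [Nat.cast_zero, h0, sub_self, zero_add]
      refine tsum_congr fun n => ?_
      rw [← mul_assoc, ← tripleTerm_succ, tripleTerm_add, ← hqdef,
        ← qPochhammer_pow_eq hq (n + 1)]
      push_cast
      rw [show ((n : ℤ) + 1) = ((n + 1 : ℕ) : ℤ) by push_cast; ring, zpow_natCast]
      ring
    linear_combination h1
  have hiter : ∀ N : ℕ, F w = (∏ k ∈ Finset.range N, (1 - cexp (2 * π * I * w) * q ^ k)) *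
      F (w + N * τ) := by
    intro N
    induction N with
    | zero => simp
    | succ N ih =>
      rw [ih, hrec (w + N * τ), Finset.prod_range_succ]
      have : cexp (2 * π * I * (w + N * τ)) = cexp (2 * π * I * w) * q ^ N := by
        rw [hqdef, ← Complex.exp_nat_mul, ← Complex.exp_add]; congr 1; ring
      rw [this]
      push_cast
      rw [show w + (N + 1) * τ = w + N * τ + τ by ring]
      ring
  have hpow : ∀ N : ℕ, F (w + N * τ) =
      ∑' n : ℕ, (tripleTerm τ w n * qPochhammer (q ^ (n + 1)) q) * (1 * q ^ N) ^ n := by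
    intro N
    refine tsum_congr fun n => ?_
    rw [tripleTerm_add, zpow_natCast, one_mul, show 2 * π * I * (N * τ) = N * (2 * π * I * τ) by ring,
      Complex.exp_nat_mul, ← hqdef]
    ring
  have hlim : Tendsto (fun N : ℕ => F (w + N * τ)) atTop (𝓝 (qPochhammer q q)) := by
    have := tendsto_tsum_mul_pow_geometric (y := 1) hq (c := fun n : ℕ => tripleTerm τ w n *
      qPochhammer (q ^ (n + 1)) q) (by simpa using hsum w)
    rw [← funext hpow] at this
    simpa [tripleTerm, jacobiTheta₂_term] using this
  have h2 := (tendsto_prod_qPochhammer (cexp (2 * π * I * w)) hq).mul hlim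
  rw [← funext hiter] at h2
  have h3 : F w = _ := tendsto_nhds_unique tendsto_const_nhds h2
  rw [mul_comm, ← h3]
  exact (hsum w).of_norm.hasSum

/-- Makes the coefficients $(q^{n+1};q)_\infty$ vanish for $n<0$, so that Euler's series over
$\mathbb N$ can be read as a series over $\mathbb Z$. -/
theorem qPochhammer_zpow_eq_zero {q : ℂ} (hq : ‖q‖ < 1) (hq0 : q ≠ 0) (n : ℕ) :
    qPochhammer (q ^ (-(n : ℤ))) q = 0 := by
  induction n with
  | zero => simpa using qPochhammer_one hq
  | succ n ih =>
    rw [qPochhammer_eq_mul _ hq, ← zpow_add_one₀ hq0]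
    have : -((n + 1 : ℕ) : ℤ) + 1 = -(n : ℤ) := by push_cast; ring
    rw [this, ih, mul_zero]

/-- The theta function `(y; q)_∞ (q / y; q)_∞`. -/
noncomputable def qTheta (y q : ℂ) : ℂ := qPochhammer y q * qPochhammer (q / y) q

theorem qTheta_mul_left {y q : ℂ} (hq : ‖q‖ < 1) (hy : y ≠ 0) (hq0 : q ≠ 0) :
    qTheta y q = -y * qTheta (y * q) q := by
  unfold qTheta
  rw [qPochhammer_eq_mul y hq, show q / (y * q) = 1 / y by field_simp,
    qPochhammer_eq_mul (1 / y) hq, show 1 / y * q = q / y by ring]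
  field_simp
  ring

/-- Jacobi's triple product identity. -/
theorem jacobi_triple_product {τ : ℂ} (hτ : 0 < τ.im) (w : ℂ) :
    qPochhammer (cexp (2 * π * I * τ)) (cexp (2 * π * I * τ)) *
      qTheta (cexp (2 * π * I * w)) (cexp (2 * π * I * τ)) =
      jacobiTheta₂ (w + 1 / 2 - τ / 2) τ := by
  set q := cexp (2 * π * I * τ) with hqdef
  have hq : ‖q‖ < 1 := norm_exp_two_pi_I_mul_lt_one hτ
  have hq0 : q ≠ 0 := Complex.exp_ne_zero _
  -- In this half-plane $|q/y|<1$, so the bilateral theta series can be multiplied by Euler's series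
  -- for $1/(q/y;q)_\infty$; the product is then shown to be $(q;q)_\infty^2(y;q)_\infty$.
  have hsmall : ∀ w : ℂ, w.im < τ.im → qPochhammer q q * qTheta (cexp (2 * π * I * w)) q =
      ∑' n : ℤ, tripleTerm τ w n := by
    intro w hw
    set y := cexp (2 * π * I * w) with hy
    have hy0 : y ≠ 0 := Complex.exp_ne_zero _
    have hx : ‖q / y‖ < 1 := by
      rw [hy, hqdef, ← Complex.exp_sub, ← mul_sub]
      exact norm_exp_two_pi_I_mul_lt_one (by simpa using hw)
    obtain ⟨hs1, he1⟩ := hasSum_inv_qPochhammer hq hx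
    have hs0 := summable_norm_tripleTerm hτ w
    have hsp : Summable fun x : ℤ × ℕ => tripleTerm τ w x.1 *
        (qPochhammer (q ^ (x.2 + 1)) q * (q / y) ^ x.2) := (hs0.mul_norm hs1).of_norm
    have hprod := tsum_mul_tsum_of_summable_norm hs0 hs1
    -- After this shear of the double sum, the inner sum over `m` is Euler's series for
    -- $(q^{n+1};q)_\infty$, and the outer sum over `n` is again an Euler series.
    let e : ℤ × ℕ ≃ ℤ × ℕ :=
      { toFun := fun x => (x.1 + x.2, x.2)
        invFun := fun x => (x.1 - x.2, x.2)
        left_inv := fun x => by simp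
        right_inv := fun x => by simp }
    have hterm : ∀ (n : ℤ) (m : ℕ), tripleTerm τ w (n + m) *
        (qPochhammer (q ^ (m + 1)) q * (q / y) ^ m) =
        tripleTerm τ w n * (tripleTerm τ ((n + 1) * τ) m * qPochhammer (q ^ (m + 1)) q) := by
      intro n m
      have : tripleTerm τ w (n + m) * (q / y) ^ m =
          tripleTerm τ w n * tripleTerm τ ((n + 1) * τ) m := by
        rw [hy, hqdef, ← Complex.exp_sub, ← Complex.exp_nat_mul]
        simp only [tripleTerm, jacobiTheta₂_term, ← Complex.exp_add]
        congr 1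
        push_cast
        ring
      linear_combination qPochhammer (q ^ (m + 1)) q * this
    have hinner : ∀ n : ℤ, ∑' m : ℕ, tripleTerm τ w (n + m) *
        (qPochhammer (q ^ (m + 1)) q * (q / y) ^ m) =
        qPochhammer q q * (tripleTerm τ w n * qPochhammer (q ^ (n + 1)) q) := by
      intro n
      simp_rw [hterm n]
      have h := hasSum_qPochhammer hτ ((n + 1) * τ)
      rw [← hqdef] at h
      rw [tsum_mul_left, h.tsum_eq, show 2 * π * I * ((n + 1) * τ) = ((n + 1 : ℤ) : ℂ) *
        (2 * π * I * τ) by push_cast; ring, Complex.exp_int_mul, ← hqdef]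
      ring
    have hout : ∑' n : ℤ, tripleTerm τ w n * qPochhammer (q ^ (n + 1)) q =
        qPochhammer q q * qPochhammer y q := by
      have h := hasSum_qPochhammer hτ w
      rw [← hqdef] at h
      have hneg : ∀ n : ℕ, tripleTerm τ w (-(n + 1 : ℤ)) *
          qPochhammer (q ^ (-(n + 1 : ℤ) + 1)) q = 0 := by
        intro n
        rw [show -(n + 1 : ℤ) + 1 = -(n : ℤ) by ring, qPochhammer_zpow_eq_zero hq hq0, mul_zero]
      have h2 := HasSum.of_nat_of_neg_add_one (f := fun n : ℤ =>
        tripleTerm τ w n * qPochhammer (q ^ (n + 1)) q) (by exact_mod_cast h)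
        (by simp_rw [hneg]; exact hasSum_zero)
      simpa using h2.tsum_eq
    have h3 : (∑' n : ℤ, tripleTerm τ w n) *
        ∑' m : ℕ, qPochhammer (q ^ (m + 1)) q * (q / y) ^ m =
        qPochhammer q q * (qPochhammer q q * qPochhammer y q) := by
      have hspe := e.summable_iff.mpr hsp
      rw [hprod, ← e.tsum_eq, ← hout, ← tsum_mul_left]
      exact (Summable.tsum_prod hspe).trans (tsum_congr hinner)
    have hqq : qPochhammer q q ≠ 0 := qPochhammer_ne_zero_of_norm_lt_one hq hq
    apply mul_left_cancel₀ hqq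
    unfold qTheta
    linear_combination -qPochhammer (q / y) q * h3 + (∑' n : ℤ, tripleTerm τ w n) * he1
  have hshift : ∀ w : ℂ, ∑' n : ℤ, tripleTerm τ w n =
      -cexp (2 * π * I * w) * ∑' n : ℤ, tripleTerm τ (w + τ) n := by
    intro w
    rw [← tsum_mul_left, ← (Equiv.addRight (1 : ℤ)).tsum_eq]
    exact tsum_congr fun n => tripleTerm_succ τ w n
  -- Both sides obey the same quasi-periodicity under $w\mapsto w+\tau$, which carries the identity
  -- from the half-plane to all $w$.
  have hall : ∀ (N : ℕ) (w : ℂ), w.im < τ.im + N * τ.im → qPochhammer q q *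
      qTheta (cexp (2 * π * I * w)) q = ∑' n : ℤ, tripleTerm τ w n := by
    intro N
    induction N with
    | zero => intro w hw; exact hsmall w (by simpa using hw)
    | succ N ih =>
      intro w hw
      have h1 := ih (w - τ) (by push_cast at hw; simp only [sub_im]; linarith)
      rw [hshift (w - τ), sub_add_cancel, qTheta_mul_left hq (Complex.exp_ne_zero _) hq0, hqdef,
        ← Complex.exp_add, ← hqdef, show 2 * π * I * (w - τ) + 2 * π * I * τ = 2 * π * I * w by ring] at h1
      have h2 : -cexp (2 * π * I * (w - τ)) ≠ 0 := neg_ne_zero.mpr (Complex.exp_ne_zero _)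
      apply mul_left_cancel₀ h2
      linear_combination h1
  obtain ⟨N, hN⟩ := exists_nat_gt (w.im / τ.im)
  rw [div_lt_iff₀ hτ] at hN
  exact hall N w (by linarith)

/-! ### Modular transformations of theta and eta. -/

/-- Modular transformation of the theta function. -/
theorem exists_qTheta_modular {τ : ℂ} (hτ : 0 < τ.im) : ∃ κ : ℂ, κ ≠ 0 ∧ ∀ z : ℂ,
    qTheta (cexp (-(2 * π * I * z))) (qTildePow τ 1) =
      κ * cexp (π * I * (τ * z ^ 2 - (1 + τ) * z)) * qTheta (qPow τ z) (qPow τ 1) := by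
  have hτ0 : τ ≠ 0 := by rintro rfl; simp at hτ
  have hτ' : 0 < (-1 / τ).im := by
    rw [neg_div, one_div, neg_im, inv_im, neg_div, neg_neg]
    exact div_pos hτ (Complex.normSq_pos.mpr hτ0)
  set c : ℂ := 1 / (-I * τ) ^ (1 / 2 : ℂ) with hc
  have hc0 : c ≠ 0 := by
    rw [hc]
    refine one_div_ne_zero ?_
    rw [Complex.cpow_def_of_ne_zero (by simp [hτ0])]
    exact Complex.exp_ne_zero _
  have hq : qPow τ 1 = cexp (2 * π * I * τ) := by simp [qPow]
  have hp : qTildePow τ 1 = cexp (2 * π * I * (-1 / τ)) := by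
    rw [qTildePow]; congr 1; ring
  have hq1 := norm_exp_two_pi_I_mul_lt_one hτ
  have hp1 := norm_exp_two_pi_I_mul_lt_one hτ'
  have hQ : qPochhammer (cexp (2 * π * I * τ)) (cexp (2 * π * I * τ)) ≠ 0 :=
    qPochhammer_ne_zero_of_norm_lt_one hq1 hq1
  have hP : qPochhammer (cexp (2 * π * I * (-1 / τ))) (cexp (2 * π * I * (-1 / τ))) ≠ 0 :=
    qPochhammer_ne_zero_of_norm_lt_one hp1 hp1
  set Q := qPochhammer (cexp (2 * π * I * τ)) (cexp (2 * π * I * τ))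
  set P := qPochhammer (cexp (2 * π * I * (-1 / τ))) (cexp (2 * π * I * (-1 / τ)))
  refine ⟨Q / (P * c) * cexp (π * I * (1 + τ) ^ 2 / (4 * τ)), by
    simp [hQ, hP, hc0], fun z => ?_⟩
  have h1 := jacobi_triple_product hτ (τ * z)
  have h2 := jacobi_triple_product hτ' (-z)
  rw [show τ * z + 1 / 2 - τ / 2 = (τ * z - 1 / 2 - τ / 2) + 1 by ring,
    jacobiTheta₂_add_left, jacobiTheta₂_functional_equation, ← hc,
    ← jacobiTheta₂_neg_left] at h1
  rw [show -z + 1 / 2 - -1 / τ / 2 = -((τ * z - 1 / 2 - τ / 2) / τ) by field_simp; ring] at h2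
  rw [← h2] at h1
  rw [hq, hp, qPow, show -(2 * π * I * z) = 2 * π * I * -z by ring,
    show 2 * π * I * τ * z = 2 * π * I * (τ * z) by ring]
  set A := qTheta (cexp (2 * π * I * (τ * z))) (cexp (2 * π * I * τ))
  set T := qTheta (cexp (2 * π * I * -z)) (cexp (2 * π * I * (-1 / τ)))
  -- Completing the square: the $z$-independent term $(1+\tau)^2/(4\tau)$ is what was put into the
  -- constant $\kappa$.
  have h3 : cexp (-π * I * (τ * z - 1 / 2 - τ / 2) ^ 2 / τ) *
      (cexp (π * I * (1 + τ) ^ 2 / (4 * τ)) * cexp (π * I * (τ * z ^ 2 - (1 + τ) * z))) = 1 := by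
    rw [← Complex.exp_add, ← Complex.exp_add, ← Complex.exp_zero]
    congr 1
    field_simp
    ring
  set e1 := cexp (-π * I * (τ * z - 1 / 2 - τ / 2) ^ 2 / τ)
  set e2 := cexp (π * I * (1 + τ) ^ 2 / (4 * τ))
  set e3 := cexp (π * I * (τ * z ^ 2 - (1 + τ) * z))
  rw [show Q / (P * c) * e2 * e3 * A = e2 * e3 * (Q * A) / (P * c) by ring, h1,
    eq_div_iff (mul_ne_zero hP hc0)]
  linear_combination (-c * P * T) * h3

/-- The modular transformation of the Dedekind eta function in terms of Pochhammer symbols. -/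
theorem qPochhammer_modular {τ : ℂ} (hτ : 0 < τ.im) :
    qPochhammer (qPow τ 1) (qPow τ 1) / qPochhammer (qTildePow τ 1) (qTildePow τ 1) =
      qPow τ (-(1 / 24)) * qTildePow τ (1 / 24) / Complex.sqrt (-I * τ) := by
  have hτ0 : τ ≠ 0 := by rintro rfl; simp at hτ
  have hτ' : 0 < (-1 / τ).im := by
    rw [neg_div, one_div, neg_im, inv_im, neg_div, neg_neg]
    exact div_pos hτ (Complex.normSq_pos.mpr hτ0)
  have heta : ∀ z : ℂ, ModularForm.eta z = cexp (2 * π * I * z / 24) *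
      qPochhammer (cexp (2 * π * I * z)) (cexp (2 * π * I * z)) := by
    intro z
    rw [ModularForm.eta, qPochhammer, Function.Periodic.qParam]
    congr 1
    refine tprod_congr fun n => ?_
    rw [ModularForm.eta_q_eq_pow, pow_succ']
  have h := ModularForm.eta_comp_eq_csqrt_I_inv (x := τ) hτ
  simp only [Function.comp, Pi.smul_apply, Pi.mul_apply, smul_eq_mul] at h
  -- The principal root is multiplicative here: $-i\tau$ lies in the right half-plane, so adding
  -- $\arg i=\pi/2$ to its argument stays inside $(-\pi,\pi]$.
  have hsq : Complex.sqrt τ = Complex.sqrt I * Complex.sqrt (-I * τ) := by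
    have hse : ∀ {z : ℂ}, z ≠ 0 → Complex.sqrt z = cexp (Complex.log z / 2) := by
      intro z hz
      rw [Complex.sqrt, Complex.cpow_def_of_ne_zero hz, div_eq_mul_inv]
    have hre : 0 < (-I * τ).re := by simpa using hτ
    have harg := Complex.abs_arg_lt_pi_div_two_iff.mpr (Or.inl hre)
    rw [abs_lt] at harg
    have hlog : Complex.log τ = Complex.log I + Complex.log (-I * τ) := by
      rw [← Complex.log_mul I_ne_zero (by simp [hτ0]), ← mul_assoc]
      · simp
      · rw [Complex.arg_I]
        constructor <;> linarith [harg.1, harg.2, Real.pi_pos]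
    rw [hse hτ0, hse I_ne_zero,
      hse (by simp [hτ0]), hlog, ← Complex.exp_add, add_div]
  have hs0 : Complex.sqrt (-I * τ) ≠ 0 := by
    simp [Complex.sqrt, hτ0]
  have hI0 : Complex.sqrt I ≠ 0 := by simp [Complex.sqrt]
  rw [hsq, heta, heta] at h
  have hq : qPow τ 1 = cexp (2 * π * I * τ) := by simp [qPow]
  have hp : qTildePow τ 1 = cexp (2 * π * I * (-1 / τ)) := by
    rw [qTildePow]; congr 1; ring
  have hp1 := norm_exp_two_pi_I_mul_lt_one hτ'
  have hP : qPochhammer (cexp (2 * π * I * (-1 / τ))) (cexp (2 * π * I * (-1 / τ))) ≠ 0 :=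
    qPochhammer_ne_zero_of_norm_lt_one hp1 hp1
  rw [hq, hp, div_eq_div_iff hP hs0]
  have e1 : qTildePow τ (1 / 24) = cexp (2 * π * I * (-1 / τ) / 24) := by
    rw [qTildePow]; congr 1; ring
  have e2 : qPow τ (-(1 / 24)) * cexp (2 * π * I * τ / 24) = 1 := by
    rw [qPow, ← Complex.exp_add, show 2 * π * I * τ * -(1 / 24) + 2 * π * I * τ / 24 = 0 by ring,
      Complex.exp_zero]
  rw [inv_mul_eq_div, eq_div_iff hI0] at h
  have h' := mul_right_cancel₀ hI0 (h.trans (by ring : _ = (Complex.sqrt (-I * τ) *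
    (cexp (2 * π * I * τ / 24) * qPochhammer (cexp (2 * π * I * τ)) (cexp (2 * π * I * τ)))) *
      Complex.sqrt I))
  rw [e1]
  linear_combination -qPow τ (-(1 / 24)) * h' - (qPochhammer (cexp (2 * π * I * τ)) (cexp (2 * π * I * τ)) *
    Complex.sqrt (-I * τ)) * e2

/-! ### The rational identity behind both contiguous relations, and auxiliary facts. -/

/-- With $S=\prod_j s_j$ and $H(z)=s_i(1-Ss_i)\prod_j(1-s_jz)/\big(z(1-z^2)(1-Sz)\big)$ the right
side is $H(z)+H(1/z)$. In both settings a unit shift of the variable exchanges the two terms up to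
sign once the weight is attached, so the sum becomes a difference. -/
theorem nassrallah_rahman_rational_identity (s : Fin 5 → ℂ) (i : Fin 5) (z : ℂ) (hs : ∀ j, s j ≠ 0)
    (hz : z ≠ 0) (hz2 : 1 - z ^ 2 ≠ 0) (h1 : 1 - (∏ j, s j) * z ≠ 0)
    (h2 : 1 - (∏ j, s j) / z ≠ 0) :
    (∏ j : Fin 4, (1 - s i * s (i.succAbove j))) -
      (∏ j : Fin 4, (1 - (∏ j, s j) / s (i.succAbove j))) *
        ((1 - s i * z) * (1 - s i / z) / ((1 - (∏ j, s j) * z) * (1 - (∏ j, s j) / z))) =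
    s i * (1 - (∏ j, s j) * s i) * (∏ j, (1 - s j * z)) /
        (z * (1 - z ^ 2) * (1 - (∏ j, s j) * z)) -
      s i * (1 - (∏ j, s j) * s i) * z ^ 3 * (∏ j, (1 - s j / z)) /
        ((1 - z ^ 2) * (1 - (∏ j, s j) / z)) := by
  have hr : ∀ j, s (i.succAbove j) ≠ 0 := fun j => hs _
  have hi := hs i
  simp only [Fin.prod_univ_succAbove _ i, Fin.prod_univ_four] at h1 h2 ⊢
  have e0 := hr 0
  have e1 := hr 1
  have e2 := hr 2
  have e3 := hr 3
  generalize s i = u at *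
  generalize s (i.succAbove 0) = a at *
  generalize s (i.succAbove 1) = b at *
  generalize s (i.succAbove 2) = c at *
  generalize s (i.succAbove 3) = d at *
  rw [show u * (a * b * c * d) / a = u * b * c * d by field_simp,
    show u * (a * b * c * d) / b = u * a * c * d by field_simp,
    show u * (a * b * c * d) / c = u * a * b * d by field_simp,
    show u * (a * b * c * d) / d = u * a * b * c by field_simp]
  have hB : ∀ w, 1 - w / z = (z - w) / z := fun w => one_sub_div hz
  simp only [hB] at h2 ⊢
  have h2' : z - u * (a * b * c * d) ≠ 0 := fun h => h2 (by rw [h, zero_div])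
  -- The denominators are kept as atoms while clearing fractions and expanded only for the final
  -- `ring`.
  obtain ⟨X, hX⟩ : ∃ X, X = 1 - u * (a * b * c * d) * z := ⟨_, rfl⟩
  obtain ⟨Y, hY⟩ : ∃ Y, Y = z - u * (a * b * c * d) := ⟨_, rfl⟩
  obtain ⟨V, hV⟩ : ∃ V, V = 1 - z ^ 2 := ⟨_, rfl⟩
  rw [← hX] at h1 ⊢
  rw [← hY] at h2' ⊢
  rw [← hV] at hz2 ⊢
  field_simp
  rw [hX, hY, hV]
  ring

theorem exists_norm_qPochhammer_le {q : ℂ} (hq : ‖q‖ < 1) (R : ℝ) :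
    ∃ M, 0 < M ∧ ∀ a : ℂ, ‖a‖ ≤ R → ‖qPochhammer a q‖ ≤ M := by
  obtain ⟨M, hM⟩ := (isCompact_closedBall (0 : ℂ) R).exists_bound_of_continuousOn
    (continuous_qPochhammer hq).continuousOn
  exact ⟨max M 1, by positivity, fun a ha => (hM a (by simpa using ha)).trans (le_max_left _ _)⟩

theorem exists_le_norm_qPochhammer {q : ℂ} (hq : ‖q‖ < 1) {ρ : ℝ} (hρ : ρ < 1) :
    ∃ m, 0 < m ∧ ∀ a : ℂ, ‖a‖ ≤ ρ → m ≤ ‖qPochhammer a q‖ := by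
  have hne : ∀ a ∈ Metric.closedBall (0 : ℂ) ρ, qPochhammer a q ≠ 0 := fun a ha =>
    qPochhammer_ne_zero_of_norm_lt_one hq ((by simpa using ha : ‖a‖ ≤ ρ).trans_lt hρ)
  obtain ⟨M, hM⟩ := (isCompact_closedBall (0 : ℂ) ρ).exists_bound_of_continuousOn
    (f := fun a => (qPochhammer a q)⁻¹) ((continuous_qPochhammer hq).continuousOn.inv₀ hne)
  refine ⟨(max M 1)⁻¹, by positivity, fun a ha => ?_⟩
  have ha' : a ∈ Metric.closedBall (0 : ℂ) ρ := by simpa using ha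
  have h1 := (hM a ha').trans (le_max_left M 1)
  rw [norm_inv] at h1
  have h2 : 0 < ‖qPochhammer a q‖ := norm_pos_iff.mpr (hne a ha')
  exact (inv_le_comm₀ h2 (by positivity)).mp h1

/-- The product over all pairs `k < m` splits off the pairs containing a given index. -/
theorem prod_Ioi_succAbove (f : Fin 5 → Fin 5 → ℂ) (hf : ∀ k m, f k m = f m k) (i : Fin 5) :
    ∏ k, ∏ m ∈ Finset.Ioi k, f k m = (∏ j : Fin 4, f i (i.succAbove j)) *
      ∏ k : Fin 4, ∏ m ∈ Finset.Ioi k, f (i.succAbove k) (i.succAbove m) := by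
  have a0 : Finset.Ioi (0 : Fin 5) = {1, 2, 3, 4} := by decide
  have a1 : Finset.Ioi (1 : Fin 5) = {2, 3, 4} := by decide
  have a2 : Finset.Ioi (2 : Fin 5) = {3, 4} := by decide
  have a3 : Finset.Ioi (3 : Fin 5) = {4} := by decide
  have a4 : Finset.Ioi (4 : Fin 5) = ∅ := by decide
  have b0 : Finset.Ioi (0 : Fin 4) = {1, 2, 3} := by decide
  have b1 : Finset.Ioi (1 : Fin 4) = {2, 3} := by decide
  have b2 : Finset.Ioi (2 : Fin 4) = {3} := by decide
  have b3 : Finset.Ioi (3 : Fin 4) = ∅ := by decide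
  have h5 : ∏ k, ∏ m ∈ Finset.Ioi k, f k m = (f 0 1 * f 0 2 * f 0 3 * f 0 4) *
      (f 1 2 * f 1 3 * f 1 4) * (f 2 3 * f 2 4) * f 3 4 := by
    rw [Fin.prod_univ_five, a0, a1, a2, a3, a4]
    repeat rw [Finset.prod_insert (by decide)]
    simp only [Finset.prod_singleton, Finset.prod_empty]
    ring
  have h4 : ∀ g : Fin 4 → Fin 4 → ℂ, ∏ k, ∏ m ∈ Finset.Ioi k, g k m =
      (g 0 1 * g 0 2 * g 0 3) * (g 1 2 * g 1 3) * g 2 3 := by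
    intro g
    rw [Fin.prod_univ_four, b0, b1, b2, b3]
    repeat rw [Finset.prod_insert (by decide)]
    simp only [Finset.prod_singleton, Finset.prod_empty]
    ring
  rw [h5, h4 (fun k m => f (i.succAbove k) (i.succAbove m)), Fin.prod_univ_four]
  obtain rfl | rfl | rfl | rfl | rfl : i = 0 ∨ i = 1 ∨ i = 2 ∨ i = 3 ∨ i = 4 := by
    revert i; decide
  · rw [show (0 : Fin 5).succAbove 0 = 1 from rfl, show (0 : Fin 5).succAbove 1 = 2 from rfl,
      show (0 : Fin 5).succAbove 2 = 3 from rfl, show (0 : Fin 5).succAbove 3 = 4 from rfl]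
    ring
  · rw [show (1 : Fin 5).succAbove 0 = 0 from rfl, show (1 : Fin 5).succAbove 1 = 2 from rfl,
      show (1 : Fin 5).succAbove 2 = 3 from rfl, show (1 : Fin 5).succAbove 3 = 4 from rfl,
      hf 1 0]
    ring
  · rw [show (2 : Fin 5).succAbove 0 = 0 from rfl, show (2 : Fin 5).succAbove 1 = 1 from rfl,
      show (2 : Fin 5).succAbove 2 = 3 from rfl, show (2 : Fin 5).succAbove 3 = 4 from rfl,
      hf 2 0, hf 2 1]
    ring
  · rw [show (3 : Fin 5).succAbove 0 = 0 from rfl, show (3 : Fin 5).succAbove 1 = 1 from rfl,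
      show (3 : Fin 5).succAbove 2 = 2 from rfl, show (3 : Fin 5).succAbove 3 = 4 from rfl,
      hf 3 0, hf 3 1, hf 3 2]
    ring
  · rw [show (4 : Fin 5).succAbove 0 = 0 from rfl, show (4 : Fin 5).succAbove 1 = 1 from rfl,
      show (4 : Fin 5).succAbove 2 = 2 from rfl, show (4 : Fin 5).succAbove 3 = 3 from rfl,
      hf 4 0, hf 4 1, hf 4 2, hf 4 3]
    ring

/-- A function invariant under each one-coordinate map `φ` is invariant under applying `φ` to any
set of coordinates. -/
theorem eq_of_update_invariant {ι α β : Type*} [DecidableEq ι] {F : (ι → α) → β} {φ : α → α}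
    {G : (ι → α) → Prop} (h : ∀ s, G s → ∀ i, G (Function.update s i (φ (s i))) ∧
      F (Function.update s i (φ (s i))) = F s) {s : ι → α} (hs : G s) (T : Finset ι) :
    G (fun j => if j ∈ T then φ (s j) else s j) ∧
      F (fun j => if j ∈ T then φ (s j) else s j) = F s := by
  induction T using Finset.induction_on with
  | empty => simpa using hs
  | insert i T hi ih =>
    have : (fun j => if j ∈ insert i T then φ (s j) else s j) =
        Function.update (fun j => if j ∈ T then φ (s j) else s j) i
          (φ ((fun j => if j ∈ T then φ (s j) else s j) i)) := by
      funext j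
      by_cases hj : j = i
      · subst hj; simp [hi]
      · simp [Finset.mem_insert, hj]
    rw [this]
    obtain ⟨h1, h2⟩ := h _ ih.1 i
    exact ⟨h1, h2.trans ih.2⟩

/-! ### The trigonometric integral. -/

/-- The integrand of the trigonometric Nassrallah–Rahman integral. -/
noncomputable def trigWeight (p : ℂ) (s : Fin 5 → ℂ) (z : ℂ) : ℂ :=
  qPochhammer (z ^ 2) p * qPochhammer (1 / z ^ 2) p * qPochhammer ((∏ j, s j) * z) p *
    qPochhammer ((∏ j, s j) / z) p / ∏ j, (qPochhammer (s j * z) p * qPochhammer (s j / z) p)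

/-- The function whose difference telescopes the trigonometric Nassrallah–Rahman integral. -/
noncomputable def trigBoundary (p : ℂ) (s : Fin 5 → ℂ) (i : Fin 5) (z : ℂ) : ℂ :=
  s i * (1 - (∏ j, s j) * s i) * (qPochhammer (p * z ^ 2) p * qPochhammer (1 / z ^ 2) p *
    qPochhammer (p * (∏ j, s j) * z) p * qPochhammer ((∏ j, s j) / z) p) /
      (z * ∏ j, (qPochhammer (p * s j * z) p * qPochhammer (s j / z) p))

theorem prod_update_mul (s : Fin 5 → ℂ) (i : Fin 5) (p : ℂ) :
    ∏ j, Function.update s i (p * s i) j = p * ∏ j, s j := by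
  rw [Fin.prod_univ_succAbove _ i, Fin.prod_univ_succAbove s i]
  simp [mul_assoc]

/-- This is the rational identity multiplied by `trigWeight p s z`. Replacing $s_i$ by $ps_i$
changes each affected Pochhammer symbol by one linear factor, and the two terms on the right of the
identity become one function evaluated at $z$ and at $z/p$. -/
theorem trigWeight_sub {p : ℂ} (hp : ‖p‖ < 1) (hp0 : p ≠ 0) (s : Fin 5 → ℂ) (i : Fin 5)
    (hs : ∀ j, s j ≠ 0) (hs1 : ∀ j, ‖s j‖ < 1) {z : ℂ} (hz : ‖z‖ = 1) (hz2 : z ^ 2 ≠ 1) :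
    (∏ j : Fin 4, (1 - s i * s (i.succAbove j))) * trigWeight p s z -
      (∏ j : Fin 4, (1 - (∏ j, s j) / s (i.succAbove j))) *
        trigWeight p (Function.update s i (p * s i)) z =
    trigBoundary p s i z - trigBoundary p s i (z / p) := by
  have hz0 : z ≠ 0 := by rintro rfl; simp at hz
  have hS1 : ‖∏ j, s j‖ < 1 := by
    rw [norm_prod, Fin.prod_univ_succ]
    refine mul_lt_one_of_nonneg_of_lt_one_left (norm_nonneg _) (hs1 0) ?_
    exact Finset.prod_le_one (fun _ _ => norm_nonneg _) fun j _ => (hs1 _).le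
  have one_sub : ∀ a : ℂ, ‖a‖ < 1 → 1 - a * z ≠ 0 ∧ 1 - a / z ≠ 0 := by
    intro a ha
    constructor <;> intro h
    · have : ‖a * z‖ = 1 := by rw [← sub_eq_zero.mp h]; simp
      rw [norm_mul, hz] at this; linarith
    · have : ‖a / z‖ = 1 := by rw [← sub_eq_zero.mp h]; simp
      rw [norm_div, hz] at this; linarith
  have key := nassrallah_rahman_rational_identity s i z hs hz0 (sub_ne_zero.mpr hz2.symm)
    (one_sub _ hS1).1 (one_sub _ hS1).2
  obtain ⟨hX, hY⟩ := one_sub _ hS1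
  set S := ∏ j, s j with hS
  set D := ∏ j : Fin 4, (1 - s i * s (i.succAbove j))
  set E := ∏ j : Fin 4, (1 - S / s (i.succAbove j))
  have hA0 : ∏ j, (1 - s j * z) ≠ 0 := Finset.prod_ne_zero_iff.mpr fun j _ => (one_sub _ (hs1 j)).1
  have hA0' : ∏ j, (1 - s j / z) ≠ 0 :=
    Finset.prod_ne_zero_iff.mpr fun j _ => (one_sub _ (hs1 j)).2
  have hlt : ∀ a : ℂ, ‖a‖ < 1 → ‖p * a‖ < 1 := fun a ha => by
    rw [norm_mul]; exact mul_lt_one_of_nonneg_of_lt_one_left (norm_nonneg _) hp ha.le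
  have hM0 : ∏ j, qPochhammer (p * s j * z) p ≠ 0 := Finset.prod_ne_zero_iff.mpr fun j _ =>
    qPochhammer_ne_zero_of_norm_lt_one hp (by rw [norm_mul, hz, mul_one]; exact hlt _ (hs1 j))
  have hN0 : ∏ j, qPochhammer (p * s j / z) p ≠ 0 := Finset.prod_ne_zero_iff.mpr fun j _ =>
    qPochhammer_ne_zero_of_norm_lt_one hp (by rw [norm_div, hz, div_one]; exact hlt _ (hs1 j))
  have e1 : ∀ a : ℂ, qPochhammer (a * z) p = (1 - a * z) * qPochhammer (p * a * z) p := fun a => by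
    rw [qPochhammer_eq_mul _ hp]; ring_nf
  have e2 : ∀ a : ℂ, qPochhammer (a / z) p = (1 - a / z) * qPochhammer (p * a / z) p := fun a => by
    rw [qPochhammer_eq_mul _ hp]; ring_nf
  have e3 : qPochhammer (z ^ 2) p = (1 - z ^ 2) * qPochhammer (p * z ^ 2) p := by
    rw [qPochhammer_eq_mul _ hp]; ring_nf
  have e4 : qPochhammer (1 / z ^ 2) p = (1 - 1 / z ^ 2) * (1 - p / z ^ 2) *
      qPochhammer (p ^ 2 / z ^ 2) p := by
    rw [qPochhammer_eq_mul _ hp, qPochhammer_eq_mul _ hp]; ring_nf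
  have e5 : qPochhammer (p * (z / p) ^ 2) p = (1 - z ^ 2 / p) * (1 - z ^ 2) *
      qPochhammer (p * z ^ 2) p := by
    rw [show p * (z / p) ^ 2 = z ^ 2 / p by field_simp, qPochhammer_eq_mul _ hp,
      show z ^ 2 / p * p = z ^ 2 by field_simp, qPochhammer_eq_mul _ hp]; ring_nf
  set x := qPochhammer (p * z ^ 2) p
  set y := qPochhammer (p ^ 2 / z ^ 2) p
  set U := qPochhammer (p * S * z) p
  set V := qPochhammer (p * S / z) p
  set M := ∏ j, qPochhammer (p * s j * z) p
  set N := ∏ j, qPochhammer (p * s j / z) p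
  have w1 : trigWeight p s z = (1 - z ^ 2) * x * ((1 - 1 / z ^ 2) * (1 - p / z ^ 2) * y) *
      ((1 - S * z) * U) * ((1 - S / z) * V) /
        (((∏ j, (1 - s j * z)) * M) * ((∏ j, (1 - s j / z)) * N)) := by
    rw [trigWeight, ← hS, e3, e4, e1 S, e2 S, Finset.prod_mul_distrib]
    simp_rw [e1 (s _), e2 (s _)]
    rw [Finset.prod_mul_distrib, Finset.prod_mul_distrib]
  have w2 : trigWeight p (Function.update s i (p * s i)) z = (1 - z ^ 2) * x *
      ((1 - 1 / z ^ 2) * (1 - p / z ^ 2) * y) * U * V * ((1 - s i * z) * (1 - s i / z)) /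
        (((∏ j, (1 - s j * z)) * M) * ((∏ j, (1 - s j / z)) * N)) := by
    have hi : (1 - s i * z) * (1 - s i / z) ≠ 0 :=
      mul_ne_zero (one_sub _ (hs1 i)).1 (one_sub _ (hs1 i)).2
    have hd : ((∏ j, (1 - s j * z)) * M) * ((∏ j, (1 - s j / z)) * N) =
        (∏ j, (qPochhammer (Function.update s i (p * s i) j * z) p *
          qPochhammer (Function.update s i (p * s i) j / z) p)) *
          ((1 - s i * z) * (1 - s i / z)) := by
      rw [← Finset.prod_mul_distrib, ← Finset.prod_mul_distrib, ← Finset.prod_mul_distrib]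
      simp_rw [← e1, ← e2]
      rw [Fin.prod_univ_succAbove _ i, Fin.prod_univ_succAbove _ i]
      simp only [Function.update_self, ne_eq, Fin.succAbove_ne, not_false_eq_true,
        Function.update_of_ne]
      rw [e1 (s i), e2 (s i)]
      ring
    rw [hd, mul_div_mul_right _ _ hi, trigWeight, prod_update_mul, ← hS, e3, e4]
  have g1 : trigBoundary p s i z = s i * (1 - S * s i) * (x * ((1 - 1 / z ^ 2) * (1 - p / z ^ 2) * y)
      * U * ((1 - S / z) * V)) / (z * (M * ((∏ j, (1 - s j / z)) * N))) := by
    rw [trigBoundary, ← hS, e4, e2 S, Finset.prod_mul_distrib]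
    simp_rw [e2 (s _)]
    rw [Finset.prod_mul_distrib]
  have g2 : trigBoundary p s i (z / p) = s i * (1 - S * s i) * ((1 - z ^ 2 / p) * (1 - z ^ 2) * x *
      y * ((1 - S * z) * U) * V) / (z / p * ((∏ j, (1 - s j * z)) * M * N)) := by
    rw [trigBoundary, ← hS, e5, show 1 / (z / p) ^ 2 = p ^ 2 / z ^ 2 by field_simp,
      show p * S * (z / p) = S * z by field_simp, show S / (z / p) = p * S / z by field_simp, e1 S,
      Finset.prod_mul_distrib]
    have c1 : ∀ j, p * s j * (z / p) = s j * z := fun j => by field_simp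
    have c2 : ∀ j, s j / (z / p) = p * s j / z := fun j => by field_simp
    simp_rw [c1, c2, e1 (s _)]
    rw [Finset.prod_mul_distrib]
  set A := ∏ j, (1 - s j * z)
  set A' := ∏ j, (1 - s j / z)
  rw [w1, w2, g1, g2]
  have hv0 : 1 - z ^ 2 ≠ 0 := sub_ne_zero.mpr hz2.symm
  have h6 : 1 - 1 / z ^ 2 = -(1 - z ^ 2) / z ^ 2 := by field_simp; ring
  have h7 : 1 - z ^ 2 / p = -(z ^ 2 / p) * (1 - p / z ^ 2) := by field_simp; ring
  rw [h6, h7]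
  generalize 1 - S * z = X at *
  generalize 1 - S / z = Y at *
  generalize 1 - z ^ 2 = v at *
  generalize 1 - p / z ^ 2 = W at *
  generalize (1 - s i * z) * (1 - s i / z) = ii at *
  generalize s i * (1 - S * s i) = c at *
  have key' := congrArg (fun k => (v * x * (-v / z ^ 2 * W * y) * (X * U) * (Y * V) /
    (A * M * (A' * N))) * k) key
  convert key' using 1
  · field_simp
    ring
  · field_simp
    ring

theorem integral_mul_exp_eq_circleAverage (g : ℂ → ℂ) (c : ℂ) :
    ∫ x : ℝ in 0..1, g (c * cexp (2 * π * I * x)) = Real.circleAverage g 0 ‖c‖ := by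
  rw [Real.circleAverage_eq_integral_add (arg c)]
  have h := intervalIntegral.integral_comp_mul_left (a := 0) (b := 1)
    (fun θ : ℝ => g (circleMap 0 ‖c‖ (θ + arg c))) (c := 2 * π) (by positivity)
  rw [mul_zero, mul_one] at h
  rw [← h]
  refine intervalIntegral.integral_congr fun x _ => ?_
  simp only [circleMap, zero_add]
  congr 1
  conv_lhs => rw [← Complex.norm_mul_exp_arg_mul_I c]
  rw [mul_assoc, ← Complex.exp_add]
  congr 2
  push_cast
  ring

/-- Division by $p$ rotates and rescales the unit circle to radius $1/|p|$; the two circle averages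
agree because $g$ is holomorphic on the annulus between them. -/
theorem integral_circle_div {g : ℂ → ℂ} {p : ℂ} (hp : ‖p‖ < 1) (hp0 : p ≠ 0)
    (hg : ∀ z : ℂ, 1 ≤ ‖z‖ → ‖z‖ ≤ 1 / ‖p‖ → DifferentiableAt ℂ g z) :
    ∫ x : ℝ in 0..1, g (cexp (2 * π * I * x)) = ∫ x : ℝ in 0..1, g (cexp (2 * π * I * x) / p) := by
  have hp' : 0 < ‖p‖ := norm_pos_iff.mpr hp0
  have h1 := integral_mul_exp_eq_circleAverage g 1
  have h2 := integral_mul_exp_eq_circleAverage g (1 / p)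
  simp only [one_mul, norm_one, norm_div] at h1 h2
  simp only [one_div_mul_eq_div] at h2
  rw [h1, h2, Real.circleAverage_eq_circleIntegral (by norm_num),
    Real.circleAverage_eq_circleIntegral (by positivity)]
  congr 1
  symm
  refine circleIntegral_sub_center_inv_smul_eq_of_differentiable_on_annulus_off_countable
    (by norm_num) ((one_le_div hp').mpr hp.le) Set.countable_empty (fun z hz => ?_) (fun z hz => ?_)
  · simp only [Set.mem_sdiff, Metric.mem_closedBall, dist_zero_right, Metric.mem_ball, not_lt] at hz
    exact (hg z hz.2 hz.1).continuousAt.continuousWithinAt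
  · simp only [Set.mem_sdiff, Metric.mem_closedBall, dist_zero_right, Metric.mem_ball, not_le] at hz
    exact hg z hz.1.2.le hz.1.1.le

theorem norm_exp_two_pi_I_mul_ofReal (x : ℝ) : ‖cexp (2 * π * I * x)‖ = 1 := by
  rw [norm_exp_two_pi_I_mul]; simp

/-- The half-integers are exceptional: there $z^2=1$ in the rational identity and one of
$(q^{1\pm2x};q)_\infty$ may vanish. Pointwise identities are proved away from this null set. -/
theorem ae_two_mul_ne_int : ∀ᵐ x : ℝ, ∀ n : ℤ, 2 * x ≠ n := by
  filter_upwards [(Set.countable_range (fun n : ℤ => (n : ℝ) / 2)).ae_notMem MeasureTheory.volume]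
    with x hx n hn
  exact hx ⟨n, by simp only; linarith⟩

theorem exp_sq_ne_one {x : ℝ} (hx : ∀ n : ℤ, 2 * x ≠ n) : cexp (2 * π * I * x) ^ 2 ≠ 1 := by
  intro h
  rw [← Complex.exp_nat_mul, Complex.exp_eq_one_iff] at h
  obtain ⟨n, hn⟩ := h
  refine hx n ?_
  have h2 : (2 * x : ℂ) * (2 * π * I) = n * (2 * π * I) := by rw [← hn]; push_cast; ring
  have := mul_right_cancel₀ Complex.two_pi_I_ne_zero h2
  exact_mod_cast this

theorem continuous_trigWeight {p : ℂ} (hp : ‖p‖ < 1) {s : Fin 5 → ℂ} (hs1 : ∀ j, ‖s j‖ < 1) :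
    Continuous fun x : ℝ => trigWeight p s (cexp (2 * π * I * x)) := by
  have cP := continuous_qPochhammer hp
  have he : Continuous fun x : ℝ => cexp (2 * π * I * x) := by fun_prop
  have he0 : ∀ x : ℝ, cexp (2 * π * I * x) ≠ 0 := fun x => Complex.exp_ne_zero _
  have hn := norm_exp_two_pi_I_mul_ofReal
  unfold trigWeight
  refine Continuous.div ?_ ?_ ?_
  · exact (((cP.comp (he.pow 2)).mul (cP.comp (continuous_const.div (he.pow 2)
      fun x => pow_ne_zero 2 (he0 x)))).mul (cP.comp (continuous_const.mul he))).mul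
      (cP.comp (continuous_const.div he he0))
  · exact continuous_finsetProd _ fun j _ => (cP.comp (continuous_const.mul he)).mul
      (cP.comp (continuous_const.div he he0))
  · intro x
    refine Finset.prod_ne_zero_iff.mpr fun j _ => mul_ne_zero ?_ ?_
    · exact qPochhammer_ne_zero_of_norm_lt_one hp (by rw [norm_mul, hn, mul_one]; exact hs1 j)
    · exact qPochhammer_ne_zero_of_norm_lt_one hp (by rw [norm_div, hn, div_one]; exact hs1 j)

/-- On this annulus both $|ps_jz|$ and $|s_j/z|$ stay below 1, so no denominator vanishes. -/
theorem differentiableAt_trigBoundary {p : ℂ} (hp : ‖p‖ < 1) (hp0 : p ≠ 0) {s : Fin 5 → ℂ}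
    (hs1 : ∀ j, ‖s j‖ < 1) (i : Fin 5) {z : ℂ} (hz : 1 ≤ ‖z‖) (hz' : ‖z‖ ≤ 1 / ‖p‖) :
    DifferentiableAt ℂ (trigBoundary p s i) z := by
  have dP := differentiable_qPochhammer hp
  have hz0 : z ≠ 0 := by rintro rfl; simp at hz; linarith
  have hp' : 0 < ‖p‖ := norm_pos_iff.mpr hp0
  have comp : ∀ {f : ℂ → ℂ}, DifferentiableAt ℂ f z →
      DifferentiableAt ℂ (fun w => qPochhammer (f w) p) z := fun hf =>
    DifferentiableAt.comp z (dP _) hf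
  have d1 : DifferentiableAt ℂ (fun w : ℂ => 1 / w ^ 2) z := by
    fun_prop (disch := simpa using hz0)
  have d2 : ∀ a : ℂ, DifferentiableAt ℂ (fun w : ℂ => a / w) z := fun a => by
    fun_prop (disch := simpa using hz0)
  unfold trigBoundary
  refine DifferentiableAt.div ?_ ?_ ?_
  · exact ((((comp (by fun_prop)).mul (comp d1)).mul (comp (by fun_prop))).mul
      (comp (d2 _))).const_mul _
  · refine differentiableAt_id.mul (DifferentiableAt.fun_finsetProd fun j _ => ?_)
    exact (comp (by fun_prop)).mul (comp (d2 _))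
  · refine mul_ne_zero hz0 (Finset.prod_ne_zero_iff.mpr fun j _ => mul_ne_zero ?_ ?_)
    · refine qPochhammer_ne_zero_of_norm_lt_one hp ?_
      rw [norm_mul, norm_mul]
      rw [le_div_iff₀ hp'] at hz'
      calc ‖p‖ * ‖s j‖ * ‖z‖ = (‖z‖ * ‖p‖) * ‖s j‖ := by ring
        _ ≤ 1 * ‖s j‖ := mul_le_mul_of_nonneg_right hz' (norm_nonneg _)
        _ < 1 := by simpa using hs1 j
    · refine qPochhammer_ne_zero_of_norm_lt_one hp ?_
      rw [norm_div, div_lt_one (by linarith)]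
      exact (hs1 j).trans_le hz

/-- The trigonometric Nassrallah–Rahman integral. -/
noncomputable def trigIntegral (p : ℂ) (s : Fin 5 → ℂ) : ℂ :=
  ∫ x : ℝ in 0..1, trigWeight p s (cexp (2 * π * I * x))

theorem norm_update_mul_lt_one {p : ℂ} (hp : ‖p‖ < 1) {s : Fin 5 → ℂ} (hs1 : ∀ j, ‖s j‖ < 1)
    (i j : Fin 5) : ‖Function.update s i (p * s i) j‖ < 1 := by
  by_cases h : j = i
  · subst h
    rw [Function.update_self, norm_mul]
    exact mul_lt_one_of_nonneg_of_lt_one_left (norm_nonneg _) hp (hs1 j).le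
  · rw [Function.update_of_ne h]; exact hs1 j

theorem trigIntegral_update {p : ℂ} (hp : ‖p‖ < 1) (hp0 : p ≠ 0) {s : Fin 5 → ℂ}
    (hs : ∀ j, s j ≠ 0) (hs1 : ∀ j, ‖s j‖ < 1) (i : Fin 5) :
    (∏ j : Fin 4, (1 - s i * s (i.succAbove j))) * trigIntegral p s =
      (∏ j : Fin 4, (1 - (∏ j, s j) / s (i.succAbove j))) *
        trigIntegral p (Function.update s i (p * s i)) := by
  have hs1' := norm_update_mul_lt_one hp hs1 i
  have hb : ∀ z : ℂ, 1 ≤ ‖z‖ → ‖z‖ ≤ 1 / ‖p‖ → DifferentiableAt ℂ (trigBoundary p s i) z :=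
    fun z h h' => differentiableAt_trigBoundary hp hp0 hs1 i h h'
  have hn := norm_exp_two_pi_I_mul_ofReal
  have hp' : 0 < ‖p‖ := norm_pos_iff.mpr hp0
  have hle : 1 ≤ 1 / ‖p‖ := (one_le_div hp').mpr hp.le
  have c1 : Continuous fun x : ℝ => trigBoundary p s i (cexp (2 * π * I * x)) := by
    rw [continuous_iff_continuousAt]
    intro x
    exact ContinuousAt.comp (g := trigBoundary p s i) (f := fun x : ℝ => cexp (2 * π * I * x))
      (hb _ (hn x).ge ((hn x).trans_le hle)).continuousAt
      (by fun_prop : Continuous fun x : ℝ => cexp (2 * π * I * x)).continuousAt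
  have c2 : Continuous fun x : ℝ => trigBoundary p s i (cexp (2 * π * I * x) / p) := by
    rw [continuous_iff_continuousAt]
    intro x
    refine ContinuousAt.comp (g := trigBoundary p s i)
      (f := fun x : ℝ => cexp (2 * π * I * x) / p)
      (hb _ ?_ ?_).continuousAt ?_
    · rwa [norm_div, hn]
    · rw [norm_div, hn]
    · exact (by fun_prop : Continuous fun x : ℝ => cexp (2 * π * I * x) / p).continuousAt
  rw [trigIntegral, trigIntegral, ← sub_eq_zero, ← intervalIntegral.integral_const_mul,
    ← intervalIntegral.integral_const_mul, ← intervalIntegral.integral_sub]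
  · rw [intervalIntegral.integral_congr_ae (g := fun x : ℝ =>
      trigBoundary p s i (cexp (2 * π * I * x)) - trigBoundary p s i (cexp (2 * π * I * x) / p))]
    · rw [intervalIntegral.integral_sub (c1.intervalIntegrable _ _) (c2.intervalIntegrable _ _),
        integral_circle_div hp hp0 hb, sub_self]
    · filter_upwards [ae_two_mul_ne_int] with x hx _
      exact trigWeight_sub hp hp0 s i hs hs1 (hn x) (exp_sq_ne_one hx)
  · exact ((continuous_trigWeight hp hs1).const_mul _).intervalIntegrable _ _
  · exact ((continuous_trigWeight hp hs1').const_mul _).intervalIntegrable _ _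

/-- The trigonometric integral divided by its evaluation, up to a constant. -/
noncomputable def trigNormalized (p : ℂ) (s : Fin 5 → ℂ) : ℂ :=
  trigIntegral p s * (∏ k, ∏ m ∈ Finset.Ioi k, qPochhammer (s k * s m) p) /
    ∏ j, qPochhammer ((∏ k, s k) / s j) p

theorem norm_prod_div_lt_one {s : Fin 5 → ℂ} (hs1 : ∀ j, ‖s j‖ < 1) (j : Fin 5) :
    ‖(∏ k, s k) / s j‖ < 1 := by
  by_cases h : s j = 0
  · simp [h]
  rw [Fin.prod_univ_succAbove _ j, mul_div_cancel_left₀ _ h, norm_prod, Fin.prod_univ_succ]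
  exact mul_lt_one_of_nonneg_of_lt_one_left (norm_nonneg _) (hs1 _)
    (Finset.prod_le_one (fun _ _ => norm_nonneg _) fun j _ => (hs1 _).le)

/-- The products in `trigNormalized` mirror the contiguous relation: under $s_i\mapsto ps_i$ the
pairs containing $i$ lose the factors $1-s_is_j$, the symbols at $S/s_j$ with $j\ne i$ lose
$1-S/s_j$, and $S/s_i$ does not change. -/
theorem trigNormalized_update {p : ℂ} (hp : ‖p‖ < 1) (hp0 : p ≠ 0) {s : Fin 5 → ℂ}
    (hs : ∀ j, s j ≠ 0) (hs1 : ∀ j, ‖s j‖ < 1) (i : Fin 5) :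
    trigNormalized p (Function.update s i (p * s i)) = trigNormalized p s := by
  have key := trigIntegral_update hp hp0 hs hs1 i
  set s' := Function.update s i (p * s i) with hs'
  have hs'i : s' i = p * s i := by simp [hs']
  have hs'j : ∀ j, s' (i.succAbove j) = s (i.succAbove j) := by simp [hs']
  have hS' : ∏ j, s' j = p * ∏ j, s j := prod_update_mul s i p
  set S := ∏ j, s j with hS
  have hE : ∏ j : Fin 4, (1 - S / s (i.succAbove j)) ≠ 0 := by
    refine Finset.prod_ne_zero_iff.mpr fun j _ h => ?_
    have := norm_prod_div_lt_one hs1 (i.succAbove j)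
    rw [← hS, ← sub_eq_zero.mp h] at this
    simp at this
  have hpair : ∏ k, ∏ m ∈ Finset.Ioi k, qPochhammer (s k * s m) p =
      (∏ j : Fin 4, (1 - s i * s (i.succAbove j))) *
        ∏ k, ∏ m ∈ Finset.Ioi k, qPochhammer (s' k * s' m) p := by
    rw [prod_Ioi_succAbove (fun k m => qPochhammer (s k * s m) p) (fun k m => by rw [mul_comm]) i,
      prod_Ioi_succAbove (fun k m => qPochhammer (s' k * s' m) p) (fun k m => by rw [mul_comm]) i]
    simp only [hs'i, hs'j]
    have : ∀ j : Fin 4, qPochhammer (s i * s (i.succAbove j)) p =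
        (1 - s i * s (i.succAbove j)) * qPochhammer (p * s i * s (i.succAbove j)) p := fun j => by
      rw [qPochhammer_eq_mul _ hp]
      ring_nf
    simp_rw [this, Finset.prod_mul_distrib]
    ring
  have hden : ∏ j, qPochhammer (S / s j) p = (∏ j : Fin 4, (1 - S / s (i.succAbove j))) *
      ∏ j, qPochhammer ((∏ k, s' k) / s' j) p := by
    rw [hS', Fin.prod_univ_succAbove (fun j => qPochhammer (S / s j) p) i,
      Fin.prod_univ_succAbove (fun j => qPochhammer (p * S / s' j) p) i, hs'i, mul_div_mul_left _ _ hp0, mul_left_comm, ← Finset.prod_mul_distrib]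
    congr 1
    refine Finset.prod_congr rfl fun j _ => ?_
    rw [hs'j, qPochhammer_eq_mul _ hp]
    ring_nf
  have hden0 : ∏ j, qPochhammer ((∏ k, s' k) / s' j) p ≠ 0 :=
    Finset.prod_ne_zero_iff.mpr fun j _ => qPochhammer_ne_zero_of_norm_lt_one hp
      (norm_prod_div_lt_one (norm_update_mul_lt_one hp hs1 i) j)
  rw [trigNormalized, trigNormalized, ← hS, hpair, hden,
    div_eq_div_iff hden0 (mul_ne_zero hE hden0)]
  linear_combination (-(∏ k, ∏ m ∈ Finset.Ioi k, qPochhammer (s' k * s' m) p) *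
    ∏ j, qPochhammer ((∏ k, s' k) / s' j) p) * key

theorem trigNormalized_pow_mul {p : ℂ} (hp : ‖p‖ < 1) (hp0 : p ≠ 0) {s : Fin 5 → ℂ}
    (hs : ∀ j, s j ≠ 0) (hs1 : ∀ j, ‖s j‖ < 1) (N : ℕ) :
    trigNormalized p (fun j => p ^ N * s j) = trigNormalized p s := by
  induction N with
  | zero => simp
  | succ N ih =>
    rw [← ih]
    have hle : ‖p ^ N‖ ≤ 1 := by rw [norm_pow]; exact pow_le_one₀ (norm_nonneg p) hp.le
    have h := (eq_of_update_invariant (F := trigNormalized p) (φ := fun w => p * w)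
      (G := fun s => (∀ j, s j ≠ 0) ∧ ∀ j, ‖s j‖ < 1) (s := fun j => p ^ N * s j)
      (fun s hs i => ⟨⟨fun j => ?_, norm_update_mul_lt_one hp hs.2 i⟩,
        trigNormalized_update hp hp0 hs.1 hs.2 i⟩)
      ⟨fun j => mul_ne_zero (pow_ne_zero N hp0) (hs j), fun j => ?_⟩ Finset.univ).2
    · simpa [pow_succ', mul_assoc] using h
    · by_cases h : j = i
      · subst h; simpa using ⟨hp0, hs.1 j⟩
      · simpa [h] using hs.1 j
    · rw [norm_mul]
      exact (mul_le_of_le_one_left (norm_nonneg _) hle).trans_lt (hs1 j)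

theorem tendsto_trigIntegral_pow_mul {p : ℂ} (hp : ‖p‖ < 1) {s : Fin 5 → ℂ}
    (hs1 : ∀ j, ‖s j‖ < 1) :
    Tendsto (fun N : ℕ => trigIntegral p (fun j => p ^ N * s j)) atTop
      (𝓝 (∫ x : ℝ in 0..1, qPochhammer (cexp (2 * π * I * x) ^ 2) p *
        qPochhammer (1 / cexp (2 * π * I * x) ^ 2) p)) := by
  have hn := norm_exp_two_pi_I_mul_ofReal
  obtain ⟨M, hM0, hM⟩ := exists_norm_qPochhammer_le hp 1
  choose m hm0 hm using fun j => exists_le_norm_qPochhammer hp (hs1 j)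
  have hle : ∀ N : ℕ, ‖p ^ N‖ ≤ 1 := fun N => by
    rw [norm_pow]; exact pow_le_one₀ (norm_nonneg p) hp.le
  have hsN : ∀ (N : ℕ) j, ‖p ^ N * s j‖ ≤ ‖s j‖ := fun N j => by
    rw [norm_mul]; exact mul_le_of_le_one_left (norm_nonneg _) (hle N)
  have hSN : ∀ N : ℕ, ‖∏ j, p ^ N * s j‖ ≤ 1 := fun N => by
    rw [norm_prod]
    exact Finset.prod_le_one (fun _ _ => norm_nonneg _) fun j _ => (hsN N j).trans (hs1 j).le
  have hpN := tendsto_pow_atTop_nhds_zero_of_norm_lt_one hp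
  have hlim : ∀ (a z : ℂ), Tendsto (fun N : ℕ => qPochhammer (p ^ N * a * z) p) atTop (𝓝 1) :=
    fun a z => tendsto_qPochhammer_one hp (by simpa using (hpN.mul_const a).mul_const z)
  refine intervalIntegral.tendsto_integral_filter_of_dominated_convergence
    (fun _ => M ^ 4 / ∏ j, (m j * m j)) (.of_forall fun N => ?_) (.of_forall fun N => ?_)
    (by simp) ?_
  · exact (continuous_trigWeight hp fun j => (hsN N j).trans_lt (hs1 j)).aestronglyMeasurable
  · refine .of_forall fun x _ => ?_
    rw [trigWeight, norm_div, norm_mul, norm_mul, norm_mul, norm_prod]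
    have b1 := hM (cexp (2 * π * I * x) ^ 2) (by rw [norm_pow, hn]; norm_num)
    have b2 := hM (1 / cexp (2 * π * I * x) ^ 2) (by rw [norm_div, norm_pow, hn]; norm_num)
    have b3 := hM ((∏ j, p ^ N * s j) * cexp (2 * π * I * x)) (by
      rw [norm_mul, hn, mul_one]; exact hSN N)
    have b4 := hM ((∏ j, p ^ N * s j) / cexp (2 * π * I * x)) (by
      rw [norm_div, hn, div_one]; exact hSN N)
    refine div_le_div₀ (by positivity) ?_ (Finset.prod_pos fun j _ => mul_pos (hm0 j) (hm0 j)) ?_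
    · calc _ ≤ M * M * M * M := by gcongr
        _ = M ^ 4 := by ring
    · refine Finset.prod_le_prod (fun j _ => (mul_pos (hm0 j) (hm0 j)).le) fun j _ => ?_
      rw [norm_mul]
      refine mul_le_mul (hm j _ ?_) (hm j _ ?_) (hm0 j).le (norm_nonneg _)
      · rw [norm_mul, hn, mul_one]; exact hsN N j
      · rw [norm_div, hn, div_one]; exact hsN N j
  · refine .of_forall fun x _ => ?_
    set z := cexp (2 * π * I * x)
    have hS : Tendsto (fun N : ℕ => ∏ j, p ^ N * s j) atTop (𝓝 0) := by
      have : Tendsto (fun N : ℕ => ∏ j, p ^ N * s j) atTop (𝓝 (∏ j, 0 * s j)) :=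
        tendsto_finsetProd _ fun j _ => hpN.mul_const (s j)
      simpa using this
    have h1 : Tendsto (fun N : ℕ => qPochhammer ((∏ j, p ^ N * s j) * z) p) atTop (𝓝 1) :=
      tendsto_qPochhammer_one hp (by simpa using hS.mul_const z)
    have h2 : Tendsto (fun N : ℕ => qPochhammer ((∏ j, p ^ N * s j) / z) p) atTop (𝓝 1) :=
      tendsto_qPochhammer_one hp (by simpa using hS.div_const z)
    have h3 : Tendsto (fun N : ℕ => ∏ j, (qPochhammer (p ^ N * s j * z) p *
        qPochhammer (p ^ N * s j / z) p)) atTop (𝓝 (∏ j : Fin 5, (1 * 1))) :=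
      tendsto_finsetProd _ fun j _ => (hlim (s j) z).mul (by
        simpa [div_eq_mul_inv] using hlim (s j) z⁻¹)
    have := ((h1.const_mul (qPochhammer (z ^ 2) p * qPochhammer (1 / z ^ 2) p)).mul h2).div h3
      (by simp)
    simpa [trigWeight, Pi.div_def] using this

theorem integral_exp_two_pi_int (n : ℤ) :
    ∫ x : ℝ in 0..1, cexp (2 * π * I * n * x) = if n = 0 then 1 else 0 := by
  split_ifs with h
  · simp [h]
  · have hc : 2 * π * I * (n : ℂ) ≠ 0 := mul_ne_zero Complex.two_pi_I_ne_zero (by exact_mod_cast h)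
    rw [integral_exp_mul_complex hc]
    have : cexp (2 * π * I * n * (1 : ℝ)) = 1 := by
      rw [Complex.exp_eq_one_iff]; exact ⟨n, by push_cast; ring⟩
    rw [this]
    simp

/-- A constant-term computation: $(p;p)_\infty(z^2;p)_\infty(z^{-2};p)_\infty$ is $1-z^2$ times a
theta function of $z^{-2}$. In the triple product series only the terms $n=0$ and $n=1$ contribute
to $z^0$, each giving 1. -/
theorem integral_qPochhammer_sq {τ : ℂ} (hτ : 0 < τ.im) :
    qPochhammer (cexp (2 * π * I * τ)) (cexp (2 * π * I * τ)) *
      ∫ x : ℝ in 0..1, qPochhammer (cexp (2 * π * I * x) ^ 2) (cexp (2 * π * I * τ)) *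
        qPochhammer (1 / cexp (2 * π * I * x) ^ 2) (cexp (2 * π * I * τ)) = 2 := by
  set p := cexp (2 * π * I * τ) with hpdef
  have hp : ‖p‖ < 1 := norm_exp_two_pi_I_mul_lt_one hτ
  have hsum := summable_norm_tripleTerm hτ 0
  have hterm : ∀ x : ℝ, HasSum (fun n : ℤ => tripleTerm τ 0 n *
      (cexp (2 * π * I * (-2 * n : ℤ) * x) - cexp (2 * π * I * (2 - 2 * n : ℤ) * x)))
      (qPochhammer p p * (qPochhammer (cexp (2 * π * I * x) ^ 2) p *
        qPochhammer (1 / cexp (2 * π * I * x) ^ 2) p)) := by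
    intro x
    have e1 : cexp (2 * π * I * x) ^ 2 = cexp (2 * π * I * (2 * x)) := by
      rw [← Complex.exp_nat_mul]; congr 1; push_cast; ring
    have e2 : 1 / cexp (2 * π * I * x) ^ 2 = cexp (2 * π * I * (-2 * x)) := by
      rw [e1, one_div, ← Complex.exp_neg]; congr 1; ring
    have h : HasSum (tripleTerm τ (-2 * x)) _ :=
      hasSum_jacobiTheta₂_term (-2 * x + 1 / 2 - τ / 2) hτ
    rw [← jacobi_triple_product hτ, ← hpdef] at h
    have h2 := h.mul_left (1 - cexp (2 * π * I * (2 * x)))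
    have hfun : (fun n : ℤ => tripleTerm τ 0 n *
        (cexp (2 * π * I * (-2 * n : ℤ) * x) - cexp (2 * π * I * (2 - 2 * n : ℤ) * x))) =
        fun n => (1 - cexp (2 * π * I * (2 * x))) * tripleTerm τ (-2 * x) n := by
      funext n
      have h3 := tripleTerm_add τ 0 (-2 * x) n
      rw [zero_add, ← Complex.exp_int_mul] at h3
      rw [h3]
      have e3 : cexp (2 * π * I * (-2 * n : ℤ) * x) = cexp (n * (2 * π * I * (-2 * x))) := by
        congr 1; push_cast; ring
      have e4 : cexp (2 * π * I * (2 - 2 * n : ℤ) * x) =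
          cexp (2 * π * I * (2 * x)) * cexp (n * (2 * π * I * (-2 * x))) := by
        rw [← Complex.exp_add]; congr 1; push_cast; ring
      rw [e3, e4]
      ring
    have hval : qPochhammer p p * (qPochhammer (cexp (2 * π * I * x) ^ 2) p *
        qPochhammer (1 / cexp (2 * π * I * x) ^ 2) p) = (1 - cexp (2 * π * I * (2 * x))) *
          (qPochhammer p p * qTheta (cexp (2 * π * I * (-2 * x))) p) := by
      rw [e2, e1, qTheta, qPochhammer_eq_mul (cexp (2 * π * I * (2 * x))) hp]
      have e5 : p / cexp (2 * π * I * (-2 * x)) = cexp (2 * π * I * (2 * x)) * p := by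
        rw [div_eq_mul_inv, ← Complex.exp_neg, mul_comm]; congr 2; ring
      rw [e5]
      ring
    rw [hfun, hval]
    exact h2
  rw [← intervalIntegral.integral_const_mul]
  have hI : HasSum (fun n : ℤ => ∫ x : ℝ in 0..1, tripleTerm τ 0 n *
      (cexp (2 * π * I * (-2 * n : ℤ) * x) - cexp (2 * π * I * (2 - 2 * n : ℤ) * x)))
      (∫ x : ℝ in 0..1, qPochhammer p p * (qPochhammer (cexp (2 * π * I * x) ^ 2) p *
        qPochhammer (1 / cexp (2 * π * I * x) ^ 2) p)) := by
    refine intervalIntegral.hasSum_integral_of_dominated_convergence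
      (fun n _ => ‖tripleTerm τ 0 n‖ * 2) (fun n => ?_) (fun n => .of_forall fun x _ => ?_)
      (.of_forall fun x _ => hsum.mul_right 2) (by simp) (.of_forall fun x _ => hterm x)
    · exact (by fun_prop : Continuous _).aestronglyMeasurable
    · have hone : ∀ k : ℤ, ‖cexp (2 * π * I * k * x)‖ = 1 := fun k => by
        have := norm_exp_two_pi_I_mul_ofReal (k * x)
        rwa [ofReal_mul, ofReal_intCast, ← mul_assoc] at this
      rw [norm_mul]
      refine mul_le_mul_of_nonneg_left ((norm_sub_le _ _).trans ?_) (norm_nonneg _)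
      rw [hone, hone]; norm_num
  have hval : ∀ n : ℤ, ∫ x : ℝ in 0..1, tripleTerm τ 0 n *
      (cexp (2 * π * I * (-2 * n : ℤ) * x) - cexp (2 * π * I * (2 - 2 * n : ℤ) * x)) =
      (if n = 0 then 1 else 0) + (if n = 1 then 1 else 0) := by
    intro n
    rw [intervalIntegral.integral_const_mul, intervalIntegral.integral_sub
      ((by fun_prop : Continuous _).intervalIntegrable _ _)
      ((by fun_prop : Continuous _).intervalIntegrable _ _), integral_exp_two_pi_int,
      integral_exp_two_pi_int]
    have h0 : tripleTerm τ 0 0 = 1 := by simp [tripleTerm, jacobiTheta₂_term]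
    have h1 : tripleTerm τ 0 1 = -1 := by
      have := tripleTerm_succ τ 0 0
      rw [tripleTerm_add, h0] at this
      simpa using this
    by_cases hn0 : n = 0
    · subst hn0; simp [h0]
    by_cases hn1 : n = 1
    · subst hn1; simp [h1]
    · have a2 : 2 - 2 * n ≠ 0 := by omega
      simp [hn0, hn1, a2]
  simp_rw [hval] at hI
  have h2 : HasSum (fun n : ℤ => (if n = 0 then (1 : ℂ) else 0) + (if n = 1 then 1 else 0))
      (1 + 1) := (hasSum_ite_eq 0 1).add (hasSum_ite_eq 1 1)
  rw [hI.unique h2]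
  norm_num

/-- The trigonometric Nassrallah–Rahman integral. -/
theorem trigIntegral_eq {τ : ℂ} (hτ : 0 < τ.im) {s : Fin 5 → ℂ}
    (hs : ∀ j, s j ≠ 0) (hs1 : ∀ j, ‖s j‖ < 1) :
    qPochhammer (cexp (2 * π * I * τ)) (cexp (2 * π * I * τ)) *
      trigNormalized (cexp (2 * π * I * τ)) s = 2 := by
  refine Eq.trans ?_ (integral_qPochhammer_sq hτ)
  congr 1
  set p := cexp (2 * π * I * τ) with hpdef
  have hp : ‖p‖ < 1 := norm_exp_two_pi_I_mul_lt_one hτ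
  have hp0 : p ≠ 0 := Complex.exp_ne_zero _
  have hpN := tendsto_pow_atTop_nhds_zero_of_norm_lt_one hp
  have h1 := tendsto_trigIntegral_pow_mul hp hs1
  have h2 : Tendsto (fun N : ℕ => ∏ k, ∏ m ∈ Finset.Ioi k,
      qPochhammer ((p ^ N * s k) * (p ^ N * s m)) p) atTop
      (𝓝 (∏ k : Fin 5, ∏ m ∈ Finset.Ioi k, 1)) :=
    tendsto_finsetProd _ fun k _ => tendsto_finsetProd _ fun m _ =>
      tendsto_qPochhammer_one hp (by simpa using (hpN.mul_const (s k)).mul (hpN.mul_const (s m)))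
  have h3 : Tendsto (fun N : ℕ => ∏ j, qPochhammer ((∏ k, p ^ N * s k) / (p ^ N * s j)) p) atTop
      (𝓝 (∏ j : Fin 5, 1)) := by
    refine tendsto_finsetProd _ fun j _ => tendsto_qPochhammer_one hp ?_
    have : ∀ N : ℕ, (∏ k, p ^ N * s k) / (p ^ N * s j) =
        ∏ k : Fin 4, p ^ N * s (j.succAbove k) := fun N => by
      rw [Fin.prod_univ_succAbove _ j,
        mul_div_cancel_left₀ _ (mul_ne_zero (pow_ne_zero N hp0) (hs j))]
    simp_rw [this]
    have h : Tendsto (fun N : ℕ => ∏ k : Fin 4, p ^ N * s (j.succAbove k)) atTop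
        (𝓝 (∏ k : Fin 4, 0 * s (j.succAbove k))) :=
      tendsto_finsetProd _ fun k _ => hpN.mul_const _
    simpa using h
  have h4 := (h1.mul h2).div h3 (by simp)
  simp only [Finset.prod_const_one, mul_one, div_one] at h4
  refine tendsto_nhds_unique ?_ h4
  -- The sequence along $p^Ns$ is constant, so its value is its limit at zero parameters.
  have : (fun N : ℕ => trigNormalized p (fun j => p ^ N * s j)) = fun _ => trigNormalized p s :=
    funext fun N => trigNormalized_pow_mul hp hp0 hs hs1 N
  have hc : Tendsto (fun N : ℕ => trigNormalized p (fun j => p ^ N * s j)) atTop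
      (𝓝 (trigNormalized p s)) := by rw [this]; exact tendsto_const_nhds
  exact hc

/-! ### Powers of $q$ and $\tilde q$, and the zeros of $(q^w;q)_\infty$. -/

theorem qPow_add (τ u v : ℂ) : qPow τ (u + v) = qPow τ u * qPow τ v := by
  rw [qPow, qPow, qPow, ← Complex.exp_add]; congr 1; ring

theorem qPow_ne_zero (τ u : ℂ) : qPow τ u ≠ 0 := Complex.exp_ne_zero _

theorem qPow_sub (τ u v : ℂ) : qPow τ (u - v) = qPow τ u / qPow τ v := by
  rw [eq_div_iff (qPow_ne_zero τ v), ← qPow_add, sub_add_cancel]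

theorem qPow_zero (τ : ℂ) : qPow τ 0 = 1 := by simp [qPow]

theorem qPow_nat_mul (τ u : ℂ) (n : ℕ) : qPow τ (n * u) = qPow τ u ^ n := by
  rw [qPow, qPow, ← Complex.exp_nat_mul]; congr 1; ring

theorem qPow_sum {ι : Type*} (τ : ℂ) (s : Finset ι) (f : ι → ℂ) :
    qPow τ (∑ j ∈ s, f j) = ∏ j ∈ s, qPow τ (f j) := by
  simp only [qPow, Finset.mul_sum, Complex.exp_sum]

theorem norm_qPow (τ u : ℂ) : ‖qPow τ u‖ = Real.exp (-(2 * π * (τ * u).im)) := by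
  rw [qPow, mul_assoc _ τ u, norm_exp_two_pi_I_mul]; congr 1; ring

theorem norm_qPow_one_lt_one {τ : ℂ} (hτ : 0 < τ.im) : ‖qPow τ 1‖ < 1 := by
  simpa [qPow] using norm_exp_two_pi_I_mul_lt_one hτ

theorem neg_one_div_im_pos {τ : ℂ} (hτ : 0 < τ.im) : 0 < (-1 / τ).im := by
  rw [neg_div, one_div, neg_im, inv_im, neg_div, neg_neg]
  exact div_pos hτ (Complex.normSq_pos.mpr (by rintro rfl; simp at hτ))

theorem qTildePow_one (τ : ℂ) : qTildePow τ 1 = cexp (2 * π * I * (-1 / τ)) := by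
  rw [qTildePow]; congr 1; ring

theorem norm_qTildePow_one_lt_one {τ : ℂ} (hτ : 0 < τ.im) : ‖qTildePow τ 1‖ < 1 := by
  rw [qTildePow_one]; exact norm_exp_two_pi_I_mul_lt_one (neg_one_div_im_pos hτ)

theorem norm_qTildePow_one (τ : ℂ) : ‖qTildePow τ 1‖ = Real.exp (2 * π * (τ⁻¹).im) := by
  rw [qTildePow_one, norm_exp_two_pi_I_mul]; congr 1
  rw [neg_div, one_div, neg_im]; ring

/-- The shifted factorial `(q ^ w; q)_∞`. -/
noncomputable def qFac (τ w : ℂ) : ℂ := qPochhammer (qPow τ w) (qPow τ 1)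

theorem qFac_eq_mul {τ : ℂ} (hτ : 0 < τ.im) (w : ℂ) :
    qFac τ w = (1 - qPow τ w) * qFac τ (w + 1) := by
  rw [qFac, qPochhammer_eq_mul _ (norm_qPow_one_lt_one hτ), ← qPow_add, ← qFac]

theorem continuous_qFac {τ : ℂ} (hτ : 0 < τ.im) : Continuous (qFac τ) :=
  (continuous_qPochhammer (norm_qPow_one_lt_one hτ)).comp (by unfold qPow; fun_prop)

theorem tendsto_qPow_add_ofReal {τ : ℂ} (hτ : 0 < τ.im) (w : ℂ) :
    Tendsto (fun x : ℝ => qPow τ (w + x)) atTop (𝓝 0) := by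
  rw [tendsto_zero_iff_norm_tendsto_zero]
  have : ∀ x : ℝ, ‖qPow τ (w + x)‖ = ‖qPow τ w‖ * Real.exp (-(2 * π * τ.im * x)) := fun x => by
    rw [qPow_add, norm_mul, norm_qPow τ x]; congr 2; simp; ring
  simp_rw [this]
  rw [← mul_zero ‖qPow τ w‖]
  refine Tendsto.const_mul _ (Real.tendsto_exp_neg_atTop_nhds_zero.comp ?_)
  exact tendsto_id.const_mul_atTop (by positivity)

theorem tendsto_qFac_add_ofReal {τ : ℂ} (hτ : 0 < τ.im) (w : ℂ) :
    Tendsto (fun x : ℝ => qFac τ (w + x)) atTop (𝓝 1) :=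
  tendsto_qPochhammer_one (norm_qPow_one_lt_one hτ) (tendsto_qPow_add_ofReal hτ w)

theorem tendsto_qFac_add_nat {τ : ℂ} (hτ : 0 < τ.im) (w : ℂ) :
    Tendsto (fun N : ℕ => qFac τ (w + N)) atTop (𝓝 1) := by
  simpa [Function.comp_def] using (tendsto_qFac_add_ofReal hτ w).comp tendsto_natCast_atTop_atTop

/-- A point which avoids the lines through the lattice points `n / τ` parallel to the real axis,
in the strips next to the real axis. -/
def OffLattice (τ w : ℂ) : Prop := w.im ≠ 0 ∧ |w.im| < -(τ⁻¹).im

theorem OffLattice.neg {τ w : ℂ} (h : OffLattice τ w) : OffLattice τ (-w) := by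
  simpa [OffLattice] using h

theorem OffLattice.congr {τ w v : ℂ} (h : OffLattice τ w) (hv : v.im = w.im) :
    OffLattice τ v := by
  rw [OffLattice, hv]; exact h

theorem qPow_eq_one {τ w : ℂ} (hτ : 0 < τ.im) (h : qPow τ w = 1) : ∃ n : ℤ, w = n * τ⁻¹ := by
  have hτ0 : τ ≠ 0 := by rintro rfl; simp at hτ
  rw [qPow, Complex.exp_eq_one_iff] at h
  obtain ⟨n, hn⟩ := h
  refine ⟨n, ?_⟩
  have : (τ * w) * (2 * π * I) = n * (2 * π * I) := by rw [← hn]; ring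
  rw [← mul_right_cancel₀ Complex.two_pi_I_ne_zero this]
  field_simp

/-- $q^w=1$ only at $w=n/\tau$, whose imaginary part is a multiple of $\operatorname{Im}(1/\tau)$;
the strips in `OffLattice` contain no such value. -/
theorem OffLattice.qPow_ne_one {τ w : ℂ} (hτ : 0 < τ.im) (h : OffLattice τ w) : qPow τ w ≠ 1 := by
  intro h1
  obtain ⟨n, rfl⟩ := qPow_eq_one hτ h1
  obtain ⟨h2, h3⟩ := h
  rw [← ofReal_intCast, im_ofReal_mul] at h2 h3
  have hn : n ≠ 0 := by rintro rfl; simp at h2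
  have hn' : (1 : ℝ) ≤ |(n : ℝ)| := by exact_mod_cast Int.one_le_abs hn
  rw [abs_mul] at h3
  have := le_mul_of_one_le_left (abs_nonneg (τ⁻¹).im) hn'
  linarith [neg_le_abs (τ⁻¹).im]

theorem OffLattice.qFac_ne_zero {τ w : ℂ} (hτ : 0 < τ.im) (h : OffLattice τ w) :
    qFac τ w ≠ 0 := by
  refine qPochhammer_ne_zero (norm_qPow_one_lt_one hτ) fun j => ?_
  rw [← qPow_nat_mul, ← qPow_add]
  exact OffLattice.qPow_ne_one hτ (h.congr (by simp))

theorem qFac_ofReal_ne_zero {τ : ℂ} (hτ : 0 < τ.im) {x : ℝ} (hx : ∀ n : ℤ, x ≠ n) :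
    qFac τ x ≠ 0 := by
  refine qPochhammer_ne_zero (norm_qPow_one_lt_one hτ) fun j h => ?_
  rw [← qPow_nat_mul, ← qPow_add] at h
  obtain ⟨n, hn⟩ := qPow_eq_one hτ h
  have hτ0 : τ ≠ 0 := by rintro rfl; simp at hτ
  have him := congrArg Complex.im hn
  have hneg : (τ⁻¹).im < 0 := by
    have := neg_one_div_im_pos hτ
    rw [neg_div, one_div, neg_im] at this
    linarith
  rw [← ofReal_intCast, im_ofReal_mul] at him
  simp only [mul_one, add_im, ofReal_im, natCast_im, add_zero] at him
  have hn0 : (n : ℝ) = 0 := by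
    rcases mul_eq_zero.mp him.symm with h | h
    · exact h
    · exact absurd h hneg.ne
  have hn0' : (n : ℂ) = 0 := by exact_mod_cast hn0
  rw [hn0', zero_mul] at hn
  have : x + j = 0 := by
    have := congrArg Complex.re hn
    simpa using this
  exact hx (-j) (by push_cast; linarith)

/-! ### Factorisation of the integrand and telescoping of its base-$q$ part. -/

/-- The base `q` part of the hyperbolic Nassrallah–Rahman integrand. -/
noncomputable def hypWeight (τ : ℂ) (t : Fin 5 → ℂ) (x : ℂ) : ℂ :=
  (∏ j, (qFac τ (t j + x) * qFac τ (t j - x))) /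
    (qFac τ (1 + 2 * x) * qFac τ (1 - 2 * x) *
      (qFac τ (∑ j, t j - 4 + x) * qFac τ (∑ j, t j - 4 - x)))

/-- The base `q̃` parameters. -/
noncomputable def expParam (t : Fin 5 → ℂ) (j : Fin 5) : ℂ := cexp (-(2 * π * I * t j))

theorem prod_expParam (t : Fin 5 → ℂ) : ∏ j, expParam t j = cexp (-(2 * π * I * ∑ j, t j)) := by
  simp only [expParam, ← Complex.exp_sum, Finset.mul_sum, Finset.sum_neg_distrib]

theorem exp_add_int (z : ℂ) (n : ℤ) : cexp (z + n * (2 * π * I)) = cexp z :=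
  Complex.exp_periodic.int_mul n z

/-- The exponentials $e^{-2\pi i\,\cdot}$ in the base-$\tilde q$ symbols absorb the integers $1$ and
$-4$. Thus all dependence on integer shifts of $x$ and of the parameters sits in `hypWeight`. -/
theorem nassrallahRahmanIntegrand_eq (τ : ℂ) (t : Fin 5 → ℂ) (x : ℂ) :
    nassrallahRahmanIntegrand τ t x =
      trigWeight (qTildePow τ 1) (expParam t) (cexp (2 * π * I * x)) * hypWeight τ t x := by
  have e1 : cexp (-(2 * π * I * (1 + 2 * x))) = 1 / cexp (2 * π * I * x) ^ 2 := by
    rw [one_div, ← Complex.exp_nat_mul, ← Complex.exp_neg, ← exp_add_int _ 1]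
    congr 1; push_cast; ring
  have e2 : cexp (-(2 * π * I * (1 - 2 * x))) = cexp (2 * π * I * x) ^ 2 := by
    rw [← Complex.exp_nat_mul, ← exp_add_int _ 1]
    congr 1; push_cast; ring
  have e3 : cexp (-(2 * π * I * (∑ j, t j - 4 + x))) =
      (∏ j, expParam t j) / cexp (2 * π * I * x) := by
    rw [prod_expParam, ← Complex.exp_sub, ← exp_add_int _ (-4)]
    congr 1; push_cast; ring
  have e4 : cexp (-(2 * π * I * (∑ j, t j - 4 - x))) =
      (∏ j, expParam t j) * cexp (2 * π * I * x) := by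
    rw [prod_expParam, ← Complex.exp_add, ← exp_add_int _ (-4)]
    congr 1; push_cast; ring
  have e5 : ∀ j, cexp (-(2 * π * I * (t j + x))) = expParam t j / cexp (2 * π * I * x) := by
    intro j; rw [expParam, ← Complex.exp_sub]; congr 1; ring
  have e6 : ∀ j, cexp (-(2 * π * I * (t j - x))) = expParam t j * cexp (2 * π * I * x) := by
    intro j; rw [expParam, ← Complex.exp_add]; congr 1; ring
  simp only [nassrallahRahmanIntegrand, tauFactorialPM, tauFactorial, trigWeight, qFac,
    hypWeight, e1, e2, e3, e4, e5, e6, Finset.prod_mul_distrib,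
    div_eq_mul_inv, mul_inv, Finset.prod_inv_distrib, inv_inv]
  ring

/-- The rational function whose difference telescopes the hyperbolic integrand. -/
noncomputable def hypBoundaryFactor (τ : ℂ) (t : Fin 5 → ℂ) (i : Fin 5) (Z : ℂ) : ℂ :=
  qPow τ (t i - 1) * (1 - qPow τ (∑ j, t j - 5) * qPow τ (t i - 1)) *
    (∏ j, (1 - qPow τ (t j - 1) * Z)) / (Z * (1 - Z ^ 2) * (1 - qPow τ (∑ j, t j - 5) * Z))

theorem hypWeight_neg (τ : ℂ) (t : Fin 5 → ℂ) (x : ℂ) : hypWeight τ t (-x) = hypWeight τ t x := by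
  unfold hypWeight
  simp only [mul_neg, sub_neg_eq_add, ← sub_eq_add_neg]
  rw [Finset.prod_congr rfl fun j _ => mul_comm (qFac τ (t j - x)) (qFac τ (t j + x))]
  ring

theorem hypWeight_update {τ : ℂ} (hτ : 0 < τ.im) (t : Fin 5 → ℂ) (i : Fin 5) (x : ℂ) :
    hypWeight τ t x = hypWeight τ (Function.update t i (t i + 1)) x *
      ((1 - qPow τ (t i) * qPow τ x) * (1 - qPow τ (t i) / qPow τ x) /
        ((1 - qPow τ (∑ j, t j - 4) * qPow τ x) * (1 - qPow τ (∑ j, t j - 4) / qPow τ x))) := by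
  have hsum : ∑ j, Function.update t i (t i + 1) j = ∑ j, t j + 1 := by
    rw [Fin.sum_univ_succAbove _ i, Fin.sum_univ_succAbove t i]; simp; ring
  unfold hypWeight
  rw [hsum, Fin.prod_univ_succAbove _ i, Fin.prod_univ_succAbove _ i]
  simp only [Function.update_self, ne_eq, Fin.succAbove_ne, not_false_eq_true,
    Function.update_of_ne]
  rw [qFac_eq_mul hτ (t i + x), qFac_eq_mul hτ (t i - x), qFac_eq_mul hτ (∑ j, t j - 4 + x),
    qFac_eq_mul hτ (∑ j, t j - 4 - x), qPow_add, qPow_sub, qPow_add _ _ x, qPow_sub _ _ x,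
    show t i + x + 1 = t i + 1 + x by ring, show t i - x + 1 = t i + 1 - x by ring,
    show ∑ j, t j - 4 + x + 1 = ∑ j, t j + 1 - 4 + x by ring,
    show ∑ j, t j - 4 - x + 1 = ∑ j, t j + 1 - 4 - x by ring]
  simp only [div_eq_mul_inv, mul_inv]
  ring

/-- Each symbol gains or loses linear factors under $x\mapsto x+1$, and these exchange the values of
the boundary factor at $q^{x+1}$ and $q^{-x}$. The sign comes from $1-1/(qZ^2)=-(1-qZ^2)/(qZ^2)$
with $Z=q^x$. -/
theorem hypWeight_add_one {τ : ℂ} (hτ : 0 < τ.im) (t : Fin 5 → ℂ) (i : Fin 5) (x : ℂ) :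
    hypWeight τ t (x + 1) * hypBoundaryFactor τ t i (qPow τ (x + 1)) =
      -(hypWeight τ t x * hypBoundaryFactor τ t i (1 / qPow τ x)) := by
  have hZ : qPow τ x ≠ 0 := qPow_ne_zero τ x
  have hq : qPow τ 1 ≠ 0 := qPow_ne_zero τ 1
  have hsub : ∀ w, qPow τ (w - 1) = qPow τ w / qPow τ 1 := fun w => qPow_sub τ w 1
  have hS5 : qPow τ (∑ j, t j - 4) = qPow τ 1 * qPow τ (∑ j, t j - 5) := by
    rw [← qPow_add]; congr 1; ring
  have ht1 : ∀ j, qPow τ (t j) = qPow τ 1 * qPow τ (t j - 1) := fun j => by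
    rw [← qPow_add]; congr 1; ring
  have a1 : ∀ j, qFac τ (t j + x) =
      (1 - qPow τ (t j - 1) * qPow τ (x + 1)) * qFac τ (t j + (x + 1)) := fun j => by
    rw [qFac_eq_mul hτ, ← qPow_add]; ring_nf
  have a2 : ∀ j, qFac τ (t j - (x + 1)) =
      (1 - qPow τ (t j - 1) * (1 / qPow τ x)) * qFac τ (t j - x) := fun j => by
    rw [qFac_eq_mul hτ, mul_one_div, ← qPow_sub]; ring_nf
  have a3 : qFac τ (1 + 2 * x) = (1 - qPow τ 1 * qPow τ x ^ 2) * (1 - qPow τ (x + 1) ^ 2) *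
      qFac τ (1 + 2 * (x + 1)) := by
    rw [qFac_eq_mul hτ, qFac_eq_mul hτ, sq, sq, ← qPow_add, ← qPow_add, ← qPow_add]; ring_nf
  have a4 : qFac τ (1 - 2 * (x + 1)) = (1 - 1 / (qPow τ 1 * qPow τ x ^ 2)) *
      (1 - (1 / qPow τ x) ^ 2) * qFac τ (1 - 2 * x) := by
    have h1 : 1 / (qPow τ 1 * qPow τ x ^ 2) = qPow τ (1 - 2 * (x + 1)) := by
      rw [sq, ← qPow_add, ← qPow_add, ← qPow_zero τ, ← qPow_sub]; congr 1; ring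
    have h2 : (1 / qPow τ x) ^ 2 = qPow τ (1 - 2 * (x + 1) + 1) := by
      rw [← qPow_zero τ, ← qPow_sub, sq, ← qPow_add]; congr 1; ring
    rw [h1, h2, qFac_eq_mul hτ, qFac_eq_mul hτ (1 - 2 * (x + 1) + 1)]
    ring_nf
  have a5 : qFac τ (∑ j, t j - 4 + x) = (1 - qPow τ (∑ j, t j - 5) * qPow τ (x + 1)) *
      qFac τ (∑ j, t j - 4 + (x + 1)) := by
    rw [qFac_eq_mul hτ, ← qPow_add]; ring_nf
  have a6 : qFac τ (∑ j, t j - 4 - (x + 1)) = (1 - qPow τ (∑ j, t j - 5) * (1 / qPow τ x)) *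
      qFac τ (∑ j, t j - 4 - x) := by
    rw [qFac_eq_mul hτ, mul_one_div, ← qPow_sub]; ring_nf
  unfold hypWeight hypBoundaryFactor
  simp_rw [a1, a2]
  rw [a3, a4, a5, a6, div_mul_div_comm, div_mul_div_comm, ← div_neg]
  simp only [Finset.prod_mul_distrib]
  congr 1
  · ring
  · have : (1 - 1 / (qPow τ 1 * qPow τ x ^ 2)) * qPow τ (x + 1) =
        -((1 - qPow τ 1 * qPow τ x ^ 2) * (1 / qPow τ x)) := by
      rw [qPow_add]; field_simp; ring
    linear_combination ((1 - (1 / qPow τ x) ^ 2) * qFac τ (1 - 2 * x) *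
      qFac τ (1 + 2 * (x + 1)) * qFac τ (∑ j, t j - 4 + (x + 1)) *
      (1 - qPow τ (∑ j, t j - 5) * (1 / qPow τ x)) * qFac τ (∑ j, t j - 4 - x) *
      (1 - qPow τ (x + 1) ^ 2) * (1 - qPow τ (∑ j, t j - 5) * qPow τ (x + 1))) * this

theorem qPow_ofReal_sq_ne_one {τ : ℂ} (hτ : 0 < τ.im) {x : ℝ} (hx : ∀ n : ℤ, 2 * x ≠ n) :
    qPow τ x ^ 2 ≠ 1 := by
  intro h
  have := qFac_ofReal_ne_zero hτ hx
  rw [qFac_eq_mul hτ, ofReal_mul, ofReal_ofNat, two_mul, qPow_add, ← sq, h] at this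
  simp at this

theorem hypWeight_sub {τ : ℂ} (hτ : 0 < τ.im) (t : Fin 5 → ℂ) (i : Fin 5) {x : ℝ}
    (hx : ∀ n : ℤ, 2 * x ≠ n) (ha : OffLattice τ (∑ j, t j)) :
    (∏ j : Fin 4, (1 - qPow τ (t i + t (i.succAbove j) - 1))) *
        hypWeight τ (Function.update t i (t i + 1)) x -
      (∏ j : Fin 4, (1 - qPow τ (∑ j, t j - t (i.succAbove j) - 3))) * hypWeight τ t x =
    hypWeight τ (Function.update t i (t i + 1)) x *
        hypBoundaryFactor τ (Function.update t i (t i + 1)) i (qPow τ x) -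
      hypWeight τ (Function.update t i (t i + 1)) (x + 1) *
        hypBoundaryFactor τ (Function.update t i (t i + 1)) i (qPow τ (x + 1)) := by
  rw [hypWeight_add_one hτ, hypWeight_update hτ t i x, sub_neg_eq_add]
  have hsum : ∑ j, Function.update t i (t i + 1) j = ∑ j, t j + 1 := by
    rw [Fin.sum_univ_succAbove _ i, Fin.sum_univ_succAbove t i]; simp; ring
  have hi : Function.update t i (t i + 1) i = t i + 1 := by simp
  have hj : ∀ j, Function.update t i (t i + 1) (i.succAbove j) = t (i.succAbove j) := by simp
  unfold hypBoundaryFactor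
  rw [hsum, hi]
  set t' := Function.update t i (t i + 1)
  have hprod : ∏ j, qPow τ (t' j - 1) = qPow τ (∑ j, t j - 4) := by
    rw [← qPow_sum, Finset.sum_sub_distrib, hsum]; congr 1; simp; ring
  have hne1 : 1 - qPow τ (∑ j, t j - 4) * qPow τ x ≠ 0 := by
    rw [← qPow_add, sub_ne_zero]
    exact (OffLattice.qPow_ne_one hτ (ha.congr (by simp))).symm
  have hne2 : 1 - qPow τ (∑ j, t j - 4) / qPow τ x ≠ 0 := by
    rw [← qPow_sub, sub_ne_zero]
    exact (OffLattice.qPow_ne_one hτ (ha.congr (by simp))).symm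
  have hZ : qPow τ x ≠ 0 := qPow_ne_zero τ x
  have hZ2 := qPow_ofReal_sq_ne_one hτ hx
  -- The identity is taken at $s_j=q^{t'_j-1}$, whose product is $q^{a-4}$ because the shifted
  -- parameters sum to $a+1$.
  have key := nassrallah_rahman_rational_identity (fun j => qPow τ (t' j - 1)) i (qPow τ x)
    (fun j => qPow_ne_zero _ _) hZ (sub_ne_zero.mpr hZ2.symm) (by rwa [hprod]) (by rwa [hprod])
  simp only [hprod, hi, hj, add_sub_cancel_right] at key
  have hD : ∀ j : Fin 4, qPow τ (t i) * qPow τ (t (i.succAbove j) - 1) =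
      qPow τ (t i + t (i.succAbove j) - 1) := fun j => by rw [← qPow_add]; congr 1; ring
  have hE : ∀ j : Fin 4, qPow τ (∑ j, t j - 4) / qPow τ (t (i.succAbove j) - 1) =
      qPow τ (∑ j, t j - t (i.succAbove j) - 3) := fun j => by rw [← qPow_sub]; congr 1; ring
  simp only [hD, hE] at key
  have hH : qPow τ (t i) * (1 - qPow τ (∑ j, t j - 4) * qPow τ (t i)) *
      (∏ j, (1 - qPow τ (t' j - 1) * (1 / qPow τ x))) / (1 / qPow τ x * (1 - (1 / qPow τ x) ^ 2) *
        (1 - qPow τ (∑ j, t j - 4) * (1 / qPow τ x))) =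
      -(qPow τ (t i) * (1 - qPow τ (∑ j, t j - 4) * qPow τ (t i)) * qPow τ x ^ 3 *
        (∏ j, (1 - qPow τ (t' j - 1) / qPow τ x)) /
          ((1 - qPow τ x ^ 2) * (1 - qPow τ (∑ j, t j - 4) / qPow τ x))) := by
    rw [← div_neg]
    simp only [mul_one_div]
    have h1 : 1 - (1 / qPow τ x) ^ 2 = -(1 - qPow τ x ^ 2) / qPow τ x ^ 2 := by
      field_simp; ring
    have hv0 : 1 - qPow τ x ^ 2 ≠ 0 := sub_ne_zero.mpr hZ2.symm
    rw [h1]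
    generalize 1 - qPow τ x ^ 2 = v at *
    generalize 1 - qPow τ (∑ j, t j - 4) / qPow τ x = Y at *
    field_simp
  rw [show ∑ j, t j + 1 - 5 = ∑ j, t j - 4 by ring, add_sub_cancel_right, hH]
  linear_combination hypWeight τ t' x * key

/-! ### Admissible parameters, the reflection formula and one-sided bounds. -/

/-- The parameter domain of the hyperbolic Nassrallah–Rahman integral. -/
def Admissible (τ : ℂ) (t : Fin 5 → ℂ) : Prop :=
  (∀ j, (t j).im < 0) ∧ (τ⁻¹).im < (∑ j, t j).im

theorem Admissible.congr {τ : ℂ} {t t' : Fin 5 → ℂ} (h : Admissible τ t)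
    (ht : ∀ j, (t' j).im = (t j).im) : Admissible τ t' := by
  refine ⟨fun j => by rw [ht]; exact h.1 j, ?_⟩
  have := h.2
  rw [im_sum] at this ⊢
  simpa only [ht] using this

theorem Admissible.update {τ : ℂ} {t : Fin 5 → ℂ} (h : Admissible τ t) (i : Fin 5) :
    Admissible τ (Function.update t i (t i + 1)) := by
  refine h.congr fun j => ?_
  by_cases hj : j = i
  · subst hj; simp
  · simp [hj]

theorem Admissible.sum_im_neg {τ : ℂ} {t : Fin 5 → ℂ} (h : Admissible τ t) :
    (∑ j, t j).im < 0 := by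
  rw [im_sum]
  exact Finset.sum_neg (fun j _ => h.1 j) Finset.univ_nonempty

/-- The lower bound on $\operatorname{Im}(a)$ places $a$ strictly between the zero lines, so the
denominators $(q^{a-4\pm x};q)_\infty$ never vanish for real $x$. -/
theorem Admissible.offLattice_sum {τ : ℂ} {t : Fin 5 → ℂ} (h : Admissible τ t) :
    OffLattice τ (∑ j, t j) := by
  have h1 := h.sum_im_neg
  exact ⟨h1.ne, by rw [abs_of_neg h1]; linarith [h.2]⟩

theorem Admissible.sum_im_le {τ : ℂ} {t : Fin 5 → ℂ} (h : Admissible τ t) (j : Fin 5) :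
    (∑ j, t j).im < (t j).im := by
  rw [Fin.sum_univ_succAbove _ j, add_im, im_sum]
  have : ∑ k : Fin 4, (t (j.succAbove k)).im < 0 :=
    Finset.sum_neg (fun k _ => h.1 _) Finset.univ_nonempty
  linarith

theorem Admissible.offLattice {τ : ℂ} {t : Fin 5 → ℂ} (h : Admissible τ t) (j : Fin 5) :
    OffLattice τ (t j) := by
  have h1 := h.1 j
  have h2 := h.sum_im_le j
  exact ⟨h1.ne, by rw [abs_of_neg h1]; linarith [h.2]⟩

theorem norm_exp_neg_two_pi_I_mul (w : ℂ) :
    ‖cexp (-(2 * π * I * w))‖ = Real.exp (2 * π * w.im) := by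
  rw [← mul_neg, norm_exp_two_pi_I_mul]; congr 1; simp

theorem norm_expParam_lt_one {t : Fin 5 → ℂ} {j : Fin 5} (h : (t j).im < 0) :
    ‖expParam t j‖ < 1 := by
  rw [expParam, norm_exp_neg_two_pi_I_mul, Real.exp_lt_one_iff]
  nlinarith [Real.pi_pos]

theorem expParam_ne_zero (t : Fin 5 → ℂ) (j : Fin 5) : expParam t j ≠ 0 := Complex.exp_ne_zero _

theorem expParam_congr {t t' : Fin 5 → ℂ} (h : ∀ j, ∃ n : ℤ, t' j = t j + n) :
    expParam t' = expParam t := by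
  funext j
  obtain ⟨n, hn⟩ := h j
  rw [expParam, expParam, hn, ← exp_add_int _ n]
  congr 1; ring

theorem norm_qTildePow_div_lt_one {τ w : ℂ} (h : (τ⁻¹).im < w.im) :
    ‖qTildePow τ 1 / cexp (-(2 * π * I * w))‖ < 1 := by
  rw [norm_div, norm_qTildePow_one, norm_exp_neg_two_pi_I_mul, div_lt_one (Real.exp_pos _),
    Real.exp_lt_exp]
  nlinarith [Real.pi_pos]

/-- The Gaussian factor of the modular transformation of theta functions. -/
noncomputable def modFactor (τ z : ℂ) : ℂ := cexp (π * I * (τ * z ^ 2 - (1 + τ) * z))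

theorem modFactor_ne_zero (τ z : ℂ) : modFactor τ z ≠ 0 := Complex.exp_ne_zero _

/-- The reflection formula for the base `q` shifted factorials. -/
theorem exists_reflection {τ : ℂ} (hτ : 0 < τ.im) : ∃ κ : ℂ, κ ≠ 0 ∧ ∀ z : ℂ,
    qPochhammer (cexp (-(2 * π * I * z))) (qTildePow τ 1) *
      qPochhammer (qTildePow τ 1 / cexp (-(2 * π * I * z))) (qTildePow τ 1) =
      κ * modFactor τ z * (qFac τ z * qFac τ (1 - z)) := by
  obtain ⟨κ, hκ, h⟩ := exists_qTheta_modular hτ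
  refine ⟨κ, hκ, fun z => ?_⟩
  have := h z
  rwa [qTheta, qTheta, ← qPow_sub] at this

theorem exists_bound_of_tendsto {f : ℝ → ℂ} (hf : Continuous f) {l : ℂ}
    (hl : Tendsto f atTop (𝓝 l)) : ∃ C, 0 < C ∧ ∀ x : ℝ, 0 ≤ x → ‖f x‖ ≤ C := by
  have h1 : ∀ᶠ x in atTop, ‖f x‖ < ‖l‖ + 1 := hl.norm.eventually_lt_const (by linarith)
  obtain ⟨A, hA⟩ := eventually_atTop.mp h1
  obtain ⟨C, hC⟩ := (isCompact_Icc (a := (0 : ℝ)) (b := A)).exists_bound_of_continuousOn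
    hf.continuousOn
  refine ⟨max C (‖l‖ + 1), by positivity, fun x hx => ?_⟩
  rcases le_total x A with h | h
  · exact (hC x ⟨hx, h⟩).trans (le_max_left _ _)
  · exact (hA x h).le.trans (le_max_right _ _)

theorem exists_bound_qFac {τ : ℂ} (hτ : 0 < τ.im) (w : ℂ) :
    ∃ C, 0 < C ∧ ∀ x : ℝ, 0 ≤ x → ‖qFac τ (w + x)‖ ≤ C :=
  exists_bound_of_tendsto ((continuous_qFac hτ).comp (by fun_prop)) (tendsto_qFac_add_ofReal hτ w)

theorem OffLattice.qFac_add_ofReal_ne_zero {τ w : ℂ} (hτ : 0 < τ.im) (hw : OffLattice τ w)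
    (x : ℝ) : qFac τ (w + x) ≠ 0 := OffLattice.qFac_ne_zero hτ (hw.congr (by simp))

theorem exists_bound_inv_qFac {τ : ℂ} (hτ : 0 < τ.im) {w : ℂ} (hw : OffLattice τ w) :
    ∃ C, 0 < C ∧ ∀ x : ℝ, 0 ≤ x → ‖(qFac τ (w + x))⁻¹‖ ≤ C :=
  exists_bound_of_tendsto (((continuous_qFac hτ).comp (by fun_prop)).inv₀
    (fun x => OffLattice.qFac_add_ofReal_ne_zero hτ hw x))
    ((tendsto_qFac_add_ofReal hτ w).inv₀ one_ne_zero)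

/-- The part of the integrand with Gaussian decay. -/
theorem qPochhammer_sq_div_qFac {τ κ : ℂ} (hτ : 0 < τ.im)
    (hκ : ∀ z : ℂ, qPochhammer (cexp (-(2 * π * I * z))) (qTildePow τ 1) *
      qPochhammer (qTildePow τ 1 / cexp (-(2 * π * I * z))) (qTildePow τ 1) =
      κ * modFactor τ z * (qFac τ z * qFac τ (1 - z))) {x : ℝ} (hx : ∀ n : ℤ, 2 * x ≠ n) :
    qPochhammer (cexp (2 * π * I * x) ^ 2) (qTildePow τ 1) *
        qPochhammer (1 / cexp (2 * π * I * x) ^ 2) (qTildePow τ 1) /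
          (qFac τ (1 + 2 * x) * qFac τ (1 - 2 * x)) =
      κ * modFactor τ (2 * x) * (1 - cexp (2 * π * I * x) ^ 2) * (1 - qPow τ x ^ 2) := by
  have h := hκ (2 * x)
  have e1 : cexp (-(2 * π * I * (2 * x))) = 1 / cexp (2 * π * I * x) ^ 2 := by
    rw [one_div, ← Complex.exp_nat_mul, ← Complex.exp_neg]; congr 1; push_cast; ring
  have e2 : qTildePow τ 1 / (1 / cexp (2 * π * I * x) ^ 2) =
      cexp (2 * π * I * x) ^ 2 * qTildePow τ 1 := by
    rw [div_div_eq_mul_div, div_one, mul_comm]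
  rw [e1, e2, qFac_eq_mul hτ (2 * x), two_mul (x : ℂ), qPow_add, ← sq, ← two_mul, add_comm _ (1 : ℂ)] at h
  have n1 : qFac τ (1 + 2 * x) ≠ 0 := by
    have := qFac_ofReal_ne_zero hτ (x := 1 + 2 * x) fun n hn => hx (n - 1) (by push_cast; linarith)
    simpa using this
  have n2 : qFac τ (1 - 2 * x) ≠ 0 := by
    have := qFac_ofReal_ne_zero hτ (x := 1 - 2 * x) fun n hn => hx (1 - n) (by push_cast; linarith)
    simpa using this
  rw [div_eq_iff (mul_ne_zero n1 n2), qPochhammer_eq_mul (cexp (2 * π * I * x) ^ 2)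
    (norm_qTildePow_one_lt_one hτ)]
  linear_combination (1 - cexp (2 * π * I * x) ^ 2) * h

/-! ### Behaviour of the integrand at infinity and absolute convergence. -/

/-- The limiting 1-periodic factor of the integrand, as a function of `exp (- 2 π i x)`. -/
noncomputable def tailPeriodic (p : ℂ) (s : Fin 5 → ℂ) (y : ℂ) : ℂ :=
  y * (y ^ 2 - 1) * (qPochhammer ((∏ j, s j) * y) p * ∏ j, qPochhammer (p / s j * y) p) /
    (qPochhammer (p / (∏ j, s j) * y) p * ∏ j, qPochhammer (s j * y) p)

/-- The factor of the integrand which tends to `1` at infinity. -/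
noncomputable def tailFactor (τ : ℂ) (t : Fin 5 → ℂ) (x : ℂ) : ℂ :=
  (∏ j, qFac τ (t j + x) / qFac τ (1 - t j + x)) *
    (qFac τ (5 - ∑ j, t j + x) / qFac τ (∑ j, t j - 4 + x))

theorem Admissible.norm_qTildePow_div_prod_lt_one {τ : ℂ} {t : Fin 5 → ℂ} (h : Admissible τ t) :
    ‖qTildePow τ 1 / ∏ j, expParam t j‖ < 1 := by
  rw [prod_expParam]; exact norm_qTildePow_div_lt_one h.2

theorem differentiableAt_tailPeriodic {τ : ℂ} (hτ : 0 < τ.im) {t : Fin 5 → ℂ}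
    (h : Admissible τ t) {y : ℂ} (hy : ‖y‖ ≤ 1) :
    DifferentiableAt ℂ (tailPeriodic (qTildePow τ 1) (expParam t)) y := by
  have hp := norm_qTildePow_one_lt_one hτ
  have dP := differentiable_qPochhammer hp
  have comp : ∀ a : ℂ, DifferentiableAt ℂ (fun w => qPochhammer (a * w) (qTildePow τ 1)) y :=
    fun a => DifferentiableAt.comp y (dP _) (by fun_prop)
  have ne : ∀ a : ℂ, ‖a‖ < 1 → qPochhammer (a * y) (qTildePow τ 1) ≠ 0 := fun a ha =>
    qPochhammer_ne_zero_of_norm_lt_one hp (by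
      rw [norm_mul]; exact mul_lt_one_of_nonneg_of_lt_one_left (norm_nonneg _) ha hy)
  unfold tailPeriodic
  refine DifferentiableAt.div ?_ ?_ ?_
  · exact (by fun_prop : DifferentiableAt ℂ (fun y : ℂ => y * (y ^ 2 - 1)) y).mul
      ((comp _).mul (DifferentiableAt.fun_finsetProd fun j _ => comp _))
  · exact (comp _).mul (DifferentiableAt.fun_finsetProd fun j _ => comp _)
  · exact mul_ne_zero (ne _ h.norm_qTildePow_div_prod_lt_one)
      (Finset.prod_ne_zero_iff.mpr fun j _ => ne _ (norm_expParam_lt_one (h.1 j)))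

theorem continuous_tailPeriodic {τ : ℂ} (hτ : 0 < τ.im) {t : Fin 5 → ℂ} (h : Admissible τ t) :
    Continuous fun x : ℝ => tailPeriodic (qTildePow τ 1) (expParam t) (cexp (-(2 * π * I * x))) := by
  rw [continuous_iff_continuousAt]
  intro x
  refine ContinuousAt.comp (g := tailPeriodic (qTildePow τ 1) (expParam t))
    (f := fun x : ℝ => cexp (-(2 * π * I * x)))
    (differentiableAt_tailPeriodic hτ h ?_).continuousAt ?_
  · rw [norm_exp_neg_two_pi_I_mul]; simp
  · exact (by fun_prop : Continuous fun x : ℝ => cexp (-(2 * π * I * x))).continuousAt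

theorem exists_bound_tailPeriodic {τ : ℂ} (hτ : 0 < τ.im) {t : Fin 5 → ℂ} (h : Admissible τ t) :
    ∃ C, 0 < C ∧ ∀ x : ℝ,
      ‖tailPeriodic (qTildePow τ 1) (expParam t) (cexp (-(2 * π * I * x)))‖ ≤ C := by
  obtain ⟨C, hC⟩ := (isCompact_closedBall (0 : ℂ) 1).exists_bound_of_continuousOn
    (f := tailPeriodic (qTildePow τ 1) (expParam t)) (fun y hy =>
      (differentiableAt_tailPeriodic hτ h (by simpa using hy)).continuousAt.continuousWithinAt)
  refine ⟨max C 1, by positivity, fun x => (hC _ ?_).trans (le_max_left _ _)⟩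
  rw [mem_closedBall_zero_iff, norm_exp_neg_two_pi_I_mul]; simp

/-- Mean value property: `tailPeriodic` is holomorphic on the closed unit disc, and its explicit
factor $y$ makes the value at the centre zero. -/
theorem integral_tailPeriodic {τ : ℂ} (hτ : 0 < τ.im) {t : Fin 5 → ℂ} (h : Admissible τ t) :
    ∫ x : ℝ in 0..1, tailPeriodic (qTildePow τ 1) (expParam t) (cexp (-(2 * π * I * x))) = 0 := by
  have h1 := integral_mul_exp_eq_circleAverage (tailPeriodic (qTildePow τ 1) (expParam t)) 1
  have h2 := intervalIntegral.integral_comp_sub_left (a := 0) (b := 1) (fun x : ℝ =>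
    tailPeriodic (qTildePow τ 1) (expParam t) (cexp (2 * π * I * x))) 1
  have h3 : ∀ x : ℝ, cexp (2 * π * I * (1 - x : ℝ)) = cexp (-(2 * π * I * x)) := fun x => by
    rw [← exp_add_int (-(2 * π * I * x)) 1]; congr 1; push_cast; ring
  simp only [h3, sub_self, sub_zero] at h2
  simp only [one_mul, norm_one] at h1
  rw [h2, h1, DiffContOnCl.circleAverage]
  · simp [tailPeriodic]
  · refine DifferentiableOn.diffContOnCl fun y hy => ?_
    rw [abs_one, closure_ball (0 : ℂ) one_ne_zero] at hy
    exact (differentiableAt_tailPeriodic hτ h (by simpa using hy)).differentiableWithinAt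

theorem continuous_tailFactor {τ : ℂ} (hτ : 0 < τ.im) {t : Fin 5 → ℂ} (h : Admissible τ t) :
    Continuous fun x : ℝ => tailFactor τ t x := by
  have c := continuous_qFac hτ
  unfold tailFactor
  refine (continuous_finsetProd _ fun j _ => ?_).mul ?_
  · refine (c.comp (by fun_prop)).div (c.comp (by fun_prop)) fun x => ?_
    exact OffLattice.qFac_ne_zero hτ ((h.offLattice j).neg.congr (by simp))
  · refine (c.comp (by fun_prop)).div (c.comp (by fun_prop)) fun x => ?_
    exact OffLattice.qFac_ne_zero hτ (h.offLattice_sum.congr (by simp))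

theorem tendsto_tailFactor {τ : ℂ} (hτ : 0 < τ.im) (t : Fin 5 → ℂ) :
    Tendsto (fun x : ℝ => tailFactor τ t x) atTop (𝓝 1) := by
  have c := tendsto_qFac_add_ofReal hτ
  have h1 : ∀ u v : ℂ, Tendsto (fun x : ℝ => qFac τ (u + x) / qFac τ (v + x)) atTop (𝓝 1) :=
    fun u v => by simpa [Pi.div_def] using (c u).div (c v) one_ne_zero
  have := (tendsto_finsetProd Finset.univ fun (j : Fin 5) _ => h1 (t j) (1 - t j)).mul
    (h1 (5 - ∑ j, t j) (∑ j, t j - 4))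
  simpa [tailFactor] using this

/-- A closed form of the integrand which shows its behaviour at `+∞`. -/
theorem exists_integrand_eq_tail {τ : ℂ} (hτ : 0 < τ.im) :
    ∃ K : ℂ, ∀ t : Fin 5 → ℂ, Admissible τ t → ∀ x : ℝ, (∀ n : ℤ, 2 * x ≠ n) →
      trigWeight (qTildePow τ 1) (expParam t) (cexp (2 * π * I * x)) * hypWeight τ t x =
        K * (modFactor τ (∑ j, t j - 4) / ∏ j, modFactor τ (t j)) *
          ((1 - qPow τ x ^ 2) * qPow τ x) *
          tailPeriodic (qTildePow τ 1) (expParam t) (cexp (-(2 * π * I * x))) *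
            tailFactor τ t x := by
  obtain ⟨κ, hκ0, hκ⟩ := exists_reflection hτ
  -- Seven reflections: one for the pair in $2x$ and one for $a-4-x$ in the numerator, five for the
  -- $t_j-x$ in the denominator.
  refine ⟨κ * (κ / κ ^ 5), fun t h x hx => ?_⟩
  have hp := norm_qTildePow_one_lt_one hτ
  set p := qTildePow τ 1 with hpdef
  set s := expParam t with hsdef
  set z := cexp (2 * π * I * x) with hz
  have hz0 : z ≠ 0 := Complex.exp_ne_zero _
  have hzn : ‖z‖ = 1 := norm_exp_two_pi_I_mul_ofReal x
  have hy : cexp (-(2 * π * I * x)) = z⁻¹ := by rw [hz, Complex.exp_neg]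
  have hyn : ‖z⁻¹‖ = 1 := by rw [norm_inv, hzn, inv_one]
  have hV := qPochhammer_sq_div_qFac hτ hκ hx
  have hT : ∀ j, qFac τ (t j - x) / qPochhammer (s j * z) p =
      qPochhammer (p / s j * z⁻¹) p / (κ * modFactor τ (t j - x) * qFac τ (1 - t j + x)) := by
    intro j
    have h1 := hκ (t j - x)
    have h2 : cexp (-(2 * π * I * (t j - x))) = s j * z := by
      rw [hsdef, expParam, hz, ← Complex.exp_add]; congr 1; ring
    rw [h2, show p / (s j * z) = p / s j * z⁻¹ by field_simp,
      show 1 - (t j - x) = 1 - t j + x by ring] at h1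
    have n1 : qPochhammer (s j * z) p ≠ 0 := qPochhammer_ne_zero_of_norm_lt_one hp (by
      rw [norm_mul, hzn, mul_one]; exact norm_expParam_lt_one (h.1 j))
    have n2 : qFac τ (1 - t j + x) ≠ 0 :=
      OffLattice.qFac_ne_zero hτ ((h.offLattice j).neg.congr (by simp))
    rw [div_eq_div_iff n1 (mul_ne_zero (mul_ne_zero hκ0 (modFactor_ne_zero _ _)) n2)]
    linear_combination -h1
  have hS : qPochhammer ((∏ j, s j) * z) p / qFac τ (∑ j, t j - 4 - x) =
      κ * modFactor τ (∑ j, t j - 4 - x) * qFac τ (5 - ∑ j, t j + x) /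
        qPochhammer (p / (∏ j, s j) * z⁻¹) p := by
    have h1 := hκ (∑ j, t j - 4 - x)
    have h2 : cexp (-(2 * π * I * (∑ j, t j - 4 - x))) = (∏ j, s j) * z := by
      rw [hsdef, prod_expParam, hz, ← Complex.exp_add, ← exp_add_int _ (-4)]
      congr 1; push_cast; ring
    rw [h2, show p / ((∏ j, s j) * z) = p / (∏ j, s j) * z⁻¹ by field_simp,
      show 1 - (∑ j, t j - 4 - x) = 5 - ∑ j, t j + x by ring] at h1
    have n1 : qPochhammer (p / (∏ j, s j) * z⁻¹) p ≠ 0 :=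
      qPochhammer_ne_zero_of_norm_lt_one hp (by
        rw [norm_mul, hyn, mul_one]; exact h.norm_qTildePow_div_prod_lt_one)
    have n2 : qFac τ (∑ j, t j - 4 - x) ≠ 0 :=
      OffLattice.qFac_ne_zero hτ (h.offLattice_sum.congr (by simp))
    rw [div_eq_div_iff n2 n1]
    linear_combination h1
  -- The Gaussians cancel, as $2^2+1-5=0$. What survives of the linear part is $\pi i(2\tau x-6x)$,
  -- that is $q^xz^{-3}$.
  have hmod : modFactor τ (2 * x) * modFactor τ (∑ j, t j - 4 - x) / ∏ j, modFactor τ (t j - x) =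
      modFactor τ (∑ j, t j - 4) / (∏ j, modFactor τ (t j)) * (z⁻¹ ^ 3 * qPow τ x) := by
    rw [div_eq_iff (Finset.prod_ne_zero_iff.mpr fun j _ => modFactor_ne_zero _ _),
      div_mul_eq_mul_div, div_mul_eq_mul_div,
      eq_div_iff (Finset.prod_ne_zero_iff.mpr fun j _ => modFactor_ne_zero _ _), ← hy]
    simp only [modFactor, qPow, ← Complex.exp_sum, ← Complex.exp_nat_mul, ← Complex.exp_add]
    congr 1
    simp only [Fin.sum_univ_five]
    push_cast
    ring
  have lhs : trigWeight p s z * hypWeight τ t x =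
      (qPochhammer (z ^ 2) p * qPochhammer (1 / z ^ 2) p / (qFac τ (1 + 2 * x) * qFac τ (1 - 2 * x))) *
      (qPochhammer ((∏ j, s j) * z) p / qFac τ (∑ j, t j - 4 - x)) *
      (∏ j, qFac τ (t j - x) / qPochhammer (s j * z) p) *
      (qPochhammer ((∏ j, s j) / z) p / ∏ j, qPochhammer (s j / z) p) *
      ((∏ j, qFac τ (t j + x)) / qFac τ (∑ j, t j - 4 + x)) := by
    simp only [trigWeight, hypWeight, Finset.prod_mul_distrib, Finset.prod_inv_distrib,
      div_eq_mul_inv, mul_inv]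
    ring
  rw [lhs, hV, hS, Finset.prod_congr rfl fun j _ => hT j, hy]
  simp only [Finset.prod_div_distrib, Finset.prod_mul_distrib, Finset.prod_const,
    Finset.card_univ, Fintype.card_fin, tailPeriodic, tailFactor]
  have hz3 : 1 - z ^ 2 = z ^ 3 * (z⁻¹ * (z⁻¹ ^ 2 - 1)) := by field_simp
  have hz4 : z ^ 3 * z⁻¹ ^ 3 = 1 := by rw [← mul_pow, mul_inv_cancel₀ hz0, one_pow]
  rw [hz3]
  simp only [div_eq_mul_inv, mul_inv] at hmod ⊢
  set R := (∏ j, s j) * z⁻¹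
  linear_combination (κ * z ^ 3 * (z⁻¹ * (z⁻¹ ^ 2 - 1)) * (1 - qPow τ x ^ 2) * κ *
    qFac τ (5 - ∑ j, t j + x) * (qPochhammer (p * (∏ j, s j)⁻¹ * z⁻¹) p)⁻¹ *
    (∏ j, qPochhammer (p * (s j)⁻¹ * z⁻¹) p) * (κ ^ 5)⁻¹ *
    (∏ j, qFac τ (1 - t j + x))⁻¹ * qPochhammer R p * (∏ j, qPochhammer (s j * z⁻¹) p)⁻¹ *
    (∏ j, qFac τ (t j + x)) * (qFac τ (∑ j, t j - 4 + x))⁻¹) * hmod +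
    (κ * (z⁻¹ * (z⁻¹ ^ 2 - 1)) * (1 - qPow τ x ^ 2) * κ *
    qFac τ (5 - ∑ j, t j + x) * (qPochhammer (p * (∏ j, s j)⁻¹ * z⁻¹) p)⁻¹ *
    (∏ j, qPochhammer (p * (s j)⁻¹ * z⁻¹) p) * (κ ^ 5)⁻¹ *
    (∏ j, qFac τ (1 - t j + x))⁻¹ * qPochhammer R p * (∏ j, qPochhammer (s j * z⁻¹) p)⁻¹ *
    (∏ j, qFac τ (t j + x)) * (qFac τ (∑ j, t j - 4 + x))⁻¹ *
    (modFactor τ (∑ j, t j - 4) * (∏ j, modFactor τ (t j))⁻¹ * qPow τ x)) * hz4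

theorem integrable_exp_neg_mul_abs {c : ℝ} (hc : 0 < c) :
    MeasureTheory.Integrable fun x : ℝ => Real.exp (-(c * |x|)) := by
  have h1 : MeasureTheory.IntegrableOn (fun x : ℝ => Real.exp (-(c * |x|))) (Set.Ioi 0) := by
    refine (exp_neg_integrableOn_Ioi 0 hc).congr_fun (fun x hx => ?_) measurableSet_Ioi
    simp only [abs_of_pos (Set.mem_Ioi.mp hx), neg_mul]
  have h2 : MeasureTheory.IntegrableOn (fun x : ℝ => Real.exp (-(c * |x|))) (Set.Iic 0) := by
    refine (integrableOn_exp_mul_Iic hc 0).congr_fun (fun x hx => ?_) measurableSet_Iic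
    simp only [abs_of_nonpos (Set.mem_Iic.mp hx), mul_neg, neg_neg]
  rw [← MeasureTheory.integrableOn_univ, ← Set.Iic_union_Ioi (a := (0 : ℝ))]
  exact h2.union h1

theorem ae_norm_le_of_even {E : Type*} [NormedAddCommGroup E] {f : ℝ → E} {g : ℝ → ℝ}
    (heven : ∀ x, f (-x) = f x)
    (hb : ∀ x : ℝ, 0 ≤ x → (∀ n : ℤ, 2 * x ≠ n) → ‖f x‖ ≤ g x) :
    ∀ᵐ x : ℝ, ‖f x‖ ≤ g |x| := by
  filter_upwards [ae_two_mul_ne_int] with x hx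
  rcases le_total 0 x with h | h
  · rw [abs_of_nonneg h]; exact hb x h hx
  · rw [abs_of_nonpos h, ← heven]
    exact hb _ (by linarith) fun n hn => hx (-n) (by push_cast; linarith)

theorem trigWeight_inv (p : ℂ) (s : Fin 5 → ℂ) (z : ℂ) :
    trigWeight p s z⁻¹ = trigWeight p s z := by
  unfold trigWeight
  simp only [div_inv_eq_mul, inv_pow, one_mul, ← div_eq_mul_inv, one_div]
  rw [Finset.prod_congr rfl fun j _ => mul_comm (qPochhammer (s j / z) p) (qPochhammer (s j * z) p)]
  ring

theorem nassrallahRahmanIntegrand_neg (τ : ℂ) (t : Fin 5 → ℂ) (x : ℂ) :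
    nassrallahRahmanIntegrand τ t (-x) = nassrallahRahmanIntegrand τ t x := by
  rw [nassrallahRahmanIntegrand_eq, nassrallahRahmanIntegrand_eq, hypWeight_neg, mul_neg,
    Complex.exp_neg, trigWeight_inv]

theorem continuous_trigWeight_expParam {τ : ℂ} (hτ : 0 < τ.im) {t : Fin 5 → ℂ}
    (ht : ∀ j, (t j).im < 0) :
    Continuous fun x : ℝ => trigWeight (qTildePow τ 1) (expParam t) (cexp (2 * π * I * x)) :=
  continuous_trigWeight (norm_qTildePow_one_lt_one hτ) fun j => norm_expParam_lt_one (ht j)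

theorem measurable_hypWeight {τ : ℂ} (hτ : 0 < τ.im) (t : Fin 5 → ℂ) :
    Measurable fun x : ℝ => hypWeight τ t x := by
  have c := continuous_qFac hτ
  unfold hypWeight
  refine Measurable.div (Continuous.measurable ?_) (Continuous.measurable ?_)
  · exact continuous_finsetProd _ fun j _ => (c.comp (by fun_prop)).mul (c.comp (by fun_prop))
  · exact ((c.comp (by fun_prop)).mul (c.comp (by fun_prop))).mul
      ((c.comp (by fun_prop)).mul (c.comp (by fun_prop)))

theorem norm_qPow_ofReal (τ : ℂ) (x : ℝ) : ‖qPow τ x‖ = Real.exp (-(2 * π * τ.im * x)) := by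
  rw [norm_qPow]; congr 1; simp; ring

theorem norm_qPow_ofReal_le_one {τ : ℂ} (hτ : 0 < τ.im) {x : ℝ} (hx : 0 ≤ x) :
    ‖qPow τ x‖ ≤ 1 := by
  rw [norm_qPow_ofReal, Real.exp_le_one_iff, neg_nonpos]; positivity

theorem norm_one_sub_qPow_sq_le {τ : ℂ} (hτ : 0 < τ.im) {x : ℝ} (hx : 0 ≤ x) :
    ‖1 - qPow τ x ^ 2‖ ≤ 2 := by
  refine (norm_sub_le _ _).trans ?_
  have := pow_le_one₀ (n := 2) (norm_nonneg _) (norm_qPow_ofReal_le_one hτ hx)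
  rw [norm_one, norm_pow]; linarith

/-- In the tail form only $q^x$ is unbounded below in size; it gives decay
$e^{-2\pi\operatorname{Im}(\tau)x}$ for $x\ge0$, and evenness covers $x<0$. -/
theorem integrable_nassrallahRahmanIntegrand {τ : ℂ} (hτ : 0 < τ.im) {t : Fin 5 → ℂ}
    (h : Admissible τ t) :
    MeasureTheory.Integrable fun x : ℝ => nassrallahRahmanIntegrand τ t x := by
  obtain ⟨κ, hκ⟩ := exists_integrand_eq_tail hτ
  have hK := hκ t h
  generalize κ * (modFactor τ (∑ j, t j - 4) / ∏ j, modFactor τ (t j)) = K at hK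
  obtain ⟨C₁, hC₁, h₁⟩ := exists_bound_tailPeriodic hτ h
  obtain ⟨C₂, hC₂, h₂⟩ := exists_bound_of_tendsto (continuous_tailFactor hτ h)
    (tendsto_tailFactor hτ t)
  have hc : 0 < 2 * π * τ.im := by positivity
  refine ((integrable_exp_neg_mul_abs hc).const_mul (‖K‖ * 2 * C₁ * C₂)).mono' ?_ ?_
  · simp only [nassrallahRahmanIntegrand_eq]
    exact ((continuous_trigWeight_expParam hτ h.1).measurable.mul
      (measurable_hypWeight hτ t)).aestronglyMeasurable
  · refine ae_norm_le_of_even (f := fun x : ℝ => nassrallahRahmanIntegrand τ t x)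
      (g := fun x => ‖K‖ * 2 * C₁ * C₂ * Real.exp (-(2 * π * τ.im * x)))
      (fun x => by simp only [ofReal_neg, nassrallahRahmanIntegrand_neg]) fun x hx hx2 => ?_
    rw [nassrallahRahmanIntegrand_eq, hK x hx2, norm_mul, norm_mul, norm_mul, norm_mul,
      norm_qPow_ofReal]
    calc _ ≤ ‖K‖ * (2 * Real.exp (-(2 * π * τ.im * x))) * C₁ * C₂ := by
          gcongr
          · exact norm_one_sub_qPow_sq_le hτ hx
          · exact h₁ x
          · exact h₂ x hx
      _ = _ := by ring

/-! ### The contiguous relation for the hyperbolic integral. -/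

/-- A function which is the difference of a suitable function and its shift has integral zero. -/
theorem integral_eq_zero_of_telescope {f g P R : ℝ → ℂ} (hf : MeasureTheory.Integrable f)
    (hP : Continuous P) (hper : Function.Periodic P 1) (hP0 : ∫ x in (0 : ℝ)..1, P x = 0)
    (hR : Continuous R) (hR1 : Tendsto R atTop (𝓝 1)) (hg : ∀ x, g x = P x * R x)
    (hfg : ∀ᵐ x, f x = g x - g (x + 1)) (hodd : ∀ᵐ x, g (1 - x) = -g x) :
    ∫ x, f x = 0 := by
  have hgc : Continuous g := by
    rw [show g = fun x => P x * R x from funext hg]; exact hP.mul hR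
  have hgi : ∀ a b : ℝ, IntervalIntegrable g MeasureTheory.volume a b :=
    fun a b => hgc.intervalIntegrable a b
  have h1 : Tendsto (fun M : ℕ => ∫ x in (-(M : ℝ))..M, f x) atTop (𝓝 (∫ x, f x)) :=
    MeasureTheory.intervalIntegral_tendsto_integral hf
      (tendsto_neg_atTop_atBot.comp tendsto_natCast_atTop_atTop) tendsto_natCast_atTop_atTop
  -- Telescoping leaves the integrals of $g$ over $[-M,-M+1]$ and $[M,M+1]$; the antisymmetry
  -- $g(1-x)=-g(x)$ makes them opposite, so their difference doubles.
  have h2 : ∀ M : ℕ, ∫ x in (-(M : ℝ))..M, f x = -2 * ∫ x in (0 : ℝ)..1, P x * R (x + M) := by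
    intro M
    have e1 : ∫ x in (-(M : ℝ))..M, f x = ∫ x in (-(M : ℝ))..M, (g x - g (x + 1)) :=
      intervalIntegral.integral_congr_ae (hfg.mono fun x hx _ => hx)
    have e2 : ∫ x in (-(M : ℝ))..M, g (x + 1) = ∫ x in (-(M : ℝ) + 1)..(M + 1), g x :=
      intervalIntegral.integral_comp_add_right g 1
    have e3 : ∫ x in (-(M : ℝ))..(-M + 1), g x = -∫ x in (M : ℝ)..(M + 1), g x := by
      have := intervalIntegral.integral_comp_sub_left (a := (M : ℝ)) (b := M + 1) g 1
      rw [show (1 : ℝ) - (M + 1) = -M by ring, show (1 : ℝ) - M = -M + 1 by ring] at this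
      rw [← this, ← intervalIntegral.integral_neg]
      exact intervalIntegral.integral_congr_ae (hodd.mono fun x hx _ => hx)
    have e4 : ∫ x in (M : ℝ)..(M + 1), g x = ∫ x in (0 : ℝ)..1, P x * R (x + M) := by
      have := intervalIntegral.integral_comp_add_right (a := 0) (b := 1) g (M : ℝ)
      rw [zero_add, add_comm (1 : ℝ)] at this
      rw [← this]
      refine intervalIntegral.integral_congr fun x _ => ?_
      simp only [hg]
      congr 1
      simpa using hper.nat_mul M x
    rw [e1, intervalIntegral.integral_sub (hgi _ _)
      ((by fun_prop : Continuous fun x => g (x + 1)).intervalIntegrable _ _), e2, ← e4]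
    have a1 := intervalIntegral.integral_add_adjacent_intervals (hgi (-(M : ℝ)) (-M + 1))
      (hgi (-M + 1) M)
    have a2 := intervalIntegral.integral_add_adjacent_intervals (hgi (-(M : ℝ) + 1) M)
      (hgi M (M + 1))
    rw [← a1, ← a2, e3]
    ring
  have h3 : Tendsto (fun M : ℕ => ∫ x in (0 : ℝ)..1, P x * R (x + M)) atTop (𝓝 0) := by
    rw [← hP0]
    obtain ⟨C, hC, hRC⟩ := exists_bound_of_tendsto hR hR1
    refine intervalIntegral.tendsto_integral_filter_of_dominated_convergence
      (fun x => ‖P x‖ * C) ?_ ?_ ?_ ?_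
    · exact Eventually.of_forall fun M => by fun_prop
    · refine Eventually.of_forall fun M => MeasureTheory.ae_of_all _ fun x hx => ?_
      rw [Set.uIoc_of_le zero_le_one] at hx
      rw [norm_mul]
      gcongr
      exact hRC _ (add_nonneg hx.1.le (Nat.cast_nonneg M))
    · exact (by fun_prop : Continuous fun x => ‖P x‖ * C).intervalIntegrable _ _
    · refine MeasureTheory.ae_of_all _ fun x _ => ?_
      have := hR1.comp (tendsto_atTop_add_const_left atTop x tendsto_natCast_atTop_atTop)
      simpa using tendsto_const_nhds.mul this
  refine tendsto_nhds_unique h1 ?_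
  simp_rw [h2]
  simpa using h3.const_mul (-2)

/-- The denominator $Z(1-Z^2)$ of the boundary factor cancels $q^x(1-q^{2x})$ in the tail form. This
removes the singularities at half-integers and also the decay: what remains is a mean-zero periodic
function times a factor tending to 1. -/
theorem exists_hypBoundary_eq {τ : ℂ} (hτ : 0 < τ.im) {t : Fin 5 → ℂ} (h : Admissible τ t)
    (i : Fin 5) : ∃ P R : ℝ → ℂ, Continuous P ∧ Function.Periodic P 1 ∧
      ∫ x in (0 : ℝ)..1, P x = 0 ∧ Continuous R ∧ Tendsto R atTop (𝓝 1) ∧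
      ∀ x : ℝ, (∀ n : ℤ, 2 * x ≠ n) →
        trigWeight (qTildePow τ 1) (expParam t) (cexp (2 * π * I * x)) *
          (hypWeight τ t x * hypBoundaryFactor τ t i (qPow τ x)) = P x * R x := by
  obtain ⟨κ, hκ⟩ := exists_integrand_eq_tail hτ
  have hK := hκ t h
  set K := κ * (modFactor τ (∑ j, t j - 4) / ∏ j, modFactor τ (t j))
  set c := K * (qPow τ (t i - 1) * (1 - qPow τ (∑ j, t j - 5) * qPow τ (t i - 1))) with hc
  have hB : ∀ x : ℝ, 1 - qPow τ (∑ j, t j - 5 + x) ≠ 0 := fun x =>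
    sub_ne_zero.mpr (OffLattice.qPow_ne_one hτ (h.offLattice_sum.congr (by simp))).symm
  have hcq : Continuous (qPow τ) := by unfold qPow; fun_prop
  refine ⟨fun x => c * tailPeriodic (qTildePow τ 1) (expParam t) (cexp (-(2 * π * I * x))),
    fun x => tailFactor τ t x * ((∏ j, (1 - qPow τ (t j - 1 + x))) /
      (1 - qPow τ (∑ j, t j - 5 + x))), (continuous_tailPeriodic hτ h).const_mul c, fun x => ?_,
      ?_, ?_, ?_, fun x hx => ?_⟩
  · simp only
    rw [← exp_add_int (-(2 * π * I * x)) (-1)]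
    congr 3
    push_cast; ring
  · rw [intervalIntegral.integral_const_mul, integral_tailPeriodic hτ h, mul_zero]
  · refine (continuous_tailFactor hτ h).mul (Continuous.div ?_ ?_ hB)
    · exact continuous_finsetProd _ fun j _ => continuous_const.sub (hcq.comp (by fun_prop))
    · exact continuous_const.sub (hcq.comp (by fun_prop))
  · have h1 : ∀ w : ℂ, Tendsto (fun x : ℝ => 1 - qPow τ (w + x)) atTop (𝓝 1) := fun w => by
      simpa using (tendsto_qPow_add_ofReal hτ w).const_sub 1
    have := (tendsto_tailFactor hτ t).mul ((tendsto_finsetProd Finset.univ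
      fun (j : Fin 5) _ => h1 (t j - 1)).div (h1 (∑ j, t j - 5)) one_ne_zero)
    simpa [Pi.div_def] using this
  · have hZ : qPow τ x ≠ 0 := qPow_ne_zero τ x
    have hv : 1 - qPow τ x ^ 2 ≠ 0 := sub_ne_zero.mpr (qPow_ofReal_sq_ne_one hτ hx).symm
    have hBx := hB x
    rw [← mul_assoc, hK x hx, hypBoundaryFactor, hc]
    simp only [← qPow_add (v := (x : ℂ))]
    generalize 1 - qPow τ x ^ 2 = v at *
    generalize 1 - qPow τ (∑ j, t j - 5 + x) = Y at *
    field_simp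

theorem sum_update_add_one (t : Fin 5 → ℂ) (i : Fin 5) :
    ∑ j, Function.update t i (t i + 1) j = ∑ j, t j + 1 := by
  rw [Fin.sum_univ_succAbove _ i, Fin.sum_univ_succAbove t i]; simp; ring

theorem expParam_update (t : Fin 5 → ℂ) (i : Fin 5) :
    expParam (Function.update t i (t i + 1)) = expParam t := by
  refine expParam_congr fun j => ?_
  by_cases hj : j = i
  · subst hj; exact ⟨1, by simp⟩
  · exact ⟨0, by simp [hj]⟩

/-- The hyperbolic Nassrallah–Rahman integral. -/
noncomputable def hypIntegral (τ : ℂ) (t : Fin 5 → ℂ) : ℂ :=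
  ∫ x : ℝ, nassrallahRahmanIntegrand τ t x

theorem hypIntegral_update {τ : ℂ} (hτ : 0 < τ.im) {t : Fin 5 → ℂ} (h : Admissible τ t)
    (i : Fin 5) :
    (∏ j : Fin 4, (1 - qPow τ (t i + t (i.succAbove j) - 1))) *
        hypIntegral τ (Function.update t i (t i + 1)) =
      (∏ j : Fin 4, (1 - qPow τ (∑ j, t j - t (i.succAbove j) - 3))) * hypIntegral τ t := by
  have h' := h.update i
  set t' := Function.update t i (t i + 1) with ht'
  have hs : expParam t' = expParam t := expParam_update t i
  obtain ⟨P, R, hP, hper, hP0, hR, hR1, hG⟩ := exists_hypBoundary_eq hτ h' i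
  have i1 := integrable_nassrallahRahmanIntegrand hτ h
  have i2 := integrable_nassrallahRahmanIntegrand hτ h'
  rw [hs] at hG
  rw [hypIntegral, hypIntegral, ← MeasureTheory.integral_const_mul,
    ← MeasureTheory.integral_const_mul, ← sub_eq_zero,
    ← MeasureTheory.integral_sub (i2.const_mul _) (i1.const_mul _)]
  have hshift : ∀ x : ℝ, cexp (2 * π * I * (x + 1)) = cexp (2 * π * I * x) := fun x => by
    rw [← exp_add_int (2 * π * I * x) 1]; congr 1; push_cast; ring
  refine integral_eq_zero_of_telescope (g := fun x => P x * R x)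
    ((i2.const_mul _).sub (i1.const_mul _)) hP hper hP0 hR hR1 (fun _ => rfl) ?_ ?_
  · filter_upwards [ae_two_mul_ne_int] with x hx
    have hx1 : ∀ n : ℤ, 2 * (x + 1) ≠ n := fun n hn => hx (n - 2) (by push_cast; linarith)
    rw [← hG x hx, ← hG (x + 1) hx1, ofReal_add, ofReal_one, hshift,
      nassrallahRahmanIntegrand_eq, nassrallahRahmanIntegrand_eq, hs]
    linear_combination trigWeight (qTildePow τ 1) (expParam t) (cexp (2 * π * I * x)) *
      hypWeight_sub hτ t i hx h.offLattice_sum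
  · filter_upwards [ae_two_mul_ne_int] with x hx
    have hx1 : ∀ n : ℤ, 2 * (1 - x) ≠ n := fun n hn => hx (2 - n) (by push_cast; linarith)
    have e1 : cexp (2 * π * I * (1 - x : ℝ)) = (cexp (2 * π * I * x))⁻¹ := by
      rw [← Complex.exp_neg, ← exp_add_int (-(2 * π * I * x)) 1]; congr 1; push_cast; ring
    -- The shift relation at $-x$, with evenness of the weights, is exactly the antisymmetry of $g$
    -- about $1/2$.
    have e2 := hypWeight_add_one hτ t' i (-x)
    rw [show -(x : ℂ) + 1 = ((1 - x : ℝ) : ℂ) by push_cast; ring, hypWeight_neg,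
      show 1 / qPow τ (-x) = qPow τ x by
        rw [← qPow_zero τ, ← qPow_sub, zero_sub, neg_neg]] at e2
    rw [← hG x hx, ← hG (1 - x) hx1, e1, trigWeight_inv, e2, mul_neg]

/-- The integral divided by its expected value, up to a constant. -/
noncomputable def hypNormalized (τ : ℂ) (t : Fin 5 → ℂ) : ℂ :=
  hypIntegral τ t * (∏ j, qFac τ (∑ k, t k - t j - 3)) /
    ∏ k, ∏ m ∈ Finset.Ioi k, qFac τ (t k + t m - 1)

theorem Admissible.offLattice_add {τ : ℂ} {t : Fin 5 → ℂ} (h : Admissible τ t) {k m : Fin 5}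
    (hkm : k ≠ m) : OffLattice τ (t k + t m) := by
  have h1 : (t k + t m).im < 0 := add_neg (h.1 k) (h.1 m)
  have h2 : (∑ j, t j).im ≤ (t k + t m).im := by
    rw [im_sum, add_im, ← Finset.sum_pair hkm (f := fun j => (t j).im), ← neg_le_neg_iff,
      ← Finset.sum_neg_distrib, ← Finset.sum_neg_distrib]
    exact Finset.sum_le_sum_of_subset_of_nonneg (Finset.subset_univ _)
      fun j _ _ => neg_nonneg.mpr (h.1 j).le
  exact ⟨h1.ne, by rw [abs_of_neg h1]; linarith [h.2]⟩

theorem Admissible.prod_qFac_ne_zero {τ : ℂ} (hτ : 0 < τ.im) {t : Fin 5 → ℂ}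
    (h : Admissible τ t) : ∏ k, ∏ m ∈ Finset.Ioi k, qFac τ (t k + t m - 1) ≠ 0 :=
  Finset.prod_ne_zero_iff.mpr fun _ _ => Finset.prod_ne_zero_iff.mpr fun _ hm =>
    OffLattice.qFac_ne_zero hτ ((h.offLattice_add (Finset.mem_Ioi.mp hm).ne).congr (by simp))

/-- As in the trigonometric case, raising $t_i$ by one strips from the two products precisely the
linear factors in the contiguous relation. -/
theorem hypNormalized_update {τ : ℂ} (hτ : 0 < τ.im) {t : Fin 5 → ℂ} (h : Admissible τ t)
    (i : Fin 5) : hypNormalized τ (Function.update t i (t i + 1)) = hypNormalized τ t := by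
  have key := hypIntegral_update hτ h i
  have h' := h.update i
  set t' := Function.update t i (t i + 1) with ht'
  have hi : t' i = t i + 1 := by simp [ht']
  have hj : ∀ j, t' (i.succAbove j) = t (i.succAbove j) := by simp [ht']
  have hS : ∑ j, t' j = ∑ j, t j + 1 := sum_update_add_one t i
  have hD : ∏ j : Fin 4, (1 - qPow τ (t i + t (i.succAbove j) - 1)) ≠ 0 :=
    Finset.prod_ne_zero_iff.mpr fun j _ => sub_ne_zero.mpr (OffLattice.qPow_ne_one hτ
      ((h.offLattice_add (Fin.succAbove_ne i j).symm).congr (by simp))).symm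
  have hden : ∏ k, ∏ m ∈ Finset.Ioi k, qFac τ (t k + t m - 1) =
      (∏ j : Fin 4, (1 - qPow τ (t i + t (i.succAbove j) - 1))) *
        ∏ k, ∏ m ∈ Finset.Ioi k, qFac τ (t' k + t' m - 1) := by
    rw [prod_Ioi_succAbove (fun k m => qFac τ (t k + t m - 1))
        (fun k m => by rw [add_comm (t k)]) i,
      prod_Ioi_succAbove (fun k m => qFac τ (t' k + t' m - 1))
        (fun k m => by rw [add_comm (t' k)]) i]
    simp only [hi, hj]
    have : ∀ j : Fin 4, qFac τ (t i + t (i.succAbove j) - 1) =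
        (1 - qPow τ (t i + t (i.succAbove j) - 1)) * qFac τ (t i + 1 + t (i.succAbove j) - 1) :=
      fun j => by rw [qFac_eq_mul hτ]; congr 2; ring
    simp_rw [this, Finset.prod_mul_distrib]
    ring
  have hnum : ∏ j, qFac τ (∑ k, t k - t j - 3) =
      (∏ j : Fin 4, (1 - qPow τ (∑ j, t j - t (i.succAbove j) - 3))) *
        ∏ j, qFac τ (∑ k, t' k - t' j - 3) := by
    rw [hS, Fin.prod_univ_succAbove (fun j => qFac τ (∑ k, t k - t j - 3)) i,
      Fin.prod_univ_succAbove (fun j => qFac τ (∑ k, t k + 1 - t' j - 3)) i, hi,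
      mul_left_comm, ← Finset.prod_mul_distrib]
    congr 1
    · congr 1; ring
    · refine Finset.prod_congr rfl fun j _ => ?_
      rw [hj, qFac_eq_mul hτ]
      congr 2; ring
  have hden0 := h'.prod_qFac_ne_zero hτ
  rw [hypNormalized, hypNormalized, hden, hnum, div_eq_div_iff hden0 (mul_ne_zero hD hden0)]
  linear_combination ((∏ j, qFac τ (∑ k, t' k - t' j - 3)) *
    ∏ k, ∏ m ∈ Finset.Ioi k, qFac τ (t' k + t' m - 1)) * key

/-- The normalized integral is invariant under integer shifts of the parameters. -/
theorem hypNormalized_add_nat {τ : ℂ} (hτ : 0 < τ.im) {t : Fin 5 → ℂ} (h : Admissible τ t)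
    (T : Finset (Fin 5)) (N : ℕ) :
    hypNormalized τ (fun j => t j + if j ∈ T then (N : ℂ) else 0) = hypNormalized τ t := by
  induction N with
  | zero => simp
  | succ N ih =>
    rw [← ih, ← (eq_of_update_invariant (F := hypNormalized τ) (φ := fun w => w + 1)
      (G := Admissible τ) (s := fun j => t j + if j ∈ T then (N : ℂ) else 0)
      (fun s hs i => ⟨hs.update i, hypNormalized_update hτ hs i⟩)
      (h.congr fun j => by split_ifs <;> simp) T).2]
    congr 1
    funext j
    split_ifs
    · push_cast; ring
    · rfl

/-! ### Domination uniform in $N$ when all parameters are shifted by $N$. -/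

theorem norm_modFactor (τ z : ℂ) :
    ‖modFactor τ z‖ = Real.exp (-(π * (τ * z ^ 2 - (1 + τ) * z).im)) := by
  rw [modFactor, Complex.norm_exp, mul_assoc, re_ofReal_mul, I_mul_re, mul_neg]

theorem neg_mul_sq_add_le {A : ℝ} (hA : 0 < A) (b x : ℝ) :
    -(A * x ^ 2) + b * x ≤ b ^ 2 / (4 * A) := by
  rw [le_div_iff₀ (by positivity)]
  nlinarith [sq_nonneg (2 * A * x - b)]

/-- The growth of the shifted factorial towards `-∞`. -/
theorem exists_bound_qFac_sub {τ : ℂ} (hτ : 0 < τ.im) {w : ℂ} (hw : OffLattice τ w) :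
    ∃ C c : ℝ, 0 < C ∧ 0 ≤ c ∧ ∀ y : ℝ, 0 ≤ y →
      ‖qFac τ (w - y)‖ ≤ C * Real.exp (π * τ.im * y ^ 2 + c * y) := by
  obtain ⟨κ, hκ0, hκ⟩ := exists_reflection hτ
  have hp := norm_qTildePow_one_lt_one hτ
  obtain ⟨M₁, hM₁, h₁⟩ := exists_norm_qPochhammer_le hp ‖cexp (-(2 * π * I * w))‖
  obtain ⟨M₂, hM₂, h₂⟩ := exists_norm_qPochhammer_le hp
    ‖qTildePow τ 1 / cexp (-(2 * π * I * w))‖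
  obtain ⟨M₃, hM₃, h₃⟩ := exists_bound_inv_qFac hτ (w := 1 - w) (hw.neg.congr (by simp))
  set g := π * (τ * w ^ 2 - (1 + τ) * w).im
  set c := π * (τ.im - 2 * (τ * w).im)
  refine ⟨M₁ * M₂ * M₃ * ‖κ‖⁻¹ * Real.exp g, |c|,
    mul_pos (mul_pos (by positivity) (inv_pos.mpr (norm_pos_iff.mpr hκ0))) (Real.exp_pos _),
    abs_nonneg c, fun y hy => ?_⟩
  have hn : ‖cexp (-(2 * π * I * (w - y)))‖ = ‖cexp (-(2 * π * I * w))‖ := by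
    rw [norm_exp_neg_two_pi_I_mul, norm_exp_neg_two_pi_I_mul]; simp
  have hne : qFac τ (1 - w + y) ≠ 0 := OffLattice.qFac_ne_zero hτ (hw.neg.congr (by simp))
  -- By reflection all growth is in the Gaussian: the arguments of the $\tilde q$-symbols have
  -- modulus independent of $y$, and $(q^{1-w+y};q)_\infty^{-1}$ is bounded.
  have key : qFac τ (w - y) = qPochhammer (cexp (-(2 * π * I * (w - y)))) (qTildePow τ 1) *
      qPochhammer (qTildePow τ 1 / cexp (-(2 * π * I * (w - y)))) (qTildePow τ 1) *
      (qFac τ (1 - w + y))⁻¹ * κ⁻¹ * (modFactor τ (w - y))⁻¹ := by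
    rw [hκ, show 1 - (w - y) = 1 - w + y by ring]
    have := modFactor_ne_zero τ (w - y)
    field_simp
  have hmod : ‖(modFactor τ (w - y))⁻¹‖ ≤
      Real.exp g * Real.exp (π * τ.im * y ^ 2 + |c| * y) := by
    rw [norm_inv, norm_modFactor, ← Real.exp_neg, neg_neg, ← Real.exp_add, Real.exp_le_exp]
    have e : (τ * (w - y) ^ 2 - (1 + τ) * (w - y)).im = (τ * w ^ 2 - (1 + τ) * w).im +
        τ.im * y ^ 2 + (τ.im - 2 * (τ * w).im) * y := by
      have : τ * (w - y) ^ 2 - (1 + τ) * (w - y) = (τ * w ^ 2 - (1 + τ) * w) +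
        τ * ((y ^ 2 : ℝ) : ℂ) + (τ - (2 : ℝ) * (τ * w)) * y + y := by push_cast; ring
      have h2 : (τ - (2 : ℝ) * (τ * w)).im = τ.im - 2 * (τ * w).im := by
        rw [sub_im, im_ofReal_mul]
      rw [this, add_im, add_im, add_im, im_mul_ofReal, im_mul_ofReal, h2, ofReal_im, add_zero]
    rw [e]
    have := mul_le_mul_of_nonneg_right (le_abs_self c) hy
    simp only [g, c] at this ⊢
    linarith
  rw [key, norm_mul, norm_mul, norm_mul, norm_mul, norm_inv κ]
  calc _ ≤ M₁ * M₂ * M₃ * ‖κ‖⁻¹ * (Real.exp g * Real.exp (π * τ.im * y ^ 2 + |c| * y)) := by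
        gcongr
        · exact h₁ _ hn.le
        · exact h₂ _ (by rw [norm_div, norm_div, hn])
        · exact h₃ y hy
    _ = _ := by ring

theorem exists_bound_qFac_add_nat_sub {τ : ℂ} (hτ : 0 < τ.im) {w : ℂ} (hw : OffLattice τ w) :
    ∃ C c : ℝ, 0 < C ∧ 0 ≤ c ∧ ∀ (N : ℕ) (x : ℝ), 0 ≤ x → x ≤ 5 * N →
      ‖qFac τ (w + N - x)‖ ≤ C * Real.exp (π * τ.im * (16 / 25) * x ^ 2 + c * x) := by
  obtain ⟨C, c, hC, hc, h⟩ := exists_bound_qFac_sub hτ hw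
  obtain ⟨D, hD, h'⟩ := exists_bound_qFac hτ w
  refine ⟨max C D, c, lt_max_of_lt_left hC, hc, fun N x hx hxN => ?_⟩
  have hE : 0 < π * τ.im := by positivity
  rcases le_total x N with hle | hle
  · have := h' (N - x) (sub_nonneg.mpr hle)
    rw [show w + ((N - x : ℝ) : ℂ) = w + N - x by push_cast; ring] at this
    refine (this.trans (le_max_right C D)).trans (le_mul_of_one_le_right (by positivity) ?_)
    rw [Real.one_le_exp_iff]
    positivity
  · have := h (x - N) (sub_nonneg.mpr hle)
    rw [show w - ((x - N : ℝ) : ℂ) = w + N - x by push_cast; ring] at this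
    refine this.trans (mul_le_mul (le_max_left C D) ?_ (Real.exp_pos _).le (by positivity))
    rw [Real.exp_le_exp]
    -- From $x\le5N$ one gets $0\le x-N\le\frac45x$.
    have h1 : (x - N) ^ 2 ≤ 16 / 25 * x ^ 2 := by nlinarith
    have h2 : c * (x - N) ≤ c * x := mul_le_mul_of_nonneg_left (by simp) hc
    nlinarith

theorem exists_bound_sq_div_qFac {τ : ℂ} (hτ : 0 < τ.im) : ∃ C : ℝ, 0 < C ∧
    ∀ x : ℝ, 0 ≤ x → (∀ n : ℤ, 2 * x ≠ n) →
      ‖qPochhammer (cexp (2 * π * I * x) ^ 2) (qTildePow τ 1) *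
        qPochhammer (1 / cexp (2 * π * I * x) ^ 2) (qTildePow τ 1) /
          (qFac τ (1 + 2 * x) * qFac τ (1 - 2 * x))‖ ≤
        C * Real.exp (-(4 * (π * τ.im) * x ^ 2) + 2 * (π * τ.im) * x) := by
  obtain ⟨κ, hκ0, hκ⟩ := exists_reflection hτ
  refine ⟨‖κ‖ * 4, mul_pos (norm_pos_iff.mpr hκ0) (by norm_num), fun x hx hx2 => ?_⟩
  rw [qPochhammer_sq_div_qFac hτ hκ hx2, norm_mul, norm_mul, norm_mul, norm_modFactor]
  have h1 : ‖1 - cexp (2 * π * I * x) ^ 2‖ ≤ 2 := by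
    refine (norm_sub_le _ _).trans ?_
    rw [norm_pow, norm_exp_two_pi_I_mul_ofReal]; norm_num
  have h2 : -(π * (τ * (2 * x) ^ 2 - (1 + τ) * (2 * x)).im) =
      -(4 * (π * τ.im) * x ^ 2) + 2 * (π * τ.im) * x := by
    have : τ * (2 * x) ^ 2 - (1 + τ) * (2 * x) =
        τ * ((4 * x ^ 2 - 2 * x : ℝ) : ℂ) - ((2 * x : ℝ) : ℂ) := by push_cast; ring
    rw [this, sub_im, im_mul_ofReal, ofReal_im]; ring
  rw [h2]
  calc _ ≤ ‖κ‖ * Real.exp (-(4 * (π * τ.im) * x ^ 2) + 2 * (π * τ.im) * x) * 2 * 2 := by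
        gcongr
        exact norm_one_sub_qPow_sq_le hτ hx
    _ = _ := by ring

/-- The part of the trigonometric weight which depends on the parameters. -/
noncomputable def trigParamWeight (p : ℂ) (s : Fin 5 → ℂ) (z : ℂ) : ℂ :=
  qPochhammer ((∏ j, s j) * z) p * qPochhammer ((∏ j, s j) / z) p /
    ∏ j, (qPochhammer (s j * z) p * qPochhammer (s j / z) p)

theorem exists_bound_trigParamWeight {p : ℂ} (hp : ‖p‖ < 1) {s : Fin 5 → ℂ}
    (hs1 : ∀ j, ‖s j‖ < 1) :
    ∃ C : ℝ, 0 < C ∧ ∀ z : ℂ, ‖z‖ = 1 → ‖trigParamWeight p s z‖ ≤ C := by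
  have cP := continuous_qPochhammer hp
  have hc : ContinuousOn (trigParamWeight p s) (Metric.sphere 0 1) := by
    intro z hz
    have hz1 : ‖z‖ = 1 := by simpa using hz
    have hz0 : z ≠ 0 := by rintro rfl; simp at hz1
    have c1 : ∀ a : ℂ, ContinuousAt (fun z => qPochhammer (a * z) p) z := fun a =>
      (cP.comp (continuous_const_mul a)).continuousAt
    have c2 : ∀ a : ℂ, ContinuousAt (fun z => qPochhammer (a / z) p) z := fun a =>
      ContinuousAt.comp (g := fun y => qPochhammer y p) (f := fun z => a / z) cP.continuousAt
        (continuousAt_const.div continuousAt_id hz0)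
    refine ContinuousAt.continuousWithinAt (ContinuousAt.div ((c1 _).mul (c2 _)) ?_ ?_)
    · exact tendsto_finsetProd _ fun j _ => (c1 _).mul (c2 _)
    · refine Finset.prod_ne_zero_iff.mpr fun j _ => mul_ne_zero ?_ ?_
      · exact qPochhammer_ne_zero_of_norm_lt_one hp (by rw [norm_mul, hz1, mul_one]; exact hs1 j)
      · exact qPochhammer_ne_zero_of_norm_lt_one hp (by rw [norm_div, hz1, div_one]; exact hs1 j)
  obtain ⟨C, hC⟩ := (isCompact_sphere (0 : ℂ) 1).exists_bound_of_continuousOn hc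
  exact ⟨max C 1, by positivity, fun z hz => (hC z (by simpa using hz)).trans (le_max_left _ _)⟩

/-- The quadratic coefficient in $N$ is $5^2-5=20>0$, so the ratio is a decaying Gaussian in $N$. -/
theorem exists_bound_modFactor_ratio {τ : ℂ} (hτ : 0 < τ.im) (t : Fin 5 → ℂ) :
    ∃ C : ℝ, 0 < C ∧ ∀ N : ℕ,
      ‖modFactor τ (∑ j, (t j + N) - 4) / ∏ j, modFactor τ (t j + N)‖ ≤ C := by
  set β := τ * (10 * (∑ j, t j - 4) - 2 * ∑ j, t j) with hβ
  set γ := τ * ((∑ j, t j - 4) ^ 2 - ∑ j, t j ^ 2) + 4 * (1 + τ) with hγ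
  have hA : 0 < 20 * (π * τ.im) := by positivity
  refine ⟨Real.exp ((-(π * β.im)) ^ 2 / (4 * (20 * (π * τ.im))) - π * γ.im), Real.exp_pos _,
    fun N => ?_⟩
  have e : modFactor τ (∑ j, (t j + N) - 4) / ∏ j, modFactor τ (t j + N) =
      cexp (π * (I * (τ * ((20 * N ^ 2 : ℝ) : ℂ) + β * (N : ℝ) + γ))) := by
    rw [div_eq_iff (Finset.prod_ne_zero_iff.mpr fun j _ => modFactor_ne_zero _ _)]
    simp only [modFactor, ← Complex.exp_sum, ← Complex.exp_add, Fin.sum_univ_five, hβ, hγ]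
    congr 1
    push_cast
    ring
  rw [e, Complex.norm_exp, re_ofReal_mul, I_mul_re, add_im, add_im, im_mul_ofReal, im_mul_ofReal,
    Real.exp_le_exp]
  have := neg_mul_sq_add_le hA (-(π * β.im)) N
  linarith

/-- For $x\le5N$ the symbol at $a-4+5N-x$ lies on its bounded side. The five symbols at $t_j+N-x$
grow at most like $e^{\frac{16}5\pi\operatorname{Im}(\tau)x^2}$ up to linear terms, which loses to
the factor $e^{-4\pi\operatorname{Im}(\tau)x^2}$ from the pair in $2x$. -/
theorem exists_bound_integrand_near {τ : ℂ} (hτ : 0 < τ.im) {t : Fin 5 → ℂ} (h : Admissible τ t) :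
    ∃ C : ℝ, ∀ (N : ℕ) (x : ℝ), 0 ≤ x → x ≤ 5 * N → (∀ n : ℤ, 2 * x ≠ n) →
      ‖trigWeight (qTildePow τ 1) (expParam t) (cexp (2 * π * I * x)) *
        hypWeight τ (fun j => t j + N) x‖ ≤ C * Real.exp (-(2 * π * τ.im * x)) := by
  have hp := norm_qTildePow_one_lt_one hτ
  have hE : 0 < π * τ.im := by positivity
  obtain ⟨C₁, hC₁, h₁⟩ := exists_bound_sq_div_qFac hτ
  obtain ⟨C₂, hC₂, h₂⟩ := exists_bound_trigParamWeight hp fun j => norm_expParam_lt_one (h.1 j)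
  choose C₃ hC₃ h₃ using fun j => exists_bound_qFac hτ (t j)
  choose C₄ c hC₄ hc h₄ using fun j => exists_bound_qFac_add_nat_sub hτ (h.offLattice j)
  obtain ⟨C₅, hC₅, h₅⟩ := exists_bound_inv_qFac hτ (w := ∑ j, t j - 4)
    (h.offLattice_sum.congr (by simp))
  -- Maximum of the leftover quadratic: $\frac45=4-\frac{16}5$, and half of the
  -- $4\pi\operatorname{Im}(\tau)$ in the linear term pays for the claimed decay
  -- $e^{-2\pi\operatorname{Im}(\tau)x}$.
  set B := (4 * (π * τ.im) + ∑ j, c j) ^ 2 / (4 * (4 / 5 * (π * τ.im)))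
  refine ⟨C₁ * C₂ * (∏ j, C₃ j) * (∏ j, C₄ j) * C₅ * C₅ * Real.exp B, fun N x hx hxN hx2 => ?_⟩
  have hsum : ∑ j, (t j + N) - 4 = ∑ j, t j - 4 + 5 * N := by
    rw [Finset.sum_add_distrib]; simp; ring
  have key : trigWeight (qTildePow τ 1) (expParam t) (cexp (2 * π * I * x)) *
        hypWeight τ (fun j => t j + N) x =
      (qPochhammer (cexp (2 * π * I * x) ^ 2) (qTildePow τ 1) *
        qPochhammer (1 / cexp (2 * π * I * x) ^ 2) (qTildePow τ 1) /
          (qFac τ (1 + 2 * x) * qFac τ (1 - 2 * x))) *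
      trigParamWeight (qTildePow τ 1) (expParam t) (cexp (2 * π * I * x)) *
      (∏ j, qFac τ (t j + ((N + x : ℝ) : ℂ))) * (∏ j, qFac τ (t j + N - x)) *
      (qFac τ (∑ j, t j - 4 + ((5 * N + x : ℝ) : ℂ)))⁻¹ *
      (qFac τ (∑ j, t j - 4 + ((5 * N - x : ℝ) : ℂ)))⁻¹ := by
    have a1 : ∀ j, t j + ((N + x : ℝ) : ℂ) = t j + N + x := fun j => by push_cast; ring
    have a2 : ∑ j, t j - 4 + ((5 * N + x : ℝ) : ℂ) = ∑ j, t j - 4 + 5 * N + x := by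
      push_cast; ring
    have a3 : ∑ j, t j - 4 + ((5 * N - x : ℝ) : ℂ) = ∑ j, t j - 4 + 5 * N - x := by
      push_cast; ring
    simp only [a1, a2, a3, trigWeight, trigParamWeight, hypWeight, hsum, Finset.prod_mul_distrib,
      div_eq_mul_inv, mul_inv]
    ring
  have hprod : ∏ j, ‖qFac τ (t j + N - x)‖ ≤
      (∏ j, C₄ j) * Real.exp (16 / 5 * (π * τ.im) * x ^ 2 + (∑ j, c j) * x) := by
    refine (Finset.prod_le_prod (fun j _ => norm_nonneg _) fun j _ => h₄ j N x hx hxN).trans_eq ?_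
    rw [Finset.prod_mul_distrib, ← Real.exp_sum, Finset.sum_add_distrib, Finset.sum_mul]
    congr 3
    simp; ring
  have hexp : Real.exp (-(4 * (π * τ.im) * x ^ 2) + 2 * (π * τ.im) * x) *
      Real.exp (16 / 5 * (π * τ.im) * x ^ 2 + (∑ j, c j) * x) ≤
      Real.exp B * Real.exp (-(2 * π * τ.im * x)) := by
    rw [← Real.exp_add, ← Real.exp_add, Real.exp_le_exp]
    have := neg_mul_sq_add_le (by positivity : 0 < 4 / 5 * (π * τ.im))
      (4 * (π * τ.im) + ∑ j, c j) x
    simp only [B]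
    linarith
  rw [key]
  simp only [norm_mul, norm_prod]
  simp only [← norm_mul]
  calc _ ≤ (C₁ * Real.exp (-(4 * (π * τ.im) * x ^ 2) + 2 * (π * τ.im) * x)) * C₂ *
        (∏ j, C₃ j) * ((∏ j, C₄ j) *
          Real.exp (16 / 5 * (π * τ.im) * x ^ 2 + (∑ j, c j) * x)) * C₅ * C₅ := by
        have p3 : 0 < ∏ j, C₃ j := Finset.prod_pos fun j _ => hC₃ j
        have p4 : 0 < ∏ j, C₄ j := Finset.prod_pos fun j _ => hC₄ j
        have b1 := h₁ x hx hx2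
        have b2 := h₂ _ (norm_exp_two_pi_I_mul_ofReal x)
        have b3 : ∏ j, ‖qFac τ (t j + ((N + x : ℝ) : ℂ))‖ ≤ ∏ j, C₃ j :=
          Finset.prod_le_prod (fun j _ => norm_nonneg _) fun j _ => h₃ j _ (by positivity)
        have b5 := h₅ (5 * N + x) (by positivity)
        have b6 := h₅ (5 * N - x) (by linarith)
        simp only [norm_mul] at b1 b2 b3 hprod b5 b6 ⊢
        gcongr
    _ = C₁ * C₂ * (∏ j, C₃ j) * (∏ j, C₄ j) * C₅ * C₅ *
        (Real.exp (-(4 * (π * τ.im) * x ^ 2) + 2 * (π * τ.im) * x) *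
          Real.exp (16 / 5 * (π * τ.im) * x ^ 2 + (∑ j, c j) * x)) := by ring
    _ ≤ C₁ * C₂ * (∏ j, C₃ j) * (∏ j, C₄ j) * C₅ * C₅ *
        (Real.exp B * Real.exp (-(2 * π * τ.im * x))) := by
        refine mul_le_mul_of_nonneg_left hexp ?_
        have p3 : 0 < ∏ j, C₃ j := Finset.prod_pos fun j _ => hC₃ j
        have p4 : 0 < ∏ j, C₄ j := Finset.prod_pos fun j _ => hC₄ j
        positivity
    _ = _ := by ring

theorem expParam_add_nat (t : Fin 5 → ℂ) (N : ℕ) : expParam (fun j => t j + N) = expParam t :=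
  expParam_congr fun _ => ⟨N, by simp⟩

/-- For $x\ge5N$ the tail form applies: every symbol in `tailFactor` has its argument shifted by a
nonnegative real, hence is bounded uniformly in $N$. -/
theorem exists_bound_integrand_far {τ : ℂ} (hτ : 0 < τ.im) {t : Fin 5 → ℂ} (h : Admissible τ t) :
    ∃ C : ℝ, ∀ (N : ℕ) (x : ℝ), 5 * N ≤ x → (∀ n : ℤ, 2 * x ≠ n) →
      ‖trigWeight (qTildePow τ 1) (expParam t) (cexp (2 * π * I * x)) *
        hypWeight τ (fun j => t j + N) x‖ ≤ C * Real.exp (-(2 * π * τ.im * x)) := by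
  obtain ⟨κ, hκ⟩ := exists_integrand_eq_tail hτ
  obtain ⟨C₁, hC₁, h₁⟩ := exists_bound_modFactor_ratio hτ t
  obtain ⟨C₂, hC₂, h₂⟩ := exists_bound_tailPeriodic hτ h
  choose C₃ hC₃ h₃ using fun j => exists_bound_qFac hτ (t j)
  choose C₄ hC₄ h₄ using fun j => exists_bound_inv_qFac hτ (w := 1 - t j)
    ((h.offLattice j).neg.congr (by simp))
  obtain ⟨C₅, hC₅, h₅⟩ := exists_bound_qFac hτ (5 - ∑ j, t j)
  obtain ⟨C₆, hC₆, h₆⟩ := exists_bound_inv_qFac hτ (w := ∑ j, t j - 4)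
    (h.offLattice_sum.congr (by simp))
  refine ⟨‖κ‖ * C₁ * 2 * C₂ * ((∏ j, C₃ j * C₄ j) * (C₅ * C₆)), fun N x hxN hx2 => ?_⟩
  have hN : (0 : ℝ) ≤ N := Nat.cast_nonneg N
  have hx : 0 ≤ x := by linarith
  have hN' : Admissible τ (fun j => t j + N) := h.congr fun j => by simp
  have hsum : ∑ j, (t j + N) = ∑ j, t j + 5 * N := by
    rw [Finset.sum_add_distrib]; simp
  have htail : ‖tailFactor τ (fun j => t j + N) x‖ ≤ (∏ j, C₃ j * C₄ j) * (C₅ * C₆) := by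
    have p : 0 < ∏ j, C₃ j * C₄ j := Finset.prod_pos fun j _ => mul_pos (hC₃ j) (hC₄ j)
    rw [tailFactor, norm_mul, norm_prod]
    refine mul_le_mul (Finset.prod_le_prod (fun j _ => norm_nonneg _) fun j _ => ?_) ?_
      (norm_nonneg _) p.le
    · have a3 := h₃ j (N + x) (by positivity)
      have a4 := h₄ j (x - N) (by linarith)
      rw [show t j + ((N + x : ℝ) : ℂ) = t j + N + x by push_cast; ring] at a3
      rw [show 1 - t j + ((x - N : ℝ) : ℂ) = 1 - (t j + N) + x by push_cast; ring] at a4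
      rw [div_eq_mul_inv, norm_mul]
      exact mul_le_mul a3 a4 (norm_nonneg _) (hC₃ j).le
    · have a5 := h₅ (x - 5 * N) (by linarith)
      have a6 := h₆ (5 * N + x) (by positivity)
      rw [show 5 - ∑ j, t j + ((x - 5 * N : ℝ) : ℂ) = 5 - (∑ j, t j + 5 * N) + x by
        push_cast; ring] at a5
      rw [show ∑ j, t j - 4 + ((5 * N + x : ℝ) : ℂ) = ∑ j, t j + 5 * N - 4 + x by
        push_cast; ring] at a6
      rw [hsum, div_eq_mul_inv, norm_mul]
      exact mul_le_mul a5 a6 (norm_nonneg _) hC₅.le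
  have key := hκ _ hN' x hx2
  rw [expParam_add_nat] at key
  have a1 := h₁ N
  have a2 := h₂ x
  have a3 := norm_one_sub_qPow_sq_le hτ hx
  rw [key]
  generalize modFactor τ (∑ j, (t j + N) - 4) / ∏ j, modFactor τ (t j + N) = m at *
  rw [norm_mul, norm_mul, norm_mul, norm_mul, norm_mul, norm_qPow_ofReal]
  calc _ ≤ ‖κ‖ * C₁ * (2 * Real.exp (-(2 * π * τ.im * x))) * C₂ *
        ((∏ j, C₃ j * C₄ j) * (C₅ * C₆)) := by
        gcongr
    _ = _ := by ring

theorem exists_bound_integrand_add_nat {τ : ℂ} (hτ : 0 < τ.im) {t : Fin 5 → ℂ}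
    (h : Admissible τ t) : ∃ C : ℝ, ∀ N : ℕ, ∀ᵐ x : ℝ,
      ‖nassrallahRahmanIntegrand τ (fun j => t j + N) x‖ ≤
        C * Real.exp (-(2 * π * τ.im * |x|)) := by
  obtain ⟨C₁, h₁⟩ := exists_bound_integrand_near hτ h
  obtain ⟨C₂, h₂⟩ := exists_bound_integrand_far hτ h
  refine ⟨max C₁ C₂, fun N => ae_norm_le_of_even
    (f := fun x : ℝ => nassrallahRahmanIntegrand τ (fun j => t j + N) x)
    (g := fun x => max C₁ C₂ * Real.exp (-(2 * π * τ.im * x)))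
    (fun x => by simp only [ofReal_neg, nassrallahRahmanIntegrand_neg]) fun x hx hx2 => ?_⟩
  rw [nassrallahRahmanIntegrand_eq, expParam_add_nat]
  rcases le_total x (5 * N) with hle | hle
  · exact (h₁ N x hx hle hx2).trans (by gcongr; exact le_max_left _ _)
  · exact (h₂ N x hle hx2).trans (by gcongr; exact le_max_right _ _)

/-! ### The limit of infinite shifts. -/

/-- The limit of the base `q` weight when all parameters are shifted to infinity. -/
noncomputable def hypLimitWeight (τ : ℂ) (x : ℂ) : ℂ :=
  (qFac τ (1 + 2 * x) * qFac τ (1 - 2 * x))⁻¹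

theorem tendsto_hypWeight_add_nat {τ : ℂ} (hτ : 0 < τ.im) (t : Fin 5 → ℂ) (x : ℂ) :
    Tendsto (fun N : ℕ => hypWeight τ (fun j => t j + N) x) atTop (𝓝 (hypLimitWeight τ x)) := by
  have h := tendsto_qFac_add_nat hτ
  have hN : ∀ w : ℂ, Tendsto (fun N : ℕ => qFac τ (w + 5 * N)) atTop (𝓝 1) := fun w => by
    have := (h w).comp (tendsto_id.const_mul_atTop' (by norm_num : 0 < 5))
    simpa [Function.comp_def] using this
  have hnum : Tendsto (fun N : ℕ => ∏ j, (qFac τ (t j + N + x) * qFac τ (t j + N - x))) atTop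
      (𝓝 1) := by
    have : Tendsto (fun N : ℕ => ∏ j, (qFac τ (t j + x + N) * qFac τ (t j - x + N))) atTop
        (𝓝 (∏ _j : Fin 5, 1 * 1)) :=
      tendsto_finsetProd _ fun j _ => (h (t j + x)).mul (h (t j - x))
    simp only [mul_one, Finset.prod_const_one] at this
    refine this.congr fun N => Finset.prod_congr rfl fun j _ => ?_
    rw [add_right_comm (t j), sub_add_eq_add_sub (t j)]
  have hden : Tendsto (fun N : ℕ => (qFac τ (∑ j, (t j + N) - 4 + x) *
      qFac τ (∑ j, (t j + N) - 4 - x))⁻¹) atTop (𝓝 1) := by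
    have := ((hN (∑ j, t j - 4 + x)).mul (hN (∑ j, t j - 4 - x))).inv₀ (by simp)
    rw [mul_one, inv_one] at this
    refine this.congr fun N => ?_
    have hsum : ∑ j, (t j + N) = ∑ j, t j + 5 * N := by
      rw [Finset.sum_add_distrib]; simp
    rw [hsum]
    congr 3 <;> ring
  have := (hnum.mul_const (hypLimitWeight τ x)).mul hden
  rw [one_mul, mul_one] at this
  refine this.congr fun N => ?_
  rw [hypWeight, hypLimitWeight, div_eq_mul_inv, mul_inv (qFac τ (1 + 2 * x) * _), mul_assoc]

theorem tendsto_hypIntegral_add_nat {τ : ℂ} (hτ : 0 < τ.im) {t : Fin 5 → ℂ}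
    (h : Admissible τ t) :
    MeasureTheory.Integrable (fun x : ℝ =>
      trigWeight (qTildePow τ 1) (expParam t) (cexp (2 * π * I * x)) * hypLimitWeight τ x) ∧
    Tendsto (fun N : ℕ => hypIntegral τ (fun j => t j + N)) atTop (𝓝 (∫ x : ℝ,
      trigWeight (qTildePow τ 1) (expParam t) (cexp (2 * π * I * x)) * hypLimitWeight τ x)) := by
  obtain ⟨C, hC⟩ := exists_bound_integrand_add_nat hτ h
  have hc : 0 < 2 * π * τ.im := by positivity
  have hbound : MeasureTheory.Integrable fun x : ℝ => C * Real.exp (-(2 * π * τ.im * |x|)) :=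
    (integrable_exp_neg_mul_abs hc).const_mul C
  have hmeas : ∀ N : ℕ, MeasureTheory.AEStronglyMeasurable
      (fun x : ℝ => nassrallahRahmanIntegrand τ (fun j => t j + N) x) MeasureTheory.volume :=
    fun N => (integrable_nassrallahRahmanIntegrand hτ
      (h.congr fun j => by simp)).aestronglyMeasurable
  have hlim : ∀ x : ℝ, Tendsto (fun N : ℕ => nassrallahRahmanIntegrand τ (fun j => t j + N) x)
      atTop (𝓝 (trigWeight (qTildePow τ 1) (expParam t) (cexp (2 * π * I * x)) *
        hypLimitWeight τ x)) := fun x => by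
    simp only [nassrallahRahmanIntegrand_eq, expParam_add_nat]
    exact (tendsto_hypWeight_add_nat hτ t x).const_mul _
  refine ⟨hbound.mono' (aestronglyMeasurable_of_tendsto_ae atTop hmeas
    (MeasureTheory.ae_of_all _ hlim)) ?_, MeasureTheory.tendsto_integral_of_dominated_convergence _
      hmeas hbound hC (MeasureTheory.ae_of_all _ hlim)⟩
  filter_upwards [MeasureTheory.ae_all_iff.mpr hC] with x hx
  exact le_of_tendsto (hlim x).norm (Eventually.of_forall hx)

/-! ### Folding the limiting integral onto a unit interval. -/

theorem tripleTerm_add_index (τ w : ℂ) (n m : ℤ) :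
    tripleTerm τ w (n + m) = tripleTerm τ w m * tripleTerm τ (w + m * τ) n := by
  simp only [tripleTerm, jacobiTheta₂_term, ← Complex.exp_add]
  congr 1
  push_cast
  ring

theorem hasSum_tripleTerm {τ : ℂ} (hτ : 0 < τ.im) (w : ℂ) :
    HasSum (tripleTerm τ w) (qPochhammer (cexp (2 * π * I * τ)) (cexp (2 * π * I * τ)) *
      qTheta (cexp (2 * π * I * w)) (cexp (2 * π * I * τ))) := by
  rw [jacobi_triple_product hτ]
  exact hasSum_jacobiTheta₂_term (w + 1 / 2 - τ / 2) hτ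

theorem qTheta_eq_tripleTerm_mul {τ : ℂ} (hτ : 0 < τ.im) (w : ℂ) (m : ℤ) :
    qTheta (cexp (2 * π * I * w)) (cexp (2 * π * I * τ)) =
      tripleTerm τ w m * qTheta (cexp (2 * π * I * (w + m * τ))) (cexp (2 * π * I * τ)) := by
  have hq := norm_exp_two_pi_I_mul_lt_one hτ
  have h1 := (Equiv.addRight m).hasSum_iff.mpr (hasSum_tripleTerm hτ w)
  have h2 := (hasSum_tripleTerm hτ (w + m * τ)).mul_left (tripleTerm τ w m)
  have h3 : tripleTerm τ w ∘ Equiv.addRight m =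
      fun n => tripleTerm τ w m * tripleTerm τ (w + m * τ) n :=
    funext fun n => tripleTerm_add_index τ w n m
  rw [h3] at h1
  refine mul_left_cancel₀ (qPochhammer_ne_zero_of_norm_lt_one hq hq) ?_
  rw [h1.unique h2]
  ring

theorem HasSum.int_even_add_odd {f : ℤ → ℂ} {S : ℂ} (h : HasSum f S) :
    HasSum (fun n : ℤ => f (2 * n) + f (2 * n + 1)) S := by
  have h1 := ((Int.divModEquiv 2).symm.hasSum_iff.mpr h).prod_fiberwise
    fun n => hasSum_fintype _
  simpa [Fin.sum_univ_two, Int.divModEquiv, mul_comm, add_comm] using h1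

theorem qTheta_qPow {τ : ℂ} (hτ : 0 < τ.im) (u : ℂ) :
    qTheta (qPow τ u) (qPow τ 1) = (1 - qPow τ u) * (qFac τ (1 + u) * qFac τ (1 - u)) := by
  rw [qTheta, ← qPow_sub, ← qFac, ← qFac, qFac_eq_mul hτ u, add_comm u]; ring

/-- The summand is $(1-q^{2(x+n)})/\theta(q^{2(x+n)})$. Quasi-periodicity moves every denominator to
$\theta(q^{2x})$, and the numerators become the terms of index $2n$ and $2n+1$ of the triple product
series, which sums to $(q;q)_\infty\theta(q^{2x})$. -/
theorem hasSum_hypLimitWeight {τ : ℂ} (hτ : 0 < τ.im) {x : ℝ} (hx : ∀ n : ℤ, 2 * x ≠ n) :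
    HasSum (fun n : ℤ => hypLimitWeight τ (x + n)) (qPochhammer (qPow τ 1) (qPow τ 1)) := by
  have hq1 : cexp (2 * π * I * τ) = qPow τ 1 := by rw [qPow, mul_one]
  have hnz : ∀ n : ℤ, (1 - qPow τ (2 * (x + n))) *
      (qFac τ (1 + 2 * (x + n)) * qFac τ (1 - 2 * (x + n))) ≠ 0 := by
    intro n
    refine mul_ne_zero (fun h0 => ?_) (mul_ne_zero ?_ ?_)
    · refine qPow_ofReal_sq_ne_one hτ (x := x + n)
        (fun m hm => hx (m - 2 * n) (by push_cast; linarith)) ?_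
      rw [sq, ← qPow_add, ← two_mul]
      push_cast
      exact (sub_eq_zero.mp h0).symm
    · have := qFac_ofReal_ne_zero hτ (x := 1 + 2 * (x + n))
        fun m hm => hx (m - 1 - 2 * n) (by push_cast; linarith)
      simpa using this
    · have := qFac_ofReal_ne_zero hτ (x := 1 - 2 * (x + n))
        fun m hm => hx (1 - 2 * n - m) (by push_cast; linarith)
      simpa using this
  set w : ℂ := 2 * x * τ with hw
  have hwn : ∀ n : ℤ, cexp (2 * π * I * (w + (2 * n : ℤ) * τ)) = qPow τ (2 * (x + n)) := by
    intro n; rw [qPow, hw]; congr 1; push_cast; ring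
  have hw0 : cexp (2 * π * I * w) = qPow τ (2 * (x + (0 : ℤ))) := by
    rw [qPow, hw]; congr 1; push_cast; ring
  set θ := qTheta (cexp (2 * π * I * w)) (qPow τ 1) with hθ
  have hθ0 : θ ≠ 0 := by rw [hθ, hw0, qTheta_qPow hτ]; exact hnz 0
  have hterm : ∀ n : ℤ, hypLimitWeight τ (x + n) =
      (tripleTerm τ w (2 * n) + tripleTerm τ w (2 * n + 1)) / θ := by
    intro n
    have h1 := qTheta_eq_tripleTerm_mul hτ w (2 * n)
    rw [hwn, hq1, ← hθ, qTheta_qPow hτ] at h1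
    have h2 : tripleTerm τ w (2 * n + 1) = -(qPow τ (2 * (x + n)) * tripleTerm τ w (2 * n)) := by
      have h3 := tripleTerm_succ τ (w + (2 * n : ℤ) * τ) 0
      have h4 : ∀ v, tripleTerm τ v 0 = 1 := fun v => by simp [tripleTerm, jacobiTheta₂_term]
      rw [zero_add, h4, hwn, mul_one] at h3
      rw [add_comm, tripleTerm_add_index, h3]; ring
    have h5 := right_ne_zero_of_mul (hnz n)
    rw [eq_div_iff hθ0, h2, h1, hypLimitWeight]
    generalize qFac τ (1 + 2 * (x + n)) * qFac τ (1 - 2 * (x + n)) = D at *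
    field_simp
    ring
  have h := (HasSum.int_even_add_odd (hasSum_tripleTerm hτ w)).div_const θ
  rw [hq1, ← hθ, mul_div_cancel_right₀ _ hθ0] at h
  simp only [hterm]
  exact h

/-- The line is cut into unit intervals; integrability permits summing under the integral, where
periodicity of $T$ leaves only the sum of the weights. -/
theorem integral_mul_hypLimitWeight {τ : ℂ} (hτ : 0 < τ.im) {T : ℝ → ℂ}
    (hper : Function.Periodic T 1)
    (hint : MeasureTheory.Integrable fun x : ℝ => T x * hypLimitWeight τ x) :
    ∫ x : ℝ, T x * hypLimitWeight τ x =
      qPochhammer (qPow τ 1) (qPow τ 1) * ∫ x in (0 : ℝ)..1, T x := by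
  have h1 := hint.hasSum_intervalIntegral_comp_add_int
  have h2 := hint.norm.hasSum_intervalIntegral_comp_add_int.summable
  simp only [intervalIntegral.integral_of_le zero_le_one] at h1 h2 ⊢
  have h3 := MeasureTheory.hasSum_integral_of_summable_integral_norm
    (μ := MeasureTheory.volume.restrict (Set.Ioc (0 : ℝ) 1))
    (F := fun (n : ℤ) (x : ℝ) => T (x + n) * hypLimitWeight τ ((x + n : ℝ) : ℂ))
    (fun n => (hint.comp_add_right (n : ℝ)).integrableOn) h2
  rw [h1.unique h3, ← MeasureTheory.integral_const_mul]
  refine MeasureTheory.integral_congr_ae (MeasureTheory.ae_restrict_of_ae ?_)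
  filter_upwards [ae_two_mul_ne_int] with x hx
  have hT : ∀ n : ℤ, T (x + n) = T x := fun n => by simpa using hper.int_mul n x
  simp only [hT, ofReal_add, ofReal_intCast]
  rw [((hasSum_hypLimitWeight hτ hx).mul_left (T x)).tsum_eq, mul_comm]

/-! ### Evaluation of the hyperbolic integral. -/

theorem tendsto_hypNormalized_add_nat {τ : ℂ} (hτ : 0 < τ.im) {t : Fin 5 → ℂ}
    (h : Admissible τ t) :
    Tendsto (fun N : ℕ => hypNormalized τ (fun j => t j + N)) atTop
      (𝓝 (qPochhammer (qPow τ 1) (qPow τ 1) * trigIntegral (qTildePow τ 1) (expParam t))) := by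
  obtain ⟨hint, hlim⟩ := tendsto_hypIntegral_add_nat hτ h
  rw [integral_mul_hypLimitWeight hτ (T := fun x : ℝ =>
    trigWeight (qTildePow τ 1) (expParam t) (cexp (2 * π * I * x))) (fun x => by
      simp only
      rw [← exp_add_int (2 * π * I * x) 1]
      congr 2
      push_cast; ring) hint] at hlim
  have hq := tendsto_qFac_add_nat hτ
  have hnum : Tendsto (fun N : ℕ => ∏ j, qFac τ (∑ k, (t k + N) - (t j + N) - 3)) atTop
      (𝓝 1) := by
    have : Tendsto (fun N : ℕ => ∏ j, qFac τ (∑ k, t k - t j - 3 + (4 * N : ℕ))) atTop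
        (𝓝 (∏ _j : Fin 5, 1)) := tendsto_finsetProd _ fun j _ =>
      (hq _).comp (tendsto_id.const_mul_atTop' (by norm_num : 0 < 4))
    rw [Finset.prod_const_one] at this
    refine this.congr fun N => Finset.prod_congr rfl fun j _ => ?_
    rw [Finset.sum_add_distrib]
    congr 1
    simp
    ring
  have hden : Tendsto (fun N : ℕ => ∏ k, ∏ m ∈ Finset.Ioi k, qFac τ (t k + N + (t m + N) - 1))
      atTop (𝓝 1) := by
    have : Tendsto (fun N : ℕ => ∏ k, ∏ m ∈ Finset.Ioi k, qFac τ (t k + t m - 1 + (2 * N : ℕ)))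
        atTop (𝓝 (∏ k : Fin 5, ∏ _m ∈ Finset.Ioi k, 1)) := tendsto_finsetProd _ fun k _ =>
      tendsto_finsetProd _ fun m _ =>
        (hq _).comp (tendsto_id.const_mul_atTop' (by norm_num : 0 < 2))
    simp only [Finset.prod_const_one] at this
    refine this.congr fun N => Finset.prod_congr rfl fun k _ => Finset.prod_congr rfl fun m _ => ?_
    congr 1
    push_cast
    ring
  have := (hlim.mul hnum).div hden one_ne_zero
  rw [mul_one, div_one] at this
  exact this

theorem hypNormalized_eq {τ : ℂ} (hτ : 0 < τ.im) {t : Fin 5 → ℂ} (h : Admissible τ t) :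
    hypNormalized τ t =
      qPochhammer (qPow τ 1) (qPow τ 1) * trigIntegral (qTildePow τ 1) (expParam t) := by
  refine tendsto_nhds_unique ?_ (tendsto_hypNormalized_add_nat hτ h)
  have : ∀ N : ℕ, hypNormalized τ (fun j => t j + N) = hypNormalized τ t := fun N => by
    simpa using hypNormalized_add_nat hτ h Finset.univ N
  simp only [this]
  exact tendsto_const_nhds

/-- Each $\tau$-shifted factorial on the right splits into its two bases: the $\tilde q$-symbols
match the trigonometric evaluation, the $q$-symbols match `hypNormalized`, and $(q;q)_\infty/(\tilde
q;\tilde q)_\infty$ supplies the prefactor. -/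
theorem hypIntegral_eq {τ : ℂ} (hτ : 0 < τ.im) {t : Fin 5 → ℂ} (h : Admissible τ t) :
    hypIntegral τ t = 2 * qPow τ (-(1 / 24)) * qTildePow τ (1 / 24) / Complex.sqrt (-I * τ) *
      ((∏ j, tauFactorial (∑ k, t k - t j - 3) τ) /
        ∏ k, ∏ m ∈ Finset.Ioi k, tauFactorial (t k + t m - 1) τ) := by
  have hp := norm_qTildePow_one_lt_one hτ
  have h1 := hypNormalized_eq hτ h
  have h2 := trigIntegral_eq (neg_one_div_im_pos hτ) (expParam_ne_zero t)
    fun j => norm_expParam_lt_one (h.1 j)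
  rw [← qTildePow_one] at h2
  have h3 := qPochhammer_modular hτ
  have e1 : ∀ j, tauFactorial (∑ k, t k - t j - 3) τ =
      qPochhammer ((∏ k, expParam t k) / expParam t j) (qTildePow τ 1) /
        qFac τ (∑ k, t k - t j - 3) := fun j => by
    rw [tauFactorial, ← qFac, prod_expParam, expParam, ← Complex.exp_sub, ← exp_add_int _ (-3)]
    congr 3; push_cast; ring
  have e2 : ∀ k m, tauFactorial (t k + t m - 1) τ =
      qPochhammer (expParam t k * expParam t m) (qTildePow τ 1) / qFac τ (t k + t m - 1) :=
    fun k m => by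
    rw [tauFactorial, ← qFac, expParam, expParam, ← Complex.exp_add, ← exp_add_int _ (-1)]
    congr 3; push_cast; ring
  have hs1 : ∀ j, ‖expParam t j‖ < 1 := fun j => norm_expParam_lt_one (h.1 j)
  have n1 : qPochhammer (qTildePow τ 1) (qTildePow τ 1) ≠ 0 :=
    qPochhammer_ne_zero_of_norm_lt_one hp hp
  have n2 : ∏ j, qPochhammer ((∏ k, expParam t k) / expParam t j) (qTildePow τ 1) ≠ 0 :=
    Finset.prod_ne_zero_iff.mpr fun j _ =>
      qPochhammer_ne_zero_of_norm_lt_one hp (norm_prod_div_lt_one hs1 j)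
  have n3 : ∏ k, ∏ m ∈ Finset.Ioi k,
      qPochhammer (expParam t k * expParam t m) (qTildePow τ 1) ≠ 0 :=
    Finset.prod_ne_zero_iff.mpr fun k _ => Finset.prod_ne_zero_iff.mpr fun m _ =>
      qPochhammer_ne_zero_of_norm_lt_one hp (by
        rw [norm_mul]
        exact mul_lt_one_of_nonneg_of_lt_one_left (norm_nonneg _) (hs1 k) (hs1 m).le)
  have n4 : ∏ j, qFac τ (∑ k, t k - t j - 3) ≠ 0 := by
    refine Finset.prod_ne_zero_iff.mpr fun j _ => OffLattice.qFac_ne_zero hτ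
      (OffLattice.congr (w := ∑ k, t k - t j) ?_ (by simp))
    have a1 := h.sum_im_le j
    have a2 := h.1 j
    have a3 : (∑ k, t k - t j).im < 0 := by rw [sub_im]; linarith
    refine ⟨a3.ne, ?_⟩
    rw [abs_of_neg a3, sub_im]
    linarith [h.2]
  have n5 := h.prod_qFac_ne_zero hτ
  simp only [e1, e2, Finset.prod_div_distrib]
  rw [mul_assoc (2 : ℂ), mul_div_assoc (2 : ℂ), ← h3]
  rw [hypNormalized, div_eq_iff n5] at h1
  rw [trigNormalized] at h2
  generalize qPochhammer (qTildePow τ 1) (qTildePow τ 1) = Pp at *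
  generalize qPochhammer (qPow τ 1) (qPow τ 1) = Pq at *
  generalize ∏ j, qPochhammer ((∏ k, expParam t k) / expParam t j) (qTildePow τ 1) = A at *
  generalize ∏ k, ∏ m ∈ Finset.Ioi k,
    qPochhammer (expParam t k * expParam t m) (qTildePow τ 1) = B at *
  generalize ∏ j, qFac τ (∑ k, t k - t j - 3) = X at *
  generalize ∏ k, ∏ m ∈ Finset.Ioi k, qFac τ (t k + t m - 1) = Y at *
  rw [mul_div_assoc', div_eq_iff n2] at h2
  rw [eq_div_of_mul_eq n4 h1]
  field_simp
  linear_combination Pq * h2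

end HyperbolicBeta

end

theorem proposition5p2 (τ : ℂ) (hτ : 0 < τ.im) (t : Fin 5 → ℂ)
    (ht : ∀ j, (t j).im < 0) (a : ℂ) (ha : a = ∑ j, t j) (ha_im : (τ⁻¹).im < a.im) :
    MeasureTheory.Integrable
        (fun x : ℝ => HyperbolicBeta.nassrallahRahmanIntegrand τ t (x : ℂ)) ∧
      ∫ x : ℝ, HyperbolicBeta.nassrallahRahmanIntegrand τ t (x : ℂ) =
        2 * HyperbolicBeta.qPow τ (-(1 / 24)) * HyperbolicBeta.qTildePow τ (1 / 24) /
            Complex.sqrt (-Complex.I * τ) *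
          ((∏ j, HyperbolicBeta.tauFactorial (a - t j - 3) τ) /
            ∏ k, ∏ m ∈ Finset.Ioi k, HyperbolicBeta.tauFactorial (t k + t m - 1) τ) := by
  have h : HyperbolicBeta.Admissible τ t := ⟨ht, ha ▸ ha_im⟩
  subst ha
  exact ⟨HyperbolicBeta.integrable_nassrallahRahmanIntegrand hτ h,
    HyperbolicBeta.hypIntegral_eq hτ h⟩
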